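/- Write $\mathbb{D}=\{z\in\mathbb{C}:|z|<1\}$. For doubly indexed quantities, $\lim_{u(n)/N\to s}X_{n,N}=X$ means that $X_{n_i,N_i}\to X$ for all sequences $n_i,N_i\to\infty$ of positive integers with $u(n_i)/N_i\to s$. Given $a=(a_n)_{n\ge 0}\subset\mathbb{D}$, let $\Phi_0=1$, $\Phi_{n+1}(z)=z\Phi_n(z)-\overline{a_n}\,\Phi_n^*(z)$ with $\Phi_n^*(z)=z^n\overline{\Phi_n(1/\bar z)}$ be the monic orthogonal polynomials on the unit circle with Verblunsky coefficients $a$, and for $|\beta|=1$, $n\ge1$, let $\Phi_n^{(\beta)}(z)=z\Phi_{n-1}(z)-\bar\beta\,\Phi_{n-1}^*(z)$ be the paraorthogonal polynomials (POPUC). Given $a_0,\dots,a_{p-1}\in\mathbb{D}$, the discriminant is $$\Delta(z)=z^{-p/2}\operatorname{Tr}\bigl(A(a_{p-1},z)\cdots A(a_0,z)\bigr),\qquad A(a,z)=\frac{1}{\sqrt{1-|a|^2}}\begin{pmatrix} z&-\bar a\\ -az&1\end{pmatrix},\qquad z\in\mathbb{C}\setminus\{0\}$$ (the choice of the branch of $z^{-p/2}$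 is immaterial below), and $\nu_\Delta$ is the measure carried by $\Delta^{-1}([-2,2])$ with density $$\frac{d\nu_\Delta}{d\theta}(e^{i\theta})=\frac{1}{\pi p}\,\frac{|\Delta'(e^{i\theta})|}{\sqrt{4-\Delta(e^{i\theta})^2}},$$ where the prime denotes the derivative of $\Delta(e^{i\theta})$ with respect to $\theta$. **Theorem 4.5.** Let $t>0$, $p\in\mathbb{N}$, and let $\alpha_0,\dots,\alpha_{p-1}:[0,t]\to\mathbb{D}$ be measurable. Let $\{\alpha_{n,N}: n,N\in\mathbb{N}_0\}\subset\mathbb{D}$ be such that, for every $j\in\{0,\dots,p-1\}$, $$\lim_{kp/N\to s}\alpha_{kp+j,N}=\alpha_j(s)\qquad\text{for a.e. } s\in[0,t].$$ Let $|\beta|=1$, let $\Phi^{(\beta)}_{n,N}$ be the POPUC with Verblunsky coefficients $(\alpha_{m,N})_{m\ge0}$, and let $\nu^{(\beta)}_{n,N}=\frac1n\sum_{j=1}^n\delta_{z_j}$, where $z_1,\dots,z_n$ are the zeros of $\Phi^{(\beta)}_{n,N}$ counted with multiplicity. For $s\in[0,t]$ let $\Delta_s$ be the discriminant of $\alpha_0(s),\dots,\alpha_{p-1}(s)$.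 Then $\nu_{\Delta_s}$ is, for every $s\in[0,t]$, the equilibrium measure of $\Delta_s^{-1}([-2,2])$, that is, the unique minimizer of the logarithmic energy $\iint\log\frac{1}{|z-w|}\,d\mu(z)\,d\mu(w)$ among the probability measures $\mu$ on this set, with finite minimal energy; the map $s\mapsto\nu_{\Delta_s}$ is (a.e.) measurable; and, in the sense of weak convergence of measures, $$\lim_{n/N\to t}\nu^{(\beta)}_{n,N}=\frac1t\int_0^t\nu_{\Delta_s}\,ds .$$ -/

import Mathlib

open MeasureTheory Filter Topology Set Polynomial
open scoped ENNReal BoundedContinuousFunction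

noncomputable section

/-- The reversed polynomial `P^*(z) = z ^ n * conj (P (1 / conj z))` of a polynomial of degree at
most `n`: the coefficients are conjugated and their order is reversed. -/
def reversedPoly (n : ℕ) (P : ℂ[X]) : ℂ[X] :=
  (P.map (starRingEnd ℂ)).reflect n

/-- The monic orthogonal polynomials on the unit circle with Verblunsky coefficients `a`:
`Φ_0 = 1` and `Φ_{n+1}(z) = z Φ_n(z) - conj (a_n) Φ_n^*(z)` (Szegő recursion). -/
def opuc (a : ℕ → ℂ) : ℕ → ℂ[X]
  | 0 => 1
  | n + 1 => X * opuc a n - C (starRingEnd ℂ (a n)) * reversedPoly n (opuc a n)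

/-- The paraorthogonal polynomials `Φ_n^{(β)}(z) = z Φ_{n-1}(z) - conj β Φ_{n-1}^*(z)`, `n ≥ 1`
(with `Φ_0^{(β)} = 1`). -/
def popuc (β : ℂ) (a : ℕ → ℂ) : ℕ → ℂ[X]
  | 0 => 1
  | n + 1 => X * opuc a n - C (starRingEnd ℂ β) * reversedPoly n (opuc a n)

/-- The zero-counting measure `n⁻¹ ∑ δ_{z_j}` of the paraorthogonal polynomial of degree `n`,
where `z_1, …, z_n` are its zeros, counted with multiplicity. -/
def popucZeroMeasure (β : ℂ) (a : ℕ → ℂ) (n : ℕ) : Measure ℂ :=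
  (n : ℝ≥0∞)⁻¹ • ((popuc β a n).roots.map fun z => Measure.dirac z).sum

/-- The limit `lim_{u(n)/N → s} X_{n,N} = x` of a doubly indexed family: convergence along all
sequences `n_i, N_i → ∞` such that `u(n_i) / N_i → s`. -/
def HasRatioLimit {E : Type*} [TopologicalSpace E] (u : ℕ → ℕ) (X : ℕ → ℕ → E) (s : ℝ) (x : E) :
    Prop :=
  ∀ n N : ℕ → ℕ, Tendsto n atTop atTop → Tendsto N atTop atTop →
    Tendsto (fun i => (u (n i) : ℝ) / (N i : ℝ)) atTop (𝓝 s) →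
      Tendsto (fun i => X (n i) (N i)) atTop (𝓝 x)

/-- The transfer matrix `A(α, z)`. -/
def transferMatrix (α z : ℂ) : Matrix (Fin 2) (Fin 2) ℂ :=
  (((√(1 - ‖α‖ ^ 2))⁻¹ : ℝ) : ℂ) • !![z, -(starRingEnd ℂ α); -(α * z), 1]

/-- The discriminant `Δ(z) = z ^ (-p/2) * Tr (A(a_{p-1}, z) ⋯ A(a_0, z))`, `z ≠ 0`, of the
`p`-periodic sequence with period `a_0, …, a_{p-1}`. For odd `p` the principal branch of the power
is used; the other branch changes the sign of `Δ`, and neither `Δ⁻¹([-2,2])` nor the density below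
depends on that sign. -/
def discriminant {p : ℕ} (a : Fin p → ℂ) (z : ℂ) : ℂ :=
  z ^ (-(p : ℂ) / 2) * (List.ofFn fun j => transferMatrix (a j) z).reverse.prod.trace

/-- The finite-gap set `Δ⁻¹([-2,2])`, a subset of `ℂ \ {0}`. -/
def bandSet {p : ℕ} (a : Fin p → ℂ) : Set ℂ :=
  {z | z ≠ 0 ∧ ∃ x ∈ Icc (-2 : ℝ) 2, discriminant a z = (x : ℂ)}

/-- The measure `ν_Δ`: it lives on `Δ⁻¹([-2,2])`, and its density with respect to `dθ` at
`e^{iθ}` is `(π p)⁻¹ |Δ'(e^{iθ})| / √(4 - Δ(e^{iθ})²)`, where the prime is the derivative of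
`Δ(e^{iθ})` with respect to `θ` (recall that `Δ` is real on the unit circle). -/
def discriminantMeasure {p : ℕ} (a : Fin p → ℂ) : Measure ℂ :=
  Measure.map (fun θ : ℝ => Complex.exp (θ * Complex.I))
    ((volume.restrict
        {θ : ℝ | θ ∈ Ioc (-Real.pi) Real.pi ∧ Complex.exp (θ * Complex.I) ∈ bandSet a}).withDensity
      fun θ => ENNReal.ofReal
        ((Real.pi * p)⁻¹ *
          (‖deriv (fun φ : ℝ => discriminant a (Complex.exp (φ * Complex.I))) θ‖ /
            √(4 - (discriminant a (Complex.exp (θ * Complex.I))).re ^ 2))))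

/-- The logarithmic energy `∬ log (1 / |z - w|) dμ(z) dμ(w)`, as the integral of the positive part
minus the integral of the negative part. The kernel is `+∞` on the diagonal; for a finite measure
with bounded support the second integral is finite. -/
def logEnergy (μ : Measure ℂ) : EReal :=
  ((∫⁻ z, ∫⁻ w, (-ENNReal.log ‖z - w‖ₑ).toENNReal ∂μ ∂μ : ℝ≥0∞) : EReal) -
    ((∫⁻ z, ∫⁻ w, (ENNReal.log ‖z - w‖ₑ).toENNReal ∂μ ∂μ : ℝ≥0∞) : EReal)

/-- `ν` is the equilibrium measure of the compact set `K`: a probability measure on `K` of finite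
logarithmic energy which is the unique minimizer of the energy among the probability measures
on `K` (any competitor whose energy is not larger is `ν` itself). -/
def IsEquilibriumMeasure (K : Set ℂ) (ν : Measure ℂ) : Prop :=
  IsProbabilityMeasure ν ∧ ν Kᶜ = 0 ∧ logEnergy ν < ⊤ ∧
    ∀ μ : Measure ℂ, IsProbabilityMeasure μ → μ Kᶜ = 0 → logEnergy μ ≤ logEnergy ν → μ = ν

/-- The averaged measure `t⁻¹ ∫_0^t ν_s ds`, that is `E ↦ t⁻¹ ∫_0^t ν_s(E) ds`, for an
(almost everywhere) measurable family `ν_s`. -/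
def averageMeasure (t : ℝ) (ν : ℝ → Measure ℂ) : Measure ℂ :=
  ENNReal.ofReal t⁻¹ • Measure.bind (volume.restrict (Icc 0 t)) ν

end

/-!
Write `log |Φ_n^*(z)|`, for `z` near `0`, as a sum of terms `log |1 - a_i z b_i|`, where `b_i` is
the orbit of a point of the closed disk under the strictly contracting maps
`b ↦ (z b - conj a_i) / (1 - a_i z b)`. The starting point of the orbit is forgotten exponentially
fast, so a stretch of nearly `p`-periodic coefficients contributes, over each period, nearly the
value belonging to the periodic sequence. Since the zeros of the paraorthogonal polynomials lie on
the unit circle, the logarithmic potential of the zero-counting measure near `0` is therefore a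
Riemann sum. Potentials near `0` determine the moments of a measure on the circle, so weak
convergence follows once the contribution of a period is identified with `p` times the potential
of `ν_Δ`.

For that, all solutions of `Δ² - 2 = 2 cos x` with `0 < x < π` are simple and lie on the unit
circle, and the area formula shows that `ν_Δ` is the average over `x` of their normalized counting
measures. Jensen's formula in `x` then gives the potential of `ν_Δ`: it is the logarithm of the
spectral radius of the monodromy matrix, up to normalization. In particular it is constant on the
bands, and as the logarithmic energy is positive definite on the circle, `ν_Δ` is the equilibrium
measure.
-/

/-! ### Orthogonal and paraorthogonal polynomials -/

section ReversedPoly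

variable {n : ℕ} {P : ℂ[X]}

theorem natDegree_reversedPoly_le (hP : P.natDegree ≤ n) : (reversedPoly n P).natDegree ≤ n :=
  natDegree_reflect_le.trans (max_le le_rfl (natDegree_map_le.trans hP))

theorem reversedPoly_reversedPoly (n : ℕ) (P : ℂ[X]) : reversedPoly n (reversedPoly n P) = P := by
  ext i
  simp [reversedPoly, coeff_reflect]

theorem reversedPoly_X_mul (hP : P.natDegree ≤ n) :
    reversedPoly (n + 1) (X * P) = reversedPoly n P := by
  rw [reversedPoly, Polynomial.map_mul, map_X, mul_comm,
    reflect_mul _ _ (natDegree_map_le.trans hP) natDegree_X_le, reflect_one_X, mul_one,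
    reversedPoly]

theorem reversedPoly_succ (hP : P.natDegree ≤ n) :
    reversedPoly (n + 1) P = X * reversedPoly n P := by
  have h := reflect_mul _ 1 (natDegree_map_le (f := starRingEnd ℂ) |>.trans hP)
    (natDegree_one.trans_le zero_le_one)
  rwa [mul_one, reflect_one, pow_one, mul_comm _ X] at h

theorem reversedPoly_sub_C_mul (n : ℕ) (P Q : ℂ[X]) (c : ℂ) :
    reversedPoly n (P - C c * Q) = reversedPoly n P - C (starRingEnd ℂ c) * reversedPoly n Q := by
  simp [reversedPoly, reflect_sub, reflect_C_mul]

theorem isMonicOfDegree_X_mul_sub_C_mul_reversedPoly (hP : IsMonicOfDegree P n) (c : ℂ) :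
    IsMonicOfDegree (X * P - C c * reversedPoly n P) (n + 1) := by
  have hQ : (C c * reversedPoly n P).natDegree < 1 + n := by
    have := natDegree_C_mul_le c (reversedPoly n P)
    have := natDegree_reversedPoly_le hP.natDegree_eq.le
    omega
  simpa only [add_comm] using ((isMonicOfDegree_X ℂ).mul hP).sub hQ

end ReversedPoly

theorem isMonicOfDegree_opuc (a : ℕ → ℂ) (n : ℕ) : IsMonicOfDegree (opuc a n) n := by
  induction n with
  | zero => exact isMonicOfDegree_zero_iff.mpr rfl
  | succ n ih => exact isMonicOfDegree_X_mul_sub_C_mul_reversedPoly ih _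

theorem isMonicOfDegree_popuc (β : ℂ) (a : ℕ → ℂ) (n : ℕ) : IsMonicOfDegree (popuc β a n) n := by
  cases n with
  | zero => exact isMonicOfDegree_zero_iff.mpr rfl
  | succ n => exact isMonicOfDegree_X_mul_sub_C_mul_reversedPoly (isMonicOfDegree_opuc a n) _

theorem eval_opuc_succ (a : ℕ → ℂ) (n : ℕ) (z : ℂ) :
    (opuc a (n + 1)).eval z =
      z * (opuc a n).eval z - starRingEnd ℂ (a n) * (reversedPoly n (opuc a n)).eval z := by
  simp [opuc]

theorem eval_reversedPoly_opuc_succ (a : ℕ → ℂ) (n : ℕ) (z : ℂ) :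
    (reversedPoly (n + 1) (opuc a (n + 1))).eval z =
      (reversedPoly n (opuc a n)).eval z - a n * (z * (opuc a n).eval z) := by
  have hd : (opuc a n).natDegree ≤ n := (isMonicOfDegree_opuc a n).natDegree_eq.le
  simp [opuc, reversedPoly_sub_C_mul, reversedPoly_X_mul hd,
    reversedPoly_succ (natDegree_reversedPoly_le hd), reversedPoly_reversedPoly]

theorem norm_sub_mul_sq_sub_norm_sub_conj_mul_sq (a u v : ℂ) :
    ‖v - a * u‖ ^ 2 - ‖u - starRingEnd ℂ a * v‖ ^ 2 = (1 - ‖a‖ ^ 2) * (‖v‖ ^ 2 - ‖u‖ ^ 2) := by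
  simp only [← Complex.normSq_eq_norm_sq, Complex.normSq_apply, Complex.sub_re, Complex.sub_im,
    Complex.mul_re, Complex.mul_im, Complex.conj_re, Complex.conj_im]
  ring

theorem one_sub_norm_sq_pos {a : ℂ} (ha : ‖a‖ < 1) : 0 < 1 - ‖a‖ ^ 2 :=
  sub_pos.mpr (pow_lt_one₀ (norm_nonneg a) ha two_ne_zero)

theorem norm_sub_conj_mul_lt_iff {a : ℂ} (ha : ‖a‖ < 1) (u v : ℂ) :
    ‖u - starRingEnd ℂ a * v‖ < ‖v - a * u‖ ↔ ‖u‖ < ‖v‖ := by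
  rw [← pow_lt_pow_iff_left₀ (norm_nonneg _) (norm_nonneg _) two_ne_zero, ← sub_pos,
    norm_sub_mul_sq_sub_norm_sub_conj_mul_sq, mul_pos_iff_of_pos_left (one_sub_norm_sq_pos ha),
    sub_pos, pow_lt_pow_iff_left₀ (norm_nonneg _) (norm_nonneg _) two_ne_zero]

section Zeros

variable {a : ℕ → ℂ} {z : ℂ}

theorem norm_mul_eval_opuc_lt (ha : ∀ n, ‖a n‖ < 1) (hz : ‖z‖ < 1) (n : ℕ) :
    ‖z * (opuc a n).eval z‖ < ‖(reversedPoly n (opuc a n)).eval z‖ := by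
  induction n with
  | zero => simpa [opuc, reversedPoly] using hz
  | succ n ih =>
    rw [norm_mul]
    refine (mul_le_of_le_one_left (norm_nonneg _) hz.le).trans_lt ?_
    rwa [eval_opuc_succ, eval_reversedPoly_opuc_succ, norm_sub_conj_mul_lt_iff (ha n)]

theorem lt_norm_mul_eval_opuc (ha : ∀ n, ‖a n‖ < 1) (hz : 1 < ‖z‖) (n : ℕ) :
    ‖(reversedPoly n (opuc a n)).eval z‖ < ‖z * (opuc a n).eval z‖ := by
  induction n with
  | zero => simpa [opuc, reversedPoly] using hz
  | succ n ih =>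
    rw [norm_mul]
    refine lt_of_lt_of_le ?_ (le_mul_of_one_le_left (norm_nonneg _) hz.le)
    rw [eval_opuc_succ, eval_reversedPoly_opuc_succ]
    have h := norm_sub_conj_mul_lt_iff ((Complex.norm_conj (a n)).trans_lt (ha n))
      ((reversedPoly n (opuc a n)).eval z) (z * (opuc a n).eval z)
    rw [Complex.conj_conj] at h
    exact h.mpr ih

theorem norm_eq_one_of_isRoot_popuc {β : ℂ} (hβ : ‖β‖ = 1) (ha : ∀ n, ‖a n‖ < 1) {n : ℕ}
    (hz : (popuc β a n).IsRoot z) : ‖z‖ = 1 := by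
  cases n with
  | zero => simp [popuc] at hz
  | succ n =>
    have h : z * (opuc a n).eval z = starRingEnd ℂ β * (reversedPoly n (opuc a n)).eval z := by
      simpa [popuc, sub_eq_zero] using hz
    have hnorm : ‖z * (opuc a n).eval z‖ = ‖(reversedPoly n (opuc a n)).eval z‖ := by
      rw [h, norm_mul, Complex.norm_conj, hβ, one_mul]
    by_contra hne
    rcases lt_or_gt_of_ne hne with hlt | hgt
    · exact (norm_mul_eval_opuc_lt ha hlt n).ne hnorm
    · exact (lt_norm_mul_eval_opuc ha hgt n).ne' hnorm

end Zeros

/-! ### Schur iterates -/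

/-- The map `b ↦ (z b - conj a) / (1 - a z b)` of the closed unit disk. It describes how the
quotient `Φ_n / Φ_n^*` evolves under the Szegő recursion. -/
noncomputable def schurStep (z a b : ℂ) : ℂ := (z * b - starRingEnd ℂ a) / (1 - a * (z * b))

/-- The orbit of `b` under the maps `schurStep z (a n)`. Started at `b = 1` it consists of the
quotients `Φ_n / Φ_n^*`. -/
noncomputable def schurIter (z : ℂ) (a : ℕ → ℂ) (b : ℂ) : ℕ → ℂ
  | 0 => b
  | n + 1 => schurStep z (a n) (schurIter z a b n)

section SchurStep

variable {z a b b' : ℂ}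

theorem norm_mul_mul_le (ha : ‖a‖ ≤ 1) (hb : ‖b‖ ≤ 1) : ‖a * (z * b)‖ ≤ ‖z‖ := by
  rw [norm_mul, norm_mul]
  exact (mul_le_of_le_one_left (by positivity) ha).trans
    (mul_le_of_le_one_right (norm_nonneg _) hb)

theorem one_sub_mul_mul_ne_zero (hz : ‖z‖ < 1) (ha : ‖a‖ ≤ 1) (hb : ‖b‖ ≤ 1) :
    1 - a * (z * b) ≠ 0 := by
  rw [sub_ne_zero]
  intro h
  have := norm_mul_mul_le (z := z) ha hb
  rw [← h, norm_one] at this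
  linarith

theorem norm_schurStep_le_one (hz : ‖z‖ < 1) (ha : ‖a‖ ≤ 1) (hb : ‖b‖ ≤ 1) :
    ‖schurStep z a b‖ ≤ 1 := by
  rw [schurStep, norm_div,
    div_le_one (norm_pos_iff.mpr (one_sub_mul_mul_ne_zero hz ha hb)),
    ← pow_le_pow_iff_left₀ (norm_nonneg _) (norm_nonneg _) two_ne_zero, ← sub_nonneg]
  have hform := norm_sub_mul_sq_sub_norm_sub_conj_mul_sq a (z * b) 1
  rw [mul_one, norm_one, one_pow] at hform
  have hzb : ‖z * b‖ ≤ 1 := norm_mul_le_of_le hz.le hb |>.trans_eq (one_mul 1)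
  rw [hform]
  exact mul_nonneg (sub_nonneg.mpr (pow_le_one₀ (norm_nonneg _) ha))
    (sub_nonneg.mpr (pow_le_one₀ (norm_nonneg _) hzb))

theorem schurStep_sub_schurStep (hb : 1 - a * (z * b) ≠ 0) (hb' : 1 - a * (z * b') ≠ 0) :
    schurStep z a b - schurStep z a b' =
      (z * ((1 - ‖a‖ ^ 2 : ℝ) : ℂ) * (b - b')) / ((1 - a * (z * b)) * (1 - a * (z * b'))) := by
  have ha : ((1 - ‖a‖ ^ 2 : ℝ) : ℂ) = 1 - a * starRingEnd ℂ a := by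
    rw [Complex.mul_conj']
    push_cast
    rfl
  rw [ha, schurStep, schurStep, div_sub_div _ _ hb hb']
  congr 1
  ring

theorem one_sub_norm_mul_norm_le (hb : ‖b‖ ≤ 1) : 1 - ‖a‖ * ‖z‖ ≤ ‖1 - a * (z * b)‖ := by
  have h : ‖a * (z * b)‖ ≤ ‖a‖ * ‖z‖ := by
    rw [norm_mul, norm_mul, ← mul_assoc]
    exact mul_le_of_le_one_right (by positivity) hb
  have := norm_sub_norm_le 1 (a * (z * b))
  rw [norm_one] at this
  linarith

theorem norm_schurStep_sub_le (hz : ‖z‖ < 1) (ha : ‖a‖ ≤ 1) (hb : ‖b‖ ≤ 1) (hb' : ‖b'‖ ≤ 1) :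
    ‖schurStep z a b - schurStep z a b'‖ ≤ ‖z‖ / (1 - ‖z‖ ^ 2) * ‖b - b'‖ := by
  have hz' : 0 < 1 - ‖z‖ ^ 2 := one_sub_norm_sq_pos hz
  have ha' : 0 ≤ 1 - ‖a‖ ^ 2 := sub_nonneg.mpr (pow_le_one₀ (norm_nonneg _) ha)
  have haz : 0 < 1 - ‖a‖ * ‖z‖ := by nlinarith [norm_nonneg z]
  have hdenom : (1 - ‖a‖ ^ 2) * (1 - ‖z‖ ^ 2) ≤ ‖1 - a * (z * b)‖ * ‖1 - a * (z * b')‖ :=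
    calc (1 - ‖a‖ ^ 2) * (1 - ‖z‖ ^ 2) ≤ (1 - ‖a‖ * ‖z‖) * (1 - ‖a‖ * ‖z‖) := by
          linarith [sq_nonneg (‖a‖ - ‖z‖)]
      _ ≤ ‖1 - a * (z * b)‖ * ‖1 - a * (z * b')‖ := by
          gcongr <;> exact one_sub_norm_mul_norm_le ‹_›
  have hb₁ := one_sub_mul_mul_ne_zero hz ha hb
  have hb₂ := one_sub_mul_mul_ne_zero hz ha hb'
  rw [schurStep_sub_schurStep hb₁ hb₂, norm_div, norm_mul, norm_mul, norm_mul,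
    Complex.norm_of_nonneg ha', div_mul_eq_mul_div, div_le_div_iff₀ (by positivity) hz']
  nlinarith [mul_le_mul_of_nonneg_left hdenom (by positivity : 0 ≤ ‖z‖ * ‖b - b'‖)]

end SchurStep

section SchurIter

variable {z b b' : ℂ} {a : ℕ → ℂ}

theorem norm_schurIter_le_one (hz : ‖z‖ < 1) (ha : ∀ i, ‖a i‖ ≤ 1) (hb : ‖b‖ ≤ 1) (n : ℕ) :
    ‖schurIter z a b n‖ ≤ 1 := by
  induction n with
  | zero => exact hb
  | succ n ih => exact norm_schurStep_le_one hz (ha n) ih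

theorem norm_schurIter_sub_le (hz : ‖z‖ < 1) (ha : ∀ i, ‖a i‖ ≤ 1) (hb : ‖b‖ ≤ 1)
    (hb' : ‖b'‖ ≤ 1) (n : ℕ) :
    ‖schurIter z a b n - schurIter z a b' n‖ ≤ (‖z‖ / (1 - ‖z‖ ^ 2)) ^ n * ‖b - b'‖ := by
  induction n with
  | zero => simp [schurIter]
  | succ n ih =>
    have hK : 0 ≤ ‖z‖ / (1 - ‖z‖ ^ 2) := div_nonneg (norm_nonneg z) (one_sub_norm_sq_pos hz).le
    rw [pow_succ', mul_assoc]
    exact (norm_schurStep_sub_le hz (ha n) (norm_schurIter_le_one hz ha hb n)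
      (norm_schurIter_le_one hz ha hb' n)).trans (mul_le_mul_of_nonneg_left ih hK)

theorem schurIter_add (z : ℂ) (a : ℕ → ℂ) (b : ℂ) (m n : ℕ) :
    schurIter z a b (m + n) = schurIter z (fun i => a (m + i)) (schurIter z a b m) n := by
  induction n with
  | zero => rfl
  | succ n ih => rw [← add_assoc, schurIter, ih, schurIter]

theorem eval_opuc_eq_schurIter_mul (hz : ‖z‖ < 1) (ha : ∀ i, ‖a i‖ ≤ 1) (n : ℕ) :
    (opuc a n).eval z = schurIter z a 1 n * (reversedPoly n (opuc a n)).eval z := by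
  induction n with
  | zero => simp [opuc, reversedPoly, schurIter]
  | succ n ih =>
    have hne : 1 - a n * (z * schurIter z a 1 n) ≠ 0 :=
      one_sub_mul_mul_ne_zero hz (ha n) (norm_schurIter_le_one hz ha norm_one.le n)
    rw [eval_opuc_succ, eval_reversedPoly_opuc_succ, ih, schurIter, schurStep, div_mul_eq_mul_div,
      eq_div_iff hne]
    ring

theorem eval_reversedPoly_opuc (hz : ‖z‖ < 1) (ha : ∀ i, ‖a i‖ ≤ 1) (n : ℕ) :
    (reversedPoly n (opuc a n)).eval z =
      ∏ i ∈ Finset.range n, (1 - a i * (z * schurIter z a 1 i)) := by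
  induction n with
  | zero => simp [opuc, reversedPoly]
  | succ n ih =>
    rw [eval_reversedPoly_opuc_succ, eval_opuc_eq_schurIter_mul hz ha, Finset.prod_range_succ, ← ih]
    ring

theorem norm_eval_popuc_succ (hz : ‖z‖ < 1) (ha : ∀ i, ‖a i‖ ≤ 1) {β : ℂ} (hβ : ‖β‖ = 1) (n : ℕ) :
    ‖(popuc β a (n + 1)).eval z‖ = ‖1 - β * (z * schurIter z a 1 n)‖ *
      ∏ i ∈ Finset.range n, ‖1 - a i * (z * schurIter z a 1 i)‖ := by
  have hβ' : starRingEnd ℂ β * β = 1 := by rw [Complex.conj_mul', hβ]; simp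
  have h : (popuc β a (n + 1)).eval z = -(starRingEnd ℂ β) *
      ((1 - β * (z * schurIter z a 1 n)) * (reversedPoly n (opuc a n)).eval z) := by
    simp only [popuc, eval_sub, eval_mul, eval_X, eval_C, eval_opuc_eq_schurIter_mul hz ha n]
    linear_combination -(z * schurIter z a 1 n * (reversedPoly n (opuc a n)).eval z) * hβ'
  rw [h, norm_mul, norm_neg, Complex.norm_conj, hβ, one_mul, norm_mul,
    eval_reversedPoly_opuc hz ha, norm_prod]

end SchurIter

/-! ### Transfer matrices over a period -/

section TransferMatrix

open scoped Matrix ComplexConjugate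

noncomputable section

/-- The transfer matrix without its normalizing factor. -/
def szegoMatrix (a z : ℂ) : Matrix (Fin 2) (Fin 2) ℂ :=
  !![z, -conj a; -(a * z), 1]

/-- The monodromy matrix, that is the product of the unnormalized transfer matrices of
`c (n - 1), …, c 0`. -/
def szegoProd (c : ℕ → ℂ) (z : ℂ) : ℕ → Matrix (Fin 2) (Fin 2) ℂ
  | 0 => 1
  | n + 1 => szegoMatrix (c n) z * szegoProd c z n

/-- The trace of the monodromy matrix as a polynomial: `(Φ_p + Ψ_p + Φ_p^* + Ψ_p^*) / 2` with the
second-kind polynomials `Ψ_p`, which are those with the Verblunsky coefficients `-c`. -/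
def tracePoly (c : ℕ → ℂ) (p : ℕ) : ℂ[X] :=
  C (1 / 2) * (opuc c p + opuc (-c) p + reversedPoly p (opuc c p + opuc (-c) p))

/-- The product of `1 - |c_j|²` over a period. -/
def rhoSq (c : ℕ → ℂ) (p : ℕ) : ℝ := ∏ j ∈ Finset.range p, (1 - ‖c j‖ ^ 2)

/-- The function `Δ² - 2`, in which no branch of `z ^ (p / 2)` has to be chosen. -/
def discSq (c : ℕ → ℂ) (p : ℕ) (z : ℂ) : ℂ :=
  (tracePoly c p).eval z ^ 2 / (rhoSq c p * z ^ p) - 2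

/-- The polynomial whose zeros are the solutions of `Δ(z)² - 2 = 2 cos x`. -/
def levelPoly (c : ℕ → ℂ) (p : ℕ) (x : ℝ) : ℂ[X] :=
  tracePoly c p ^ 2 - C ((rhoSq c p * (2 + 2 * Real.cos x) : ℝ) : ℂ) * X ^ p

end

theorem szegoMatrix_mulVec (a z u v : ℂ) :
    szegoMatrix a z *ᵥ ![u, v] = ![z * u - conj a * v, v - a * (z * u)] := by
  simp only [szegoMatrix, Matrix.mulVec_cons, Matrix.mulVec_empty]
  ext i
  fin_cases i <;> simp <;> ring

theorem det_szegoMatrix (a z : ℂ) : (szegoMatrix a z).det = (1 - ‖a‖ ^ 2 : ℝ) * z := by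
  have h : ((1 - ‖a‖ ^ 2 : ℝ) : ℂ) = 1 - a * conj a := by
    rw [Complex.mul_conj, Complex.normSq_eq_norm_sq]
    push_cast
    rfl
  rw [h, szegoMatrix, Matrix.det_fin_two_of]
  ring

theorem szegoProd_mulVec_one_one (c : ℕ → ℂ) (z : ℂ) (n : ℕ) :
    szegoProd c z n *ᵥ ![1, 1] =
      ![(opuc c n).eval z, (reversedPoly n (opuc c n)).eval z] := by
  induction n with
  | zero => simp [szegoProd, opuc, reversedPoly]
  | succ n ih =>
    rw [szegoProd, ← Matrix.mulVec_mulVec, ih, szegoMatrix_mulVec, eval_opuc_succ,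
      eval_reversedPoly_opuc_succ]

theorem szegoProd_mulVec_one_neg_one (c : ℕ → ℂ) (z : ℂ) (n : ℕ) :
    szegoProd c z n *ᵥ ![1, -1] =
      ![(opuc (-c) n).eval z, -(reversedPoly n (opuc (-c) n)).eval z] := by
  induction n with
  | zero => simp [szegoProd, opuc, reversedPoly]
  | succ n ih =>
    rw [szegoProd, ← Matrix.mulVec_mulVec, ih, szegoMatrix_mulVec, eval_opuc_succ,
      eval_reversedPoly_opuc_succ]
    simp only [Pi.neg_apply, map_neg]
    ring_nf

theorem reversedPoly_add (n : ℕ) (P Q : ℂ[X]) :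
    reversedPoly n (P + Q) = reversedPoly n P + reversedPoly n Q := by
  simp [reversedPoly, reflect_add]

theorem reversedPoly_C_mul (n : ℕ) (a : ℂ) (P : ℂ[X]) :
    reversedPoly n (C a * P) = C (conj a) * reversedPoly n P := by
  simp [reversedPoly, reflect_C_mul]

theorem coeff_zero_reversedPoly (n : ℕ) (P : ℂ[X]) :
    (reversedPoly n P).coeff 0 = conj (P.coeff n) := by
  simp [reversedPoly, coeff_reflect]

theorem coeff_self_reversedPoly (n : ℕ) (P : ℂ[X]) :
    (reversedPoly n P).coeff n = conj (P.coeff 0) := by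
  simp [reversedPoly, coeff_reflect]

theorem eval_reversedPoly {n : ℕ} {P : ℂ[X]} (hP : P.natDegree ≤ n) {z : ℂ} (hz : z ≠ 0) :
    (reversedPoly n P).eval z = z ^ n * conj (P.eval (conj z)⁻¹) := by
  have : Invertible z⁻¹ := invertibleOfNonzero (inv_ne_zero hz)
  have h := eval₂_reflect_mul_pow (RingHom.id ℂ) z⁻¹ n (P.map conj)
    (natDegree_map_le.trans hP)
  rw [invOf_eq_inv, inv_inv, eval₂_id, eval₂_id, inv_pow, ← div_eq_mul_inv,
    div_eq_iff (pow_ne_zero n hz), ← reversedPoly] at h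
  rw [h, mul_comm, ← eval₂_at_apply, map_inv₀, Complex.conj_conj, eval_map]

theorem eval_tracePoly (c : ℕ → ℂ) (p : ℕ) (z : ℂ) :
    (tracePoly c p).eval z = (szegoProd c z p).trace := by
  have hφ := szegoProd_mulVec_one_one c z p
  have hψ := szegoProd_mulVec_one_neg_one c z p
  have h₀ := congrFun hφ 0
  have h₁ := congrFun hφ 1
  have k₀ := congrFun hψ 0
  have k₁ := congrFun hψ 1
  simp only [Matrix.mulVec, dotProduct, Fin.sum_univ_two, Matrix.cons_val_zero,
    Matrix.cons_val_one] at h₀ h₁ k₀ k₁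
  simp only [tracePoly, reversedPoly_add, eval_mul, eval_add, eval_C, Matrix.trace_fin_two]
  linear_combination (-1 / 2 : ℂ) * (h₀ + h₁ + k₀ - k₁)

theorem reversedPoly_tracePoly (c : ℕ → ℂ) (p : ℕ) :
    reversedPoly p (tracePoly c p) = tracePoly c p := by
  rw [tracePoly, reversedPoly_C_mul, reversedPoly_add, reversedPoly_reversedPoly, add_comm]
  simp only [one_div, map_inv₀, map_ofNat]

theorem natDegree_tracePoly_le (c : ℕ → ℂ) (p : ℕ) : (tracePoly c p).natDegree ≤ p := by
  have h : (opuc c p + opuc (-c) p).natDegree ≤ p := natDegree_add_le_of_degree_le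
    (isMonicOfDegree_opuc c p).natDegree_eq.le (isMonicOfDegree_opuc (-c) p).natDegree_eq.le
  exact (natDegree_C_mul_le _ _).trans
    (natDegree_add_le_of_degree_le h (natDegree_reversedPoly_le h))

theorem coeff_zero_opuc_add_opuc_neg (c : ℕ → ℂ) {p : ℕ} (hp : 0 < p) :
    (opuc c p + opuc (-c) p).coeff 0 = 0 := by
  obtain ⟨n, rfl⟩ := Nat.exists_eq_add_one_of_ne_zero hp.ne'
  have h (a : ℕ → ℂ) : (opuc a n).coeff n = 1 :=
    ((isMonicOfDegree_iff _ _).mp (isMonicOfDegree_opuc a n)).2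
  simp [opuc, coeff_zero_reversedPoly, h]

theorem isMonicOfDegree_tracePoly (c : ℕ → ℂ) {p : ℕ} (hp : 0 < p) :
    IsMonicOfDegree (tracePoly c p) p := by
  have hΦ := ((isMonicOfDegree_iff _ _).mp (isMonicOfDegree_opuc c p)).2
  have hΨ := ((isMonicOfDegree_iff _ _).mp (isMonicOfDegree_opuc (-c) p)).2
  refine (isMonicOfDegree_iff _ _).mpr ⟨natDegree_tracePoly_le c p, ?_⟩
  rw [tracePoly, coeff_C_mul, coeff_add, coeff_self_reversedPoly,
    coeff_zero_opuc_add_opuc_neg c hp, coeff_add, hΦ, hΨ]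
  norm_num

theorem eval_tracePoly_zero (c : ℕ → ℂ) {p : ℕ} (hp : 0 < p) : (tracePoly c p).eval 0 = 1 := by
  rw [← coeff_zero_eq_eval_zero, ← reversedPoly_tracePoly, coeff_zero_reversedPoly,
    ((isMonicOfDegree_iff _ _).mp (isMonicOfDegree_tracePoly c hp)).2, map_one]

section Reflection

variable (c : ℕ → ℂ) (p : ℕ) {z : ℂ}

theorem inv_conj_of_norm_eq_one (hz : ‖z‖ = 1) : (conj z)⁻¹ = z := by
  have h : z * conj z = 1 := by
    rw [Complex.mul_conj, Complex.normSq_eq_norm_sq, hz, one_pow, Complex.ofReal_one]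
  exact (eq_inv_of_mul_eq_one_left h).symm

theorem eval_tracePoly_reflection (hz : z ≠ 0) :
    (tracePoly c p).eval z = z ^ p * conj ((tracePoly c p).eval (conj z)⁻¹) := by
  conv_lhs => rw [← reversedPoly_tracePoly]
  exact eval_reversedPoly (natDegree_tracePoly_le c p) hz

theorem discSq_reflection (hz : z ≠ 0) : discSq c p z = conj (discSq c p (conj z)⁻¹) := by
  simp only [discSq, eval_tracePoly_reflection c p hz, map_sub, map_div₀, map_pow, map_mul,
    map_inv₀, Complex.conj_conj, Complex.conj_ofReal, map_ofNat]
  generalize conj (eval (conj z)⁻¹ (tracePoly c p)) = w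
  by_cases hR : (rhoSq c p : ℂ) = 0
  · simp [hR]
  · have : conj z ≠ 0 := by simpa using hz
    rw [inv_pow]
    field_simp

end Reflection

theorem rhoSq_succ (c : ℕ → ℂ) (p : ℕ) : rhoSq c (p + 1) = rhoSq c p * (1 - ‖c p‖ ^ 2) :=
  Finset.prod_range_succ _ _

theorem det_szegoProd (c : ℕ → ℂ) (z : ℂ) (n : ℕ) :
    (szegoProd c z n).det = rhoSq c n * z ^ n := by
  induction n with
  | zero => simp [szegoProd, rhoSq]
  | succ n ih =>
    rw [szegoProd, Matrix.det_mul, ih, det_szegoMatrix, rhoSq_succ, pow_succ]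
    push_cast
    ring

theorem isMonicOfDegree_levelPoly (c : ℕ → ℂ) {p : ℕ} (hp : 0 < p) (x : ℝ) :
    IsMonicOfDegree (levelPoly c p x) (p * 2) :=
  ((isMonicOfDegree_tracePoly c hp).pow 2).sub
    ((natDegree_C_mul_X_pow_le _ _).trans_lt (by omega))

/-! ### Solutions of `Δ² - 2 = 2 cos x` -/

/-- The indefinite form `|v₀|² - |v₁|²`, which transfer matrices on the unit circle multiply by
`1 - |a|²`. -/
noncomputable def indefForm (v : Fin 2 → ℂ) : ℝ := ‖v 0‖ ^ 2 - ‖v 1‖ ^ 2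

theorem abs_indefForm_le (v : Fin 2 → ℂ) : |indefForm v| ≤ ‖v 0‖ ^ 2 + ‖v 1‖ ^ 2 := by
  have h₀ := sq_nonneg ‖v 0‖
  have h₁ := sq_nonneg ‖v 1‖
  exact abs_le.mpr ⟨by rw [indefForm]; linarith, by rw [indefForm]; linarith⟩

theorem indefForm_smul (l : ℂ) (v : Fin 2 → ℂ) : indefForm (l • v) = ‖l‖ ^ 2 * indefForm v := by
  simp only [indefForm, Pi.smul_apply, smul_eq_mul, norm_mul, mul_pow, mul_sub]

theorem indefForm_szegoMatrix_mulVec_le {a z : ℂ} (ha : ‖a‖ < 1) (v : Fin 2 → ℂ) :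
    indefForm (szegoMatrix a z *ᵥ v) ≤ (1 - ‖a‖ ^ 2) * ‖z‖ *
      (indefForm v - (1 - ‖z‖) * (‖v 0‖ ^ 2 + ‖v 1‖ ^ 2)) := by
  have hform : indefForm (szegoMatrix a z *ᵥ v) =
      (1 - ‖a‖ ^ 2) * (‖z * v 0‖ ^ 2 - ‖v 1‖ ^ 2) := by
    rw [show v = ![v 0, v 1] by ext i; fin_cases i <;> rfl, szegoMatrix_mulVec]
    have := norm_sub_mul_sq_sub_norm_sub_conj_mul_sq a (z * v 0) (v 1)
    simp only [indefForm, Matrix.cons_val_zero, Matrix.cons_val_one]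
    linarith
  rw [hform, mul_assoc, norm_mul, indefForm]
  refine mul_le_mul_of_nonneg_left ?_ (one_sub_norm_sq_pos ha).le
  nlinarith [mul_nonneg (sq_nonneg (1 - ‖z‖)) (sq_nonneg ‖v 1‖)]

section Level

variable {c : ℕ → ℂ} (hc : ∀ j, ‖c j‖ < 1) {p : ℕ} {z : ℂ}

include hc

theorem rhoSq_pos (p : ℕ) : 0 < rhoSq c p :=
  Finset.prod_pos fun j _ => one_sub_norm_sq_pos (hc j)

theorem rhoSq_ne_zero (p : ℕ) : (rhoSq c p : ℂ) ≠ 0 :=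
  Complex.ofReal_ne_zero.mpr (rhoSq_pos hc p).ne'

theorem eval_levelPoly (p : ℕ) (x : ℝ) (hz : z ≠ 0) :
    (levelPoly c p x).eval z =
      rhoSq c p * z ^ p * (discSq c p z - ((2 * Real.cos x : ℝ) : ℂ)) := by
  have hR := rhoSq_ne_zero hc p
  simp only [levelPoly, discSq, eval_sub, eval_mul, eval_pow, eval_C, eval_X]
  push_cast
  field_simp
  ring

theorem eval_levelPoly_eq_zero_iff (p : ℕ) (x : ℝ) (hz : z ≠ 0) :
    (levelPoly c p x).eval z = 0 ↔ discSq c p z = ((2 * Real.cos x : ℝ) : ℂ) := by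
  rw [eval_levelPoly hc p x hz, mul_eq_zero, sub_eq_zero]
  exact or_iff_right (mul_ne_zero (rhoSq_ne_zero hc p) (pow_ne_zero _ hz))

theorem indefForm_szegoProd_mulVec_le (hp : 0 < p) (hz : ‖z‖ < 1) (v : Fin 2 → ℂ) :
    indefForm (szegoProd c z p *ᵥ v) ≤ rhoSq c p * ‖z‖ ^ p *
      (indefForm v - (1 - ‖z‖) * (‖v 0‖ ^ 2 + ‖v 1‖ ^ 2)) := by
  induction p, hp using Nat.le_induction with
  | base => simpa [szegoProd, rhoSq] using indefForm_szegoMatrix_mulVec_le (hc 0) v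
  | succ n _ ih =>
    rw [szegoProd, ← Matrix.mulVec_mulVec]
    set w := szegoProd c z n *ᵥ v
    have hw : 0 ≤ (1 - ‖z‖) * (‖w 0‖ ^ 2 + ‖w 1‖ ^ 2) :=
      mul_nonneg (by linarith) (by positivity)
    have hn := (one_sub_norm_sq_pos (hc n)).le
    calc indefForm (szegoMatrix (c n) z *ᵥ w)
        ≤ (1 - ‖c n‖ ^ 2) * ‖z‖ * (indefForm w - (1 - ‖z‖) * (‖w 0‖ ^ 2 + ‖w 1‖ ^ 2)) :=
          indefForm_szegoMatrix_mulVec_le (hc n) w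
      _ ≤ (1 - ‖c n‖ ^ 2) * ‖z‖ * (rhoSq c n * ‖z‖ ^ n *
            (indefForm v - (1 - ‖z‖) * (‖v 0‖ ^ 2 + ‖v 1‖ ^ 2))) := by
          gcongr
          linarith
      _ = _ := by rw [rhoSq_succ c n, pow_succ]; ring

omit hc in
theorem det_szegoProd_sub_smul_one (c : ℕ → ℂ) (p : ℕ) (z l : ℂ) :
    (szegoProd c z p - l • (1 : Matrix (Fin 2) (Fin 2) ℂ)).det =
      l ^ 2 - (tracePoly c p).eval z * l + rhoSq c p * z ^ p := by
  rw [eval_tracePoly, ← det_szegoProd, Matrix.det_fin_two, Matrix.det_fin_two,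
    Matrix.trace_fin_two]
  simp only [Matrix.sub_apply, Matrix.smul_apply, Matrix.one_apply_eq, smul_eq_mul, mul_one, ne_eq,
    zero_ne_one, one_ne_zero, not_false_eq_true, Matrix.one_apply_ne, mul_zero, sub_zero]
  ring

omit hc in
theorem exists_eigenvector_iff (c : ℕ → ℂ) (p : ℕ) (z l : ℂ) :
    (∃ v : Fin 2 → ℂ, v ≠ 0 ∧ szegoProd c z p *ᵥ v = l • v) ↔
      l ^ 2 - (tracePoly c p).eval z * l + rhoSq c p * z ^ p = 0 := by
  rw [← det_szegoProd_sub_smul_one, ← Matrix.exists_mulVec_eq_zero_iff]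
  simp only [Matrix.sub_mulVec, Matrix.smul_mulVec, Matrix.one_mulVec, sub_eq_zero]

theorem exists_eigenvalue (p : ℕ) {Y : ℂ} (hz : z ≠ 0) (hY : Y ≠ 0)
    (h : Y + Y⁻¹ = discSq c p z) :
    ∃ l : ℂ, l ^ 2 = Y * (rhoSq c p * z ^ p) ∧
      l ^ 2 - (tracePoly c p).eval z * l + rhoSq c p * z ^ p = 0 := by
  have hD₀ : rhoSq c p * z ^ p ≠ 0 := mul_ne_zero (rhoSq_ne_zero hc p) (pow_ne_zero _ hz)
  have hτ : (tracePoly c p).eval z ^ 2 = (Y + Y⁻¹ + 2) * (rhoSq c p * z ^ p) := by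
    rw [h, discSq, sub_add_cancel, div_mul_cancel₀ _ hD₀]
  set D : ℂ := rhoSq c p * z ^ p
  set τ := (tracePoly c p).eval z
  obtain ⟨l, hl⟩ := IsAlgClosed.exists_pow_nat_eq (Y * D) two_pos
  have hl₀ : l ≠ 0 := by
    rintro rfl
    exact mul_ne_zero hY hD₀ (by rw [← hl]; simp)
  have hsq : (l + D / l) ^ 2 = τ ^ 2 := by
    have : (l + D / l) ^ 2 = l ^ 2 + 2 * D + D ^ 2 / l ^ 2 := by field_simp; ring
    rw [this, hl, hτ]
    field_simp
    ring
  rcases sq_eq_sq_iff_eq_or_eq_neg.mp hsq with hτl | hτl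
  · refine ⟨l, hl, ?_⟩
    rw [← hτl]; field_simp; ring
  · refine ⟨-l, by rw [neg_sq, hl], ?_⟩
    rw [show τ = -(l + D / l) by rw [hτl, neg_neg]]; field_simp; ring

theorem one_sub_norm_le_abs_norm_sub_one (hp : 0 < p) {Y : ℂ} (hz₀ : z ≠ 0) (hz : ‖z‖ < 1)
    (hY : Y ≠ 0) (h : Y + Y⁻¹ = discSq c p z) : 1 - ‖z‖ ≤ |‖Y‖ - 1| := by
  obtain ⟨l, hl, hl'⟩ := exists_eigenvalue hc p hz₀ hY h
  obtain ⟨v, hv₀, hv⟩ := (exists_eigenvector_iff c p z l).mpr hl'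
  have hR := rhoSq_pos hc p
  have hD : 0 < rhoSq c p * ‖z‖ ^ p := mul_pos hR (pow_pos (norm_pos_iff.mpr hz₀) _)
  have hl2 : ‖l‖ ^ 2 = rhoSq c p * ‖z‖ ^ p * ‖Y‖ := by
    rw [← norm_pow, hl, norm_mul, norm_mul, norm_pow, Complex.norm_real, Real.norm_eq_abs,
      abs_of_pos hR, mul_comm]
  have hform : ‖Y‖ * indefForm v ≤ indefForm v - (1 - ‖z‖) * (‖v 0‖ ^ 2 + ‖v 1‖ ^ 2) := by
    have := indefForm_szegoProd_mulVec_le hc hp hz v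
    rw [hv, indefForm_smul, hl2, mul_assoc] at this
    exact le_of_mul_le_mul_left this hD
  have hN : 0 < ‖v 0‖ ^ 2 + ‖v 1‖ ^ 2 := by
    contrapose! hv₀
    have h₀ : ‖v 0‖ = 0 := by nlinarith [sq_nonneg ‖v 0‖, sq_nonneg ‖v 1‖]
    have h₁ : ‖v 1‖ = 0 := by nlinarith [sq_nonneg ‖v 0‖, sq_nonneg ‖v 1‖]
    ext i
    fin_cases i
    exacts [norm_eq_zero.mp h₀, norm_eq_zero.mp h₁]
  refine le_of_mul_le_mul_right ?_ hN
  calc (1 - ‖z‖) * (‖v 0‖ ^ 2 + ‖v 1‖ ^ 2)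
      ≤ -((‖Y‖ - 1) * indefForm v) := by linarith
    _ ≤ |‖Y‖ - 1| * |indefForm v| := (neg_le_abs _).trans_eq (abs_mul _ _)
    _ ≤ _ := mul_le_mul_of_nonneg_left (abs_indefForm_le v) (abs_nonneg _)

end Level

theorem exists_norm_le_one_add_inv_eq (u : ℂ) : ∃ Y : ℂ, Y ≠ 0 ∧ ‖Y‖ ≤ 1 ∧ Y + Y⁻¹ = u := by
  obtain ⟨s, hs⟩ := IsAlgClosed.exists_pow_nat_eq (u ^ 2 - 4) two_pos
  set Y := (u + s) / 2
  have hmul : Y * ((u - s) / 2) = 1 := by linear_combination (-1 / 4 : ℂ) * hs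
  have hY : Y ≠ 0 := left_ne_zero_of_mul_eq_one hmul
  have hadd : Y + Y⁻¹ = u := by
    rw [← eq_inv_of_mul_eq_one_right hmul]
    ring
  rcases le_total ‖Y‖ 1 with hle | hge
  · exact ⟨Y, hY, hle, hadd⟩
  · exact ⟨Y⁻¹, inv_ne_zero hY, by rw [norm_inv]; exact inv_le_one_of_one_le₀ hge,
      by rw [inv_inv, add_comm, hadd]⟩

theorem exp_mul_I_add_inv (x : ℝ) :
    Complex.exp (x * Complex.I) + (Complex.exp (x * Complex.I))⁻¹ = (2 * Real.cos x : ℝ) := by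
  rw [← Complex.exp_neg, ← neg_mul]
  push_cast
  exact (Complex.two_cos x).symm

theorem one_sub_norm_mul_abs_sin_le {Y : ℂ} (hY : Y ≠ 0) (hY1 : ‖Y‖ ≤ 1) (x : ℝ) :
    (1 - ‖Y‖) * |Real.sin x| ≤ ‖Y + Y⁻¹ - (2 * Real.cos x : ℝ)‖ := by
  set e := Complex.exp (x * Complex.I) with he
  have he₀ : e ≠ 0 := Complex.exp_ne_zero _
  have he₁ : ‖e‖ = 1 := Complex.norm_exp_ofReal_mul_I x
  have hdist (w : ℂ) (hw : ‖w‖ = 1) : 1 - ‖Y‖ ≤ ‖Y - w‖ := by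
    rw [norm_sub_rev, ← hw]
    exact norm_sub_norm_le _ _
  have hsin : 2 * |Real.sin x| ≤ ‖Y - e‖ + ‖Y - e⁻¹‖ := by
    have hsub : e - e⁻¹ = (2 * Real.sin x : ℝ) * Complex.I := by
      rw [he, ← Complex.exp_neg, ← neg_mul, Complex.ofReal_mul, Complex.ofReal_ofNat,
        Complex.ofReal_sin, Complex.two_sin]
      linear_combination (Complex.exp (x * Complex.I) - Complex.exp (-x * Complex.I)) *
        Complex.I_sq
    calc 2 * |Real.sin x| = ‖(Y - e⁻¹) - (Y - e)‖ := by
          rw [sub_sub_sub_cancel_left, hsub, norm_mul, Complex.norm_I, mul_one,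
            Complex.norm_real, Real.norm_eq_abs, abs_mul, abs_two]
      _ ≤ _ := (norm_sub_le _ _).trans_eq (add_comm _ _)
  have hprod : (1 - ‖Y‖) * |Real.sin x| ≤ ‖Y - e‖ * ‖Y - e⁻¹‖ := by
    have h₁ := hdist e he₁
    have h₂ := hdist e⁻¹ (by rw [norm_inv, he₁, inv_one])
    rcases le_total ‖Y - e‖ ‖Y - e⁻¹‖ with h | h
    · exact mul_le_mul h₁ (by linarith) (abs_nonneg _) (norm_nonneg _)
    · rw [mul_comm ‖Y - e‖]
      exact mul_le_mul h₂ (by linarith) (abs_nonneg _) (norm_nonneg _)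
  have hfac : Y + Y⁻¹ - (2 * Real.cos x : ℝ) = (Y - e) * (Y - e⁻¹) / Y := by
    rw [← exp_mul_I_add_inv]
    field_simp
    ring
  rw [hfac, norm_div, norm_mul, le_div_iff₀ (norm_pos_iff.mpr hY)]
  exact (mul_le_of_le_one_right (mul_nonneg (by linarith) (abs_nonneg _)) hY1).trans hprod

theorem derivative_ne_zero_of_le_norm_eval {P : ℂ[X]} {z : ℂ} {k : ℝ} (hk : 0 < k)
    (hz : P.eval z = 0) (h : ∀ᶠ r : ℝ in 𝓝[<] 1, k * (1 - r) ≤ ‖P.eval (r * z)‖) :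
    (derivative P).eval z ≠ 0 := by
  intro hd
  have hderiv : HasDerivAt (fun r : ℝ => P.eval (r * z)) 0 1 := by
    have hP := P.hasDerivAt ((1 : ℝ) * z)
    have hr : HasDerivAt (fun r : ℝ => (r : ℂ) * z) z 1 := by
      simpa using (Complex.ofRealCLM.hasDerivAt (x := (1 : ℝ))).mul_const z
    rw [Complex.ofReal_one, one_mul, hd] at hP
    have h1 : HasDerivAt (fun w : ℂ => P.eval w) 0 ((1 : ℝ) * z : ℂ) := by simpa using hP
    exact (h1.comp (1 : ℝ) hr).congr_deriv (zero_mul z)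
  have ho := (hasDerivAt_iff_isLittleO.mp hderiv).def (half_pos hk)
  obtain ⟨r, ⟨hle, hlow⟩, hr⟩ :=
    ((ho.filter_mono nhdsWithin_le_nhds).and h |>.and self_mem_nhdsWithin).exists
  simp only [Complex.ofReal_one, one_mul, hz, sub_zero, smul_zero, Real.norm_eq_abs] at hle
  rw [abs_of_neg (sub_neg.mpr hr)] at hle
  nlinarith [show r < 1 from hr]

section Level

variable {c : ℕ → ℂ} (hc : ∀ j, ‖c j‖ < 1) {p : ℕ} (hp : 0 < p) {z : ℂ} {x : ℝ}

include hc hp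

theorem abs_sin_le_norm_eval_levelPoly (hz₀ : z ≠ 0) (hz : ‖z‖ < 1) (x : ℝ) :
    rhoSq c p * ‖z‖ ^ p * ((1 - ‖z‖) * |Real.sin x|) ≤ ‖(levelPoly c p x).eval z‖ := by
  have hR := rhoSq_pos hc p
  obtain ⟨Y, hY, hY1, hYF⟩ := exists_norm_le_one_add_inv_eq (discSq c p z)
  have hYz : 1 - ‖z‖ ≤ 1 - ‖Y‖ := by
    have := one_sub_norm_le_abs_norm_sub_one hc hp hz₀ hz hY hYF
    rwa [abs_of_nonpos (by linarith), neg_sub] at this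
  rw [eval_levelPoly hc p x hz₀, ← hYF, norm_mul, norm_mul, norm_pow, Complex.norm_real,
    Real.norm_eq_abs, abs_of_pos hR]
  gcongr
  exact (mul_le_mul_of_nonneg_right hYz (abs_nonneg _)).trans
    (one_sub_norm_mul_abs_sin_le hY hY1 x)

theorem norm_eq_one_of_discSq_eq (hz₀ : z ≠ 0) (h : discSq c p z = (2 * Real.cos x : ℝ)) :
    ‖z‖ = 1 := by
  have hdisk (w : ℂ) (hw₀ : w ≠ 0) (hw : discSq c p w = (2 * Real.cos x : ℝ)) : 1 ≤ ‖w‖ := by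
    by_contra! hlt
    have := one_sub_norm_le_abs_norm_sub_one hc hp hw₀ hlt (Complex.exp_ne_zero _)
      ((exp_mul_I_add_inv x).trans hw.symm)
    rw [Complex.norm_exp_ofReal_mul_I, sub_self, abs_zero] at this
    linarith
  have hinv : 1 ≤ ‖z‖⁻¹ := by
    rw [← Complex.norm_conj, ← norm_inv]
    refine hdisk _ (by simpa using hz₀) ?_
    rw [← Complex.conj_conj (discSq _ _ _), ← discSq_reflection c p hz₀, h, Complex.conj_ofReal]
  exact ((one_le_inv₀ (norm_pos_iff.mpr hz₀)).mp hinv).antisymm (hdisk z hz₀ h)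

omit hc in
theorem ne_zero_of_eval_levelPoly_eq_zero (h : (levelPoly c p x).eval z = 0) : z ≠ 0 := by
  rintro rfl
  simp [levelPoly, eval_tracePoly_zero c hp, hp.ne'] at h

theorem norm_eq_one_of_eval_levelPoly_eq_zero (h : (levelPoly c p x).eval z = 0) : ‖z‖ = 1 :=
  have hz₀ := ne_zero_of_eval_levelPoly_eq_zero hp h
  norm_eq_one_of_discSq_eq hc hp hz₀ ((eval_levelPoly_eq_zero_iff hc p x hz₀).mp h)

theorem derivative_levelPoly_ne_zero (hx : x ∈ Ioo 0 Real.pi)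
    (h : (levelPoly c p x).eval z = 0) : (derivative (levelPoly c p x)).eval z ≠ 0 := by
  have hs : 0 < |Real.sin x| := abs_pos.mpr (Real.sin_pos_of_mem_Ioo hx).ne'
  have hz1 := norm_eq_one_of_eval_levelPoly_eq_zero hc hp h
  have hR := rhoSq_pos hc p
  have hk : 0 < rhoSq c p * (1 / 2) ^ p * |Real.sin x| := by positivity
  refine derivative_ne_zero_of_le_norm_eval hk h ?_
  filter_upwards [Ioo_mem_nhdsLT (show (1 / 2 : ℝ) < 1 by norm_num)] with r hr
  have hr₀ : 0 < r := by linarith [hr.1]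
  have hn : ‖(r : ℂ) * z‖ = r := by
    rw [norm_mul, hz1, mul_one, Complex.norm_real, Real.norm_eq_abs, abs_of_pos hr₀]
  have hlow := abs_sin_le_norm_eval_levelPoly hc hp (norm_pos_iff.mp (hn.symm ▸ hr₀))
    (hn.symm ▸ hr.2) x
  rw [hn] at hlow
  refine le_trans ?_ hlow
  rw [mul_assoc, mul_comm |_|]
  have h1r : 0 ≤ 1 - r := by linarith [hr.2]
  gcongr
  exact hr.1.le

theorem nodup_roots_levelPoly (hx : x ∈ Ioo 0 Real.pi) : (levelPoly c p x).roots.Nodup := by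
  have hne := (isMonicOfDegree_levelPoly c hp x).ne_zero
  rw [Multiset.nodup_iff_count_le_one]
  intro z
  rw [count_roots]
  by_contra hcon
  obtain ⟨hz, hz'⟩ := (one_lt_rootMultiplicity_iff_isRoot hne).mp (not_le.mp hcon)
  exact derivative_levelPoly_ne_zero hc hp hx hz hz'

end Level

end TransferMatrix

/-! ### A one-dimensional area formula -/

/-- The sum of `g` over the points of the fibre `f = y` in `s`. -/
noncomputable def fiberSum (f : ℝ → ℝ) (s : Set ℝ) (g : ℝ → ℝ≥0∞) (y : ℝ) : ℝ≥0∞ :=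
  ∑' x, (s ∩ f ⁻¹' {y}).indicator g x

section AreaFormula

variable {f f' : ℝ → ℝ} {s : Set ℝ} {g : ℝ → ℝ≥0∞}

theorem fiberSum_of_notMem_image {y : ℝ} (hy : y ∉ f '' s) : fiberSum f s g y = 0 :=
  ENNReal.tsum_eq_zero.mpr fun x => indicator_of_notMem (fun h => hy ⟨x, h.1, h.2⟩) g

theorem fiberSum_of_injOn (hinj : InjOn f s) {x : ℝ} (hx : x ∈ s) :
    fiberSum f s g (f x) = g x := by
  have hmem : x ∈ s ∩ f ⁻¹' {f x} := ⟨hx, rfl⟩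
  rw [fiberSum, tsum_eq_single x, indicator_of_mem hmem]
  exact fun x' hx' => indicator_of_notMem (fun h => hx' (hinj h.1 hx h.2)) g

theorem measurable_fiberSum (hs : MeasurableSet s) (hf : ContinuousOn f s) (hinj : InjOn f s)
    (hg : Measurable g) : Measurable (fiberSum f s g) := by
  have hemb : MeasurableEmbedding (s.domRestrict f) := hf.measurableEmbedding hs hinj
  convert hemb.measurable_extend (hg.comp measurable_subtype_coe) (measurable_const (a := 0))
  ext y
  by_cases hy : y ∈ f '' s
  · obtain ⟨x, hx, rfl⟩ := hy
    rw [fiberSum_of_injOn hinj hx]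
    exact (hemb.injective.extend_apply (g ∘ Subtype.val) _ ⟨x, hx⟩).symm
  · rw [fiberSum_of_notMem_image hy, Function.extend_apply']
    rintro ⟨x, rfl⟩
    exact hy ⟨x, x.2, rfl⟩

theorem lintegral_abs_deriv_mul_of_injOn (hs : MeasurableSet s)
    (hf : ∀ x ∈ s, HasDerivAt f (f' x) x) (hinj : InjOn f s) (g : ℝ → ℝ≥0∞) :
    ∫⁻ x in s, ENNReal.ofReal |f' x| * g x = ∫⁻ y, fiberSum f s g y := by
  have hcont : ContinuousOn f s := fun x hx => (hf x hx).continuousAt.continuousWithinAt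
  calc ∫⁻ x in s, ENNReal.ofReal |f' x| * g x
      = ∫⁻ x in s, ENNReal.ofReal |f' x| * fiberSum f s g (f x) :=
        setLIntegral_congr_fun hs fun x hx => by rw [fiberSum_of_injOn hinj hx]
    _ = ∫⁻ y in f '' s, fiberSum f s g y := (lintegral_image_eq_lintegral_abs_deriv_mul hs
        (fun x hx => (hf x hx).hasDerivWithinAt) hinj _).symm
    _ = ∫⁻ y, fiberSum f s g y := by
        rw [← lintegral_indicator (hs.image_of_continuousOn_injOn hcont hinj)]
        refine lintegral_congr fun y => ?_
        by_cases hy : y ∈ f '' s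
        · rw [indicator_of_mem hy]
        · rw [indicator_of_notMem hy, fiberSum_of_notMem_image hy]

theorem exists_measurable_partition_injOn (hs : MeasurableSet s)
    (hf : ∀ x ∈ s, HasStrictDerivAt f (f' x) x) (hf' : ∀ x ∈ s, f' x ≠ 0) :
    ∃ A : ℕ → Set ℝ, (∀ n, MeasurableSet (A n)) ∧ Pairwise (Function.onFun Disjoint A) ∧
      (∀ n, InjOn f (A n)) ∧ ⋃ n, A n = s := by
  have hloc : ∀ x ∈ s, ∃ U ∈ 𝓝 x, IsOpen U ∧ InjOn f U := fun x hx =>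
    let e := ((hf x hx).hasStrictFDerivAt_equiv (hf' x hx)).toOpenPartialHomeomorph f
    ⟨e.source, e.open_source.mem_nhds
      ((hf x hx).hasStrictFDerivAt_equiv (hf' x hx)).mem_toOpenPartialHomeomorph_source,
      e.open_source, e.injOn⟩
  choose! U hU hUo hUi using hloc
  obtain ⟨t, hts, htc, htU⟩ :=
    TopologicalSpace.countable_cover_nhdsWithin fun x hx => mem_nhdsWithin_of_mem_nhds (hU x hx)
  rcases t.eq_empty_or_nonempty with rfl | htn
  · refine ⟨fun _ => ∅, fun _ => .empty, fun _ _ _ => disjoint_empty _, fun _ => injOn_empty _, ?_⟩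
    simpa using htU.antisymm'
  obtain ⟨e, rfl⟩ := htc.exists_eq_range htn
  have hes (n : ℕ) : e n ∈ s := hts ⟨n, rfl⟩
  refine ⟨fun n => s ∩ disjointed (fun n => U (e n)) n,
    fun n => hs.inter (MeasurableSet.disjointed (fun n => (hUo _ (hes n)).measurableSet) n),
    fun i j hij => (disjoint_disjointed _ hij).mono inter_subset_right inter_subset_right,
    fun n => (hUi _ (hes n)).mono (inter_subset_right.trans (disjointed_subset _ n)), ?_⟩
  rw [← inter_iUnion, iUnion_disjointed, inter_eq_left]
  simpa [biUnion_range] using htU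

theorem fiberSum_iUnion {A : ℕ → Set ℝ} (hA : Pairwise (Function.onFun Disjoint A))
    (f : ℝ → ℝ) (g : ℝ → ℝ≥0∞) (y : ℝ) :
    fiberSum f (⋃ n, A n) g y = ∑' n, fiberSum f (A n) g y := by
  simp only [fiberSum]
  rw [ENNReal.tsum_comm]
  congr 1
  ext x
  rw [iUnion_inter, indicator_iUnion_of_pairwise_disjoint]
  exact fun i j hij => (hA hij).mono inter_subset_left inter_subset_left

theorem lintegral_abs_deriv_mul (hs : MeasurableSet s)
    (hf : ∀ x ∈ s, HasStrictDerivAt f (f' x) x) (hf' : ∀ x ∈ s, f' x ≠ 0) (hg : Measurable g) :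
    ∫⁻ x in s, ENNReal.ofReal |f' x| * g x = ∫⁻ y, fiberSum f s g y := by
  obtain ⟨A, hAm, hAd, hAi, rfl⟩ := exists_measurable_partition_injOn hs hf hf'
  have hderiv (n : ℕ) (x : ℝ) (hx : x ∈ A n) : HasDerivAt f (f' x) x :=
    (hf x (mem_iUnion_of_mem n hx)).hasDerivAt
  have hcont (n : ℕ) : ContinuousOn f (A n) :=
    fun x hx => (hderiv n x hx).continuousAt.continuousWithinAt
  simp only [fiberSum_iUnion hAd]
  rw [lintegral_iUnion hAm hAd,
    lintegral_tsum fun n => (measurable_fiberSum (hAm n) (hcont n) (hAi n) hg).aemeasurable]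
  exact tsum_congr fun n => lintegral_abs_deriv_mul_of_injOn (hAm n) (hderiv n) (hAi n) g

end AreaFormula

/-! ### The discriminant on the unit circle -/

section Discriminant

open scoped ComplexConjugate

variable {c : ℕ → ℂ} {p : ℕ} {z : ℂ} {θ x : ℝ}

theorem exp_arg_mul_I (hz : ‖z‖ = 1) : Complex.exp (z.arg * Complex.I) = z := by
  simpa [hz] using Complex.norm_mul_exp_arg_mul_I z

theorem arg_exp_mul_I_of_mem (hθ : θ ∈ Ioc (-Real.pi) Real.pi) :
    (Complex.exp (θ * Complex.I)).arg = θ := by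
  rw [Complex.exp_mul_I, Complex.arg_cos_add_sin_mul_I hθ]

theorem im_eq_zero_of_sq_eq_ofReal {w : ℂ} {r : ℝ} (hr : 0 ≤ r) (h : w ^ 2 = r) : w.im = 0 := by
  rw [← Real.sq_sqrt hr, Complex.ofReal_pow, sq_eq_sq_iff_eq_or_eq_neg] at h
  rcases h with rfl | rfl <;> simp

theorem prod_transferMatrix (hc : ∀ j, ‖c j‖ < 1) (z : ℂ) (p : ℕ) :
    (List.ofFn fun j : Fin p => transferMatrix (c j) z).reverse.prod =
      (((√(rhoSq c p))⁻¹ : ℝ) : ℂ) • szegoProd c z p := by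
  induction p with
  | zero => simp [szegoProd, rhoSq]
  | succ p ih =>
    have hlast : transferMatrix (c p) z =
      (((√(1 - ‖c p‖ ^ 2))⁻¹ : ℝ) : ℂ) • szegoMatrix (c p) z := rfl
    rw [List.ofFn_succ', List.concat_eq_append, List.reverse_append, List.reverse_singleton,
      List.singleton_append, List.prod_cons]
    simp only [Fin.val_castSucc, Fin.val_last]
    rw [ih, hlast, szegoProd, rhoSq_succ, Real.sqrt_mul (rhoSq_pos hc p).le, Matrix.smul_mul,
      Matrix.mul_smul, smul_smul, mul_inv_rev, Complex.ofReal_mul]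

theorem discriminant_eq (hc : ∀ j, ‖c j‖ < 1) (p : ℕ) (z : ℂ) :
    discriminant (fun j : Fin p => c j) z =
      z ^ (-(p : ℂ) / 2) * ((((√(rhoSq c p))⁻¹ : ℝ) : ℂ) * (tracePoly c p).eval z) := by
  rw [discriminant, prod_transferMatrix hc, Matrix.trace_smul, eval_tracePoly, smul_eq_mul]

theorem discriminant_sq (hc : ∀ j, ‖c j‖ < 1) (p : ℕ) (z : ℂ) :
    discriminant (fun j : Fin p => c j) z ^ 2 = discSq c p z + 2 := by
  have hpow : (z ^ (-(p : ℂ) / 2)) ^ 2 = (z ^ p)⁻¹ := by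
    rw [← Complex.cpow_nat_mul, Nat.cast_two, mul_div_cancel₀ _ two_ne_zero, Complex.cpow_neg,
      Complex.cpow_natCast]
  have hsqrt : (((√(rhoSq c p))⁻¹ : ℝ) : ℂ) ^ 2 = (rhoSq c p : ℂ)⁻¹ := by
    rw [← Complex.ofReal_pow, inv_pow, Real.sq_sqrt (rhoSq_pos hc p).le, Complex.ofReal_inv]
  rw [discriminant_eq hc, mul_pow, mul_pow, hpow, hsqrt, discSq, sub_add_cancel, div_eq_mul_inv,
    mul_inv]
  ring

theorem discSq_of_norm_eq_one (c : ℕ → ℂ) (p : ℕ) (hz : ‖z‖ = 1) :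
    discSq c p z = ((‖(tracePoly c p).eval z‖ ^ 2 / rhoSq c p - 2 : ℝ) : ℂ) := by
  have hz₀ : z ≠ 0 := norm_ne_zero_iff.mp (hz ▸ one_ne_zero)
  have hrefl := eval_tracePoly_reflection c p hz₀
  rw [inv_conj_of_norm_eq_one hz] at hrefl
  set τ := (tracePoly c p).eval z
  have hτ : τ ^ 2 = z ^ p * ((‖τ‖ ^ 2 : ℝ) : ℂ) := by
    rw [← Complex.normSq_eq_norm_sq, ← Complex.mul_conj]
    linear_combination τ * hrefl
  rw [discSq, hτ, mul_comm (rhoSq c p : ℂ), mul_div_mul_left _ _ (pow_ne_zero p hz₀)]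
  push_cast
  rfl

theorem im_discriminant (hc : ∀ j, ‖c j‖ < 1) (p : ℕ) (hz : ‖z‖ = 1) :
    (discriminant (fun j : Fin p => c j) z).im = 0 := by
  refine im_eq_zero_of_sq_eq_ofReal
    (r := ‖(tracePoly c p).eval z‖ ^ 2 / rhoSq c p) (by have := rhoSq_pos hc p; positivity) ?_
  rw [discriminant_sq hc, discSq_of_norm_eq_one c p hz]
  push_cast
  ring

theorem re_discriminant_sq (hc : ∀ j, ‖c j‖ < 1) (p : ℕ) (hz : ‖z‖ = 1) :
    (discriminant (fun j : Fin p => c j) z).re ^ 2 = (discSq c p z).re + 2 := by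
  have h := congrArg Complex.re (discriminant_sq hc p z)
  rwa [sq, Complex.mul_re, im_discriminant hc p hz, mul_zero, sub_zero, ← sq, Complex.add_re,
    Complex.re_ofNat] at h

theorem mem_bandSet_iff (hc : ∀ j, ‖c j‖ < 1) (hp : 0 < p) (z : ℂ) :
    z ∈ bandSet (fun j : Fin p => c j) ↔ ‖z‖ = 1 ∧ (discSq c p z).re ≤ 2 := by
  constructor
  · rintro ⟨hz, x, hx, hD⟩
    have hx2 : x ^ 2 ≤ 4 := by nlinarith [hx.1, hx.2]
    have hdisc : discSq c p z = ((x ^ 2 - 2 : ℝ) : ℂ) := by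
      rw [← sub_eq_iff_eq_add.mpr (discriminant_sq hc p z), hD]
      push_cast
      rfl
    have hcos : 2 * Real.cos (Real.arccos ((x ^ 2 - 2) / 2)) = x ^ 2 - 2 := by
      rw [Real.cos_arccos (by linarith [sq_nonneg x]) (by linarith)]
      ring
    refine ⟨norm_eq_one_of_discSq_eq hc hp hz (by rw [hdisc, hcos]), ?_⟩
    rw [hdisc, Complex.ofReal_re]
    linarith
  · rintro ⟨hz, hdisc⟩
    refine ⟨norm_ne_zero_iff.mp (hz ▸ one_ne_zero), _, ?_,
      Complex.ext rfl (im_discriminant hc p hz)⟩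
    have h := re_discriminant_sq hc p hz
    exact abs_le.mp (abs_le_of_sq_le_sq (by linarith) (by norm_num))

/-- The function `Δ(e^{iθ})² - 2`. -/
noncomputable def discAngle (c : ℕ → ℂ) (p : ℕ) (θ : ℝ) : ℝ :=
  ‖(tracePoly c p).eval (Complex.exp (θ * Complex.I))‖ ^ 2 / rhoSq c p - 2

theorem discSq_exp (c : ℕ → ℂ) (p : ℕ) (θ : ℝ) :
    discSq c p (Complex.exp (θ * Complex.I)) = (discAngle c p θ : ℂ) :=
  discSq_of_norm_eq_one c p (Complex.norm_exp_ofReal_mul_I θ)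

theorem contDiff_eval_exp (P : ℂ[X]) :
    ContDiff ℝ 1 fun θ : ℝ => P.eval (Complex.exp (θ * Complex.I)) :=
  ((P.contDiff_aeval 1).restrict_scalars ℝ).comp
    (Complex.ofRealCLM.contDiff.mul contDiff_const).cexp

theorem contDiff_discAngle (c : ℕ → ℂ) (p : ℕ) : ContDiff ℝ 1 (discAngle c p) :=
  (((contDiff_eval_exp _).norm_sq ℝ).div_const _).sub contDiff_const

theorem hasDerivAt_discAngle (c : ℕ → ℂ) (p : ℕ) (θ : ℝ) :
    HasDerivAt (discAngle c p) (deriv (discAngle c p) θ) θ :=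
  ((contDiff_discAngle c p).differentiable one_ne_zero θ).hasDerivAt

theorem neg_two_le_discAngle (hc : ∀ j, ‖c j‖ < 1) (p : ℕ) (θ : ℝ) : -2 ≤ discAngle c p θ := by
  have := rhoSq_pos hc p
  rw [discAngle, neg_le_sub_iff_le_add]
  exact le_add_of_nonneg_left (by positivity)

theorem hasDerivAt_exp_mul_I (θ : ℝ) :
    HasDerivAt (fun θ : ℝ => Complex.exp (θ * Complex.I))
      (Complex.exp (θ * Complex.I) * Complex.I) θ := by
  simpa using ((hasDerivAt_id θ).ofReal_comp.mul_const Complex.I).cexp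

theorem eval_levelPoly_exp (hc : ∀ j, ‖c j‖ < 1) (p : ℕ) (x θ : ℝ) :
    (levelPoly c p x).eval (Complex.exp (θ * Complex.I)) =
      rhoSq c p * Complex.exp (θ * Complex.I) ^ p *
        ((discAngle c p θ - 2 * Real.cos x : ℝ) : ℂ) := by
  rw [eval_levelPoly hc p x (Complex.exp_ne_zero _), discSq_exp, Complex.ofReal_sub]

theorem eval_levelPoly_exp_eq_zero_iff (hc : ∀ j, ‖c j‖ < 1) (p : ℕ) (x θ : ℝ) :
    (levelPoly c p x).eval (Complex.exp (θ * Complex.I)) = 0 ↔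
      discAngle c p θ = 2 * Real.cos x := by
  rw [eval_levelPoly_eq_zero_iff hc p x (Complex.exp_ne_zero _), discSq_exp, Complex.ofReal_inj]

/-- The angle `x ∈ [0, π]` with `Δ(e^{iθ})² - 2 = 2 cos x`, where `e^{iθ}` lies in the bands. -/
noncomputable def bandPhase (c : ℕ → ℂ) (p : ℕ) (θ : ℝ) : ℝ :=
  Real.arccos (discAngle c p θ / 2)

theorem two_mul_cos_bandPhase (hθ : discAngle c p θ ∈ Icc (-2) 2) :
    2 * Real.cos (bandPhase c p θ) = discAngle c p θ := by
  rw [bandPhase, Real.cos_arccos (by linarith [hθ.1]) (by linarith [hθ.2])]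
  ring

theorem bandPhase_mem_Ioo_iff :
    bandPhase c p θ ∈ Ioo 0 Real.pi ↔ discAngle c p θ ∈ Ioo (-2) 2 := by
  rw [mem_Ioo, mem_Ioo, bandPhase, Real.arccos_pos, Real.arccos_lt_pi, and_comm,
    div_lt_one two_pos, lt_div_iff₀ two_pos, neg_one_mul]

theorem deriv_discAngle_ne_zero (hc : ∀ j, ‖c j‖ < 1) (hp : 0 < p)
    (hθ : discAngle c p θ ∈ Ioo (-2) 2) : deriv (discAngle c p) θ ≠ 0 := by
  intro hcrit
  set x := bandPhase c p θ
  have hcos : discAngle c p θ = 2 * Real.cos x :=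
    (two_mul_cos_bandPhase (Ioo_subset_Icc_self hθ)).symm
  have hpoly : HasDerivAt (fun φ : ℝ => (levelPoly c p x).eval (Complex.exp (φ * Complex.I)))
      ((derivative (levelPoly c p x)).eval (Complex.exp (θ * Complex.I)) *
        (Complex.exp (θ * Complex.I) * Complex.I)) θ :=
    ((levelPoly c p x).hasDerivAt _).comp θ (hasDerivAt_exp_mul_I θ)
  have hzero : HasDerivAt (fun φ : ℝ => (levelPoly c p x).eval (Complex.exp (φ * Complex.I)))
      0 θ := by
    simp only [eval_levelPoly_exp hc]
    refine ((((hasDerivAt_exp_mul_I θ).pow p).const_mul (rhoSq c p : ℂ)).mul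
      ((hasDerivAt_discAngle c p θ).sub_const (2 * Real.cos x)).ofReal_comp).congr_deriv ?_
    simp [hcos, hcrit]
  exact mul_ne_zero (derivative_levelPoly_ne_zero hc hp (bandPhase_mem_Ioo_iff.mpr hθ)
    ((eval_levelPoly_exp_eq_zero_iff hc p x θ).mpr hcos))
    (mul_ne_zero (Complex.exp_ne_zero _) Complex.I_ne_zero) (hpoly.unique hzero)

theorem hasStrictDerivAt_bandPhase (hθ : discAngle c p θ ∈ Ioo (-2) 2) :
    HasStrictDerivAt (bandPhase c p)
      (-(deriv (discAngle c p) θ / √(4 - discAngle c p θ ^ 2))) θ := by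
  have hdisc : HasStrictDerivAt (discAngle c p) (deriv (discAngle c p) θ) θ :=
    (contDiff_discAngle c p).hasStrictDerivAt one_ne_zero
  have hsqrt : √(4 - discAngle c p θ ^ 2) = 2 * √(1 - (discAngle c p θ / 2) ^ 2) := by
    rw [show 4 - discAngle c p θ ^ 2 = 2 ^ 2 * (1 - (discAngle c p θ / 2) ^ 2) by ring,
      Real.sqrt_mul (by norm_num), Real.sqrt_sq (by norm_num)]
  refine ((Real.hasStrictDerivAt_arccos (by linarith [hθ.1]) (by linarith [hθ.2])).comp θ
    (hdisc.div_const 2)).congr_deriv ?_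
  rw [hsqrt]
  field_simp

/-- The angles in `(-π, π]` of the points in the interior of the bands where `Δ ≠ 0`. -/
def bandAngles (c : ℕ → ℂ) (p : ℕ) : Set ℝ :=
  Ioc (-Real.pi) Real.pi ∩ discAngle c p ⁻¹' Ioo (-2) 2

theorem measurableSet_bandAngles (c : ℕ → ℂ) (p : ℕ) : MeasurableSet (bandAngles c p) :=
  measurableSet_Ioc.inter ((contDiff_discAngle c p).continuous.measurable measurableSet_Ioo)

theorem bandAngles_inter_bandPhase_preimage (hc : ∀ j, ‖c j‖ < 1) (hp : 0 < p)
    (hx : x ∈ Ioo 0 Real.pi) :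
    bandAngles c p ∩ bandPhase c p ⁻¹' {x} = Complex.arg '' {z | (levelPoly c p x).eval z = 0} := by
  ext θ
  constructor
  · rintro ⟨⟨hθ, hmem⟩, rfl⟩
    exact ⟨Complex.exp (θ * Complex.I), (eval_levelPoly_exp_eq_zero_iff hc p _ θ).mpr
      (two_mul_cos_bandPhase (Ioo_subset_Icc_self hmem)).symm, arg_exp_mul_I_of_mem hθ⟩
  · rintro ⟨z, hz, rfl⟩
    have hroot : (levelPoly c p x).eval (Complex.exp (z.arg * Complex.I)) = 0 := by
      rwa [exp_arg_mul_I (norm_eq_one_of_eval_levelPoly_eq_zero hc hp hz)]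
    have hphase : bandPhase c p z.arg = x := by
      rw [bandPhase, (eval_levelPoly_exp_eq_zero_iff hc p x _).mp hroot,
        mul_div_cancel_left₀ _ two_ne_zero, Real.arccos_cos hx.1.le hx.2.le]
    exact ⟨⟨Complex.arg_mem_Ioc z, bandPhase_mem_Ioo_iff.mp (hphase ▸ hx)⟩, hphase⟩

theorem fiberSum_bandPhase (hc : ∀ j, ‖c j‖ < 1) (hp : 0 < p) (hx : x ∈ Ioo 0 Real.pi)
    (g : ℂ → ℝ≥0∞) :
    fiberSum (bandPhase c p) (bandAngles c p) (fun θ => g (Complex.exp (θ * Complex.I))) x =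
      ((levelPoly c p x).roots.map g).sum := by
  set Z := (levelPoly c p x).roots.toFinset with hZ
  have hroot (z : ℂ) : z ∈ Z ↔ (levelPoly c p x).eval z = 0 := by
    rw [hZ, Multiset.mem_toFinset, mem_roots (isMonicOfDegree_levelPoly c hp x).ne_zero, IsRoot.def]
  have hexp (z : ℂ) (hz : z ∈ Z) : Complex.exp (z.arg * Complex.I) = z :=
    exp_arg_mul_I (norm_eq_one_of_eval_levelPoly_eq_zero hc hp ((hroot z).mp hz))
  have hset : bandAngles c p ∩ bandPhase c p ⁻¹' {x} = ↑(Z.image Complex.arg) := by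
    rw [bandAngles_inter_bandPhase_preimage hc hp hx, Finset.coe_image]
    congr 1
    ext z
    exact (hroot z).symm
  have hinj : InjOn Complex.arg Z := fun z hz w hw h => by rw [← hexp z hz, h, hexp w hw]
  rw [fiberSum, hset, ← tsum_subtype,
    Finset.tsum_subtype' (Z.image Complex.arg) fun θ : ℝ => g (Complex.exp (θ * Complex.I)),
    Finset.sum_image hinj, Finset.sum_congr rfl fun z hz => by rw [hexp z hz], Finset.sum, hZ,
    Multiset.toFinset_val, (nodup_roots_levelPoly hc hp hx).dedup]

theorem lintegral_bandAngles (hc : ∀ j, ‖c j‖ < 1) (hp : 0 < p) {g : ℂ → ℝ≥0∞}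
    (hg : Measurable g) :
    ∫⁻ θ in bandAngles c p, ENNReal.ofReal (|deriv (discAngle c p) θ| /
        √(4 - discAngle c p θ ^ 2)) * g (Complex.exp (θ * Complex.I)) =
      ∫⁻ x in Ioo 0 Real.pi, ((levelPoly c p x).roots.map g).sum := by
  have hsqrt {θ : ℝ} (hθ : θ ∈ bandAngles c p) : √(4 - discAngle c p θ ^ 2) ≠ 0 :=
    (Real.sqrt_pos.mpr (by nlinarith [hθ.2.1, hθ.2.2])).ne'
  have harea := lintegral_abs_deriv_mul (measurableSet_bandAngles c p)
    (fun θ hθ => hasStrictDerivAt_bandPhase hθ.2)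
    (fun θ hθ => neg_ne_zero.mpr (div_ne_zero (deriv_discAngle_ne_zero hc hp hθ.2) (hsqrt hθ)))
    (g := fun θ => g (Complex.exp (θ * Complex.I))) (hg.comp (by fun_prop))
  simp only [abs_neg, abs_div, abs_of_nonneg (Real.sqrt_nonneg _)] at harea
  rw [harea, ← lintegral_indicator measurableSet_Ioo]
  refine lintegral_congr fun x => ?_
  by_cases hx : x ∈ Ioo 0 Real.pi
  · rw [indicator_of_mem hx, fiberSum_bandPhase hc hp hx]
  · rw [indicator_of_notMem hx, fiberSum_of_notMem_image]
    rintro ⟨θ, hθ, rfl⟩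
    exact hx (bandPhase_mem_Ioo_iff.mpr hθ.2)

end Discriminant

/-! ### The measure of the discriminant -/

section DiscriminantMeasure

variable {c : ℕ → ℂ} (hc : ∀ j, ‖c j‖ < 1) {p : ℕ}

include hc

theorem differentiableAt_discriminant_exp (p : ℕ) {θ : ℝ} (hθ : θ ∈ Ioo (-Real.pi) Real.pi) :
    DifferentiableAt ℝ
      (fun φ : ℝ => discriminant (fun j : Fin p => c j) (Complex.exp (φ * Complex.I))) θ := by
  have hslit : Complex.exp (θ * Complex.I) ∈ Complex.slitPlane := by
    rw [Complex.mem_slitPlane_iff_arg, arg_exp_mul_I_of_mem (Ioo_subset_Ioc_self hθ)]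
    exact ⟨hθ.2.ne, Complex.exp_ne_zero _⟩
  simp only [discriminant_eq hc]
  exact ((((hasDerivAt_id _).cpow_const hslit).differentiableAt.restrictScalars ℝ).comp θ
    (hasDerivAt_exp_mul_I θ).differentiableAt).mul
    (((contDiff_eval_exp _).differentiable one_ne_zero θ).const_mul _)

theorem norm_deriv_discriminant_div {θ : ℝ} (hθ : θ ∈ Ioo (-Real.pi) Real.pi)
    (hmem : discAngle c p θ ∈ Ioo (-2) 2) :
    ‖deriv (fun φ : ℝ => discriminant (fun j : Fin p => c j) (Complex.exp (φ * Complex.I))) θ‖ /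
        √(4 - (discriminant (fun j : Fin p => c j) (Complex.exp (θ * Complex.I))).re ^ 2) =
      2⁻¹ * (|deriv (discAngle c p) θ| / √(4 - discAngle c p θ ^ 2)) := by
  have hre := re_discriminant_sq hc p (Complex.norm_exp_ofReal_mul_I θ)
  rw [discSq_exp, Complex.ofReal_re] at hre
  have hderiv := (differentiableAt_discriminant_exp hc p hθ).hasDerivAt
  set D := fun φ : ℝ => discriminant (fun j : Fin p => c j) (Complex.exp (φ * Complex.I))
  have hsq : (fun φ => D φ ^ 2) = fun φ => ((discAngle c p φ + 2 : ℝ) : ℂ) := by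
    ext φ
    rw [discriminant_sq hc, discSq_exp, Complex.ofReal_add, Complex.ofReal_ofNat]
  have hchain : 2 * D θ * deriv D θ = ((deriv (discAngle c p) θ : ℝ) : ℂ) := by
    have hpow := hderiv.fun_pow 2
    rw [hsq] at hpow
    simpa using hpow.unique ((hasDerivAt_discAngle c p θ).add_const 2).ofReal_comp
  have hnorm : ‖D θ‖ = √(2 + discAngle c p θ) := by
    have h := congrArg norm (congrFun hsq θ)
    rw [norm_pow, Complex.norm_real, Real.norm_eq_abs, abs_of_pos (by linarith [hmem.1])] at h
    rw [add_comm, ← h, Real.sqrt_sq (norm_nonneg _)]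
  have hpos₁ : 0 < √(2 + discAngle c p θ) := Real.sqrt_pos.mpr (by linarith [hmem.1])
  have hpos₂ : 0 < √(2 - discAngle c p θ) := Real.sqrt_pos.mpr (by linarith [hmem.2])
  have habs : |deriv (discAngle c p) θ| = 2 * √(2 + discAngle c p θ) * ‖deriv D θ‖ := by
    rw [← Real.norm_eq_abs, ← Complex.norm_real, ← hchain, norm_mul, norm_mul, hnorm,
      Complex.norm_ofNat]
  rw [habs, hre, show 4 - (discAngle c p θ + 2) = 2 - discAngle c p θ by ring,
    show 4 - discAngle c p θ ^ 2 = (2 + discAngle c p θ) * (2 - discAngle c p θ) by ring,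
    Real.sqrt_mul (by linarith [hmem.1])]
  field_simp

variable (hp : 0 < p)

include hp

theorem finite_discAngle_eq (x : ℝ) :
    (Ioc (-Real.pi) Real.pi ∩ discAngle c p ⁻¹' {2 * Real.cos x}).Finite := by
  refine ((levelPoly c p x).roots.toFinset.finite_toSet.image Complex.arg).subset ?_
  rintro θ ⟨hθ, h⟩
  refine ⟨Complex.exp (θ * Complex.I), ?_, arg_exp_mul_I_of_mem hθ⟩
  rw [Finset.mem_coe, Multiset.mem_toFinset, mem_roots (isMonicOfDegree_levelPoly c hp x).ne_zero]
  exact (eval_levelPoly_exp_eq_zero_iff hc p x θ).mpr h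

theorem ae_eq_bandAngles :
    {θ : ℝ | θ ∈ Ioc (-Real.pi) Real.pi ∧
      Complex.exp (θ * Complex.I) ∈ bandSet fun j : Fin p => c j} =ᵐ[volume] bandAngles c p := by
  filter_upwards [measure_eq_zero_iff_ae_notMem.mp ((finite_discAngle_eq hc hp 0).measure_zero _),
    measure_eq_zero_iff_ae_notMem.mp ((finite_discAngle_eq hc hp Real.pi).measure_zero _)]
    with θ hθ₀ hθπ
  have hband := mem_bandSet_iff hc hp (Complex.exp (θ * Complex.I))
  rw [discSq_exp, Complex.ofReal_re, Complex.norm_exp_ofReal_mul_I, eq_self, true_and] at hband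
  refine eq_iff_iff.mpr (and_congr_right fun hθ => hband.trans ⟨fun h => ⟨?_, ?_⟩, fun h => h.2.le⟩)
  · exact lt_of_le_of_ne (neg_two_le_discAngle hc p θ) fun h' => hθπ ⟨hθ, by simp [← h']⟩
  · exact lt_of_le_of_ne h fun h' => hθ₀ ⟨hθ, by simp [h']⟩

omit hp in
theorem measurable_discriminantMeasure_density (p : ℕ) :
    Measurable fun θ : ℝ => ENNReal.ofReal ((Real.pi * p)⁻¹ *
      (‖deriv (fun φ : ℝ => discriminant (fun j : Fin p => c j) (Complex.exp (φ * Complex.I))) θ‖ /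
        √(4 - (discriminant (fun j : Fin p => c j) (Complex.exp (θ * Complex.I))).re ^ 2))) := by
  have hτ : Measurable fun z => (tracePoly c p).eval z := (tracePoly c p).continuous.measurable
  have hD : Measurable fun θ : ℝ =>
      discriminant (fun j : Fin p => c j) (Complex.exp (θ * Complex.I)) := by
    simp only [discriminant_eq hc]
    fun_prop
  exact ((((measurable_deriv _).norm).div
    ((measurable_const.sub (hD.re.pow_const 2)).sqrt)).const_mul _).ennreal_ofReal

theorem lintegral_discriminantMeasure {g : ℂ → ℝ≥0∞} (hg : Measurable g) :
    ∫⁻ w, g w ∂(discriminantMeasure fun j : Fin p => c j) =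
      ENNReal.ofReal ((2 * Real.pi * p)⁻¹) * ∫⁻ θ in bandAngles c p,
        ENNReal.ofReal (|deriv (discAngle c p) θ| / √(4 - discAngle c p θ ^ 2)) *
          g (Complex.exp (θ * Complex.I)) := by
  have hexp : Measurable fun θ : ℝ => Complex.exp (θ * Complex.I) := by fun_prop
  have hgexp : Measurable fun θ : ℝ => g (Complex.exp (θ * Complex.I)) := hg.comp hexp
  rw [discriminantMeasure, lintegral_map hg hexp, lintegral_withDensity_eq_lintegral_mul _
    (measurable_discriminantMeasure_density hc p) hgexp,
    setLIntegral_congr (ae_eq_bandAngles hc hp), ← lintegral_const_mul' _ _ ENNReal.ofReal_ne_top]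
  refine setLIntegral_congr_fun_ae (measurableSet_bandAngles c p) ?_
  filter_upwards [Measure.ae_ne volume Real.pi] with θ hθπ hθ
  rw [Pi.mul_apply, norm_deriv_discriminant_div hc ⟨hθ.1.1, lt_of_le_of_ne hθ.1.2 hθπ⟩ hθ.2,
    ← mul_assoc, ← mul_assoc, ENNReal.ofReal_mul (by positivity),
    show (Real.pi * p)⁻¹ * 2⁻¹ = (2 * Real.pi * p)⁻¹ by rw [← mul_inv]; ring]

theorem lintegral_discriminantMeasure_eq_roots {g : ℂ → ℝ≥0∞} (hg : Measurable g) :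
    ∫⁻ w, g w ∂(discriminantMeasure fun j : Fin p => c j) =
      ENNReal.ofReal ((2 * Real.pi * p)⁻¹) *
        ∫⁻ x in Ioo 0 Real.pi, ((levelPoly c p x).roots.map g).sum := by
  rw [lintegral_discriminantMeasure hc hp hg, lintegral_bandAngles hc hp hg]

omit hc in
theorem card_roots_levelPoly (c : ℕ → ℂ) (x : ℝ) : (levelPoly c p x).roots.card = p * 2 := by
  rw [splits_iff_card_roots.mp (IsAlgClosed.splits _),
    (isMonicOfDegree_levelPoly c hp x).natDegree_eq]

theorem isProbabilityMeasure_discriminantMeasure :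
    IsProbabilityMeasure (discriminantMeasure fun j : Fin p => c j) := by
  have hsum (x : ℝ) : ((levelPoly c p x).roots.map fun _ => (1 : ℝ≥0∞)).sum =
      ENNReal.ofReal (p * 2) := by
    rw [Multiset.map_const', Multiset.sum_replicate, card_roots_levelPoly hp, nsmul_one]
    norm_cast
  constructor
  rw [← lintegral_one, lintegral_discriminantMeasure_eq_roots hc hp measurable_const]
  simp only [hsum, lintegral_const, Measure.restrict_apply_univ, Real.volume_Ioo, sub_zero]
  rw [← ENNReal.ofReal_mul (by positivity), ← ENNReal.ofReal_mul (by positivity),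
    ENNReal.ofReal_eq_one]
  field_simp

theorem measurableSet_bandSet : MeasurableSet (bandSet fun j : Fin p => c j) := by
  have hτ : Measurable fun z => (tracePoly c p).eval z := (tracePoly c p).continuous.measurable
  have hdisc : Measurable fun z => (discSq c p z).re := by
    unfold discSq
    fun_prop
  have hband : (bandSet fun j : Fin p => c j) = {z | ‖z‖ = 1} ∩ {z | (discSq c p z).re ≤ 2} :=
    Set.ext (mem_bandSet_iff hc hp)
  rw [hband]
  exact (measurableSet_eq_fun measurable_norm measurable_const).inter
    (measurableSet_le hdisc measurable_const)

theorem discriminantMeasure_compl_bandSet :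
    discriminantMeasure (fun j : Fin p => c j) (bandSet fun j : Fin p => c j)ᶜ = 0 := by
  have hcompl := (measurableSet_bandSet hc hp).compl
  rw [← lintegral_indicator_one hcompl, lintegral_discriminantMeasure hc hp
    (measurable_one.indicator hcompl)]
  refine mul_eq_zero_of_right _ (setLIntegral_eq_zero (measurableSet_bandAngles c p) fun θ hθ => ?_)
  have hmem : Complex.exp (θ * Complex.I) ∈ bandSet fun j : Fin p => c j := by
    rw [mem_bandSet_iff hc hp, discSq_exp, Complex.ofReal_re]
    exact ⟨Complex.norm_exp_ofReal_mul_I θ, hθ.2.2.le⟩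
  simp [hmem]

end DiscriminantMeasure

/-! ### The logarithmic potential of `ν_Δ` -/

theorem norm_add_inv_sub_two_cos {Y : ℂ} (hY : Y ≠ 0) (x : ℝ) :
    ‖Y + Y⁻¹ - ((2 * Real.cos x : ℝ) : ℂ)‖ =
      ‖circleMap 0 1 x - Y‖ * ‖circleMap 0 1 x - Y⁻¹‖ := by
  have he₀ : circleMap 0 1 x ≠ 0 := circleMap_ne_center one_ne_zero
  have he : ‖circleMap 0 1 x‖ = 1 := by simp
  have hcos : circleMap 0 1 x + (circleMap 0 1 x)⁻¹ = (2 * Real.cos x : ℝ) := by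
    simpa [circleMap] using exp_mul_I_add_inv x
  rw [← hcos]
  generalize circleMap 0 1 x = e at he he₀
  have hfactor : Y + Y⁻¹ - (e + e⁻¹) = -(e⁻¹ * ((e - Y) * (e - Y⁻¹))) := by
    field_simp
    ring
  rw [hfactor, norm_neg, norm_mul, norm_inv, he, inv_one, one_mul, norm_mul]

theorem log_norm_add_inv_sub_two_cos_ae_eq {Y : ℂ} (hY : Y ≠ 0) :
    (fun x => Real.log ‖circleMap 0 1 x - Y‖ + Real.log ‖circleMap 0 1 x - Y⁻¹‖) =ᵐ[volume]
      fun x : ℝ => Real.log ‖Y + Y⁻¹ - ((2 * Real.cos x : ℝ) : ℂ)‖ := by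
  have hne (a : ℂ) : ∀ᵐ x : ℝ, circleMap 0 1 x ≠ a :=
    measure_eq_zero_iff_ae_notMem.mp
      (((countable_singleton a).preimage_circleMap 0 one_ne_zero).measure_zero volume)
  filter_upwards [hne Y, hne Y⁻¹] with x hx hx'
  rw [norm_add_inv_sub_two_cos hY, Real.log_mul (norm_ne_zero_iff.mpr (sub_ne_zero.mpr hx))
    (norm_ne_zero_iff.mpr (sub_ne_zero.mpr hx'))]

theorem posLog_add_posLog_inv (r : ℝ) : Real.posLog r + Real.posLog r⁻¹ = |Real.log r| := by
  rw [Real.posLog, Real.posLog, Real.log_inv]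
  rcases le_total 0 (Real.log r) with h | h
  · rw [max_eq_right h, max_eq_left (by linarith), abs_of_nonneg h, add_zero]
  · rw [max_eq_left h, max_eq_right (by linarith), abs_of_nonpos h, zero_add]

/-- Jensen's formula for `w ↦ (w - Y) (w - Y⁻¹)`. -/
theorem intervalIntegral_log_sub_two_cos {Y : ℂ} (hY : Y ≠ 0) :
    IntervalIntegrable (fun x : ℝ => Real.log ‖Y + Y⁻¹ - ((2 * Real.cos x : ℝ) : ℂ)‖) volume 0
      (2 * Real.pi) ∧
    ∫ x in (0 : ℝ)..2 * Real.pi, Real.log ‖Y + Y⁻¹ - ((2 * Real.cos x : ℝ) : ℂ)‖ =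
      2 * Real.pi * |Real.log ‖Y‖| := by
  have hint (a : ℂ) : IntervalIntegrable (fun x => Real.log ‖circleMap 0 1 x - a‖) volume 0
      (2 * Real.pi) := circleIntegrable_log_norm_sub_const (a := a) (c := 0) 1
  have hval (a : ℂ) : ∫ x in (0 : ℝ)..2 * Real.pi, Real.log ‖circleMap 0 1 x - a‖ =
      2 * Real.pi * Real.posLog ‖a‖ := by
    rw [← circleAverage_log_norm_sub_const_eq_posLog (a := a), Real.circleAverage_def, smul_eq_mul,
      mul_inv_cancel_left₀ Real.two_pi_pos.ne']
  have hae := log_norm_add_inv_sub_two_cos_ae_eq hY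
  refine ⟨((hint Y).add (hint Y⁻¹)).congr_ae (ae_restrict_of_ae hae), ?_⟩
  rw [← intervalIntegral.integral_congr_ae (hae.mono fun x hx _ => hx),
    intervalIntegral.integral_add (hint _) (hint _), hval, hval, ← mul_add, norm_inv,
    posLog_add_posLog_inv]

theorem integral_comp_cos {F : ℝ → ℝ}
    (hF : IntervalIntegrable (fun x => F (Real.cos x)) volume 0 (2 * Real.pi)) :
    IntegrableOn (fun x => F (Real.cos x)) (Ioo 0 Real.pi) ∧
      ∫ x in Ioo 0 Real.pi, F (Real.cos x) =
        (∫ x in (0 : ℝ)..2 * Real.pi, F (Real.cos x)) / 2 := by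
  have hπ := Real.pi_pos
  have hleft : IntervalIntegrable (fun x => F (Real.cos x)) volume 0 Real.pi := hF.mono_set (by
    rw [uIcc_of_le hπ.le, uIcc_of_le Real.two_pi_pos.le]
    exact Icc_subset_Icc_right (by linarith))
  have hright : IntervalIntegrable (fun x => F (Real.cos x)) volume Real.pi (2 * Real.pi) :=
    hF.mono_set (by
      rw [uIcc_of_le (by linarith), uIcc_of_le Real.two_pi_pos.le]
      exact Icc_subset_Icc_left hπ.le)
  have hsymm : ∫ x in Real.pi..2 * Real.pi, F (Real.cos x) =
      ∫ x in (0 : ℝ)..Real.pi, F (Real.cos x) := by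
    have h := intervalIntegral.integral_comp_sub_left (fun x => F (Real.cos x)) (2 * Real.pi)
      (a := 0) (b := Real.pi)
    rw [sub_zero, show 2 * Real.pi - Real.pi = Real.pi by ring] at h
    simp only [← h, Real.cos_two_pi_sub]
  refine ⟨(intervalIntegrable_iff_integrableOn_Ioo_of_le hπ.le).mp hleft, ?_⟩
  rw [← integral_Ioc_eq_integral_Ioo, ← intervalIntegral.integral_of_le hπ.le,
    ← intervalIntegral.integral_add_adjacent_intervals hleft hright, hsymm]
  ring

theorem integral_log_sub_two_cos {Y : ℂ} (hY : Y ≠ 0) :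
    IntegrableOn (fun x : ℝ => Real.log ‖Y + Y⁻¹ - ((2 * Real.cos x : ℝ) : ℂ)‖)
      (Ioo 0 Real.pi) ∧
    ∫ x in Ioo 0 Real.pi, Real.log ‖Y + Y⁻¹ - ((2 * Real.cos x : ℝ) : ℂ)‖ =
      Real.pi * |Real.log ‖Y‖| := by
  obtain ⟨hint, hval⟩ := intervalIntegral_log_sub_two_cos hY
  obtain ⟨hint', hval'⟩ :=
    integral_comp_cos (F := fun u => Real.log ‖Y + Y⁻¹ - ((2 * u : ℝ) : ℂ)‖) hint
  exact ⟨hint', by rw [hval', hval]; ring⟩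

theorem log_norm_multiset_prod {s : Multiset ℂ} (hs : 0 ∉ s) :
    Real.log ‖s.prod‖ = (s.map fun w => Real.log ‖w‖).sum := by
  induction s using Multiset.induction_on with
  | empty => simp
  | cons a s ih =>
    rw [Multiset.mem_cons, not_or] at hs
    rw [Multiset.prod_cons, norm_mul, Real.log_mul (norm_ne_zero_iff.mpr (Ne.symm hs.1))
      (norm_ne_zero_iff.mpr (Multiset.prod_ne_zero hs.2)), ih hs.2, Multiset.map_cons,
      Multiset.sum_cons]

theorem log_norm_eval_eq_sum_roots {P : ℂ[X]} (hP : P.Monic) {z : ℂ} (hz : P.eval z ≠ 0) :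
    Real.log ‖P.eval z‖ = (P.roots.map fun w => Real.log ‖z - w‖).sum := by
  have hprod := (IsAlgClosed.splits P).eval_eq_prod_roots_of_monic hP z
  rw [hprod, log_norm_multiset_prod, Multiset.map_map]
  · rfl
  · rwa [← Multiset.prod_eq_zero_iff, ← hprod]

theorem log_norm_sub_le_log_two {z w : ℂ} (hz : ‖z‖ ≤ 1) (hw : ‖w‖ ≤ 1) :
    Real.log ‖z - w‖ ≤ Real.log 2 := by
  rcases eq_or_ne (z - w) 0 with h | h
  · rw [h, norm_zero, Real.log_zero]
    exact Real.log_nonneg one_le_two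
  · exact Real.log_le_log (norm_pos_iff.mpr h) ((norm_sub_le z w).trans (by linarith))

theorem sum_map_ofReal {ι : Type*} {s : Multiset ι} {f : ι → ℝ} (hf : ∀ i ∈ s, 0 ≤ f i) :
    (s.map fun i => ENNReal.ofReal (f i)).sum = ENNReal.ofReal (s.map f).sum := by
  induction s using Multiset.induction_on with
  | empty => simp
  | cons a s ih =>
    have hs : ∀ i ∈ s, 0 ≤ f i := fun i hi => hf i (Multiset.mem_cons_of_mem hi)
    simp only [Multiset.map_cons, Multiset.sum_cons]
    rw [ih hs, ENNReal.ofReal_add (hf a (Multiset.mem_cons_self a s))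
      (Multiset.sum_nonneg (Multiset.forall_mem_map_iff.mpr hs))]

section Potential

variable {c : ℕ → ℂ} (hc : ∀ j, ‖c j‖ < 1) {p : ℕ} {z : ℂ}

include hc

theorem log_norm_eval_levelPoly {x : ℝ} (hx : (levelPoly c p x).eval z ≠ 0) (hz : z ≠ 0) :
    Real.log ‖(levelPoly c p x).eval z‖ = Real.log (rhoSq c p * ‖z‖ ^ p) +
      Real.log ‖discSq c p z - ((2 * Real.cos x : ℝ) : ℂ)‖ := by
  have hR := rhoSq_pos hc p
  rw [eval_levelPoly hc p x hz] at hx ⊢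
  rw [norm_mul, norm_mul, norm_pow, Complex.norm_real, Real.norm_of_nonneg hR.le,
    Real.log_mul (by positivity) (norm_ne_zero_iff.mpr (right_ne_zero_of_mul hx))]

theorem ae_eval_levelPoly_ne_zero (hz : z ≠ 0) :
    ∀ᵐ x ∂(volume.restrict (Ioo 0 Real.pi)), (levelPoly c p x).eval z ≠ 0 := by
  have hsub : (Ioo 0 Real.pi ∩ {x | (levelPoly c p x).eval z = 0}).Subsingleton := by
    rintro x ⟨hx, hxz⟩ y ⟨hy, hyz⟩
    have hcos := ((eval_levelPoly_eq_zero_iff hc p x hz).mp hxz).symm.trans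
      ((eval_levelPoly_eq_zero_iff hc p y hz).mp hyz)
    exact Real.injOn_cos (Ioo_subset_Icc_self hx) (Ioo_subset_Icc_self hy)
      (mul_left_cancel₀ two_ne_zero (Complex.ofReal_injective hcos))
  rw [ae_restrict_iff' measurableSet_Ioo]
  filter_upwards [measure_eq_zero_iff_ae_notMem.mp (hsub.measure_zero volume)] with x hx hx' hz
  exact hx ⟨hx', hz⟩

variable (hp : 0 < p)

include hp

theorem ae_norm_eq_one_discriminantMeasure :
    ∀ᵐ w ∂(discriminantMeasure fun j : Fin p => c j), ‖w‖ = 1 :=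
  measure_mono_null (fun w hw h => hw ((mem_bandSet_iff hc hp w).mp h).1)
    (discriminantMeasure_compl_bandSet hc hp)

theorem integral_discriminantMeasure_eq_roots_of_nonneg {g : ℂ → ℝ} (hg : Measurable g)
    (hg₀ : ∀ w, ‖w‖ = 1 → 0 ≤ g w)
    (hint : IntegrableOn (fun x => ((levelPoly c p x).roots.map g).sum) (Ioo 0 Real.pi)) :
    Integrable g (discriminantMeasure fun j : Fin p => c j) ∧
      ∫ w, g w ∂(discriminantMeasure fun j : Fin p => c j) =
        (2 * Real.pi * p)⁻¹ * ∫ x in Ioo 0 Real.pi, ((levelPoly c p x).roots.map g).sum := by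
  have hroots (x : ℝ) : ∀ w ∈ (levelPoly c p x).roots, 0 ≤ g w := fun w hw =>
    hg₀ w (norm_eq_one_of_eval_levelPoly_eq_zero hc hp (isRoot_of_mem_roots hw))
  have hsum₀ (x : ℝ) : 0 ≤ ((levelPoly c p x).roots.map g).sum :=
    Multiset.sum_nonneg (Multiset.forall_mem_map_iff.mpr (hroots x))
  have hint₀ : 0 ≤ ∫ x in Ioo 0 Real.pi, ((levelPoly c p x).roots.map g).sum :=
    integral_nonneg hsum₀
  set ν := discriminantMeasure fun j : Fin p => c j
  have hae : 0 ≤ᵐ[ν] g := (ae_norm_eq_one_discriminantMeasure hc hp).mono hg₀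
  have hlint : ∫⁻ w, ENNReal.ofReal (g w) ∂ν = ENNReal.ofReal ((2 * Real.pi * p)⁻¹ *
      ∫ x in Ioo 0 Real.pi, ((levelPoly c p x).roots.map g).sum) := by
    rw [lintegral_discriminantMeasure_eq_roots hc hp hg.ennreal_ofReal,
      ENNReal.ofReal_mul (by positivity),
      ofReal_integral_eq_lintegral_ofReal hint (ae_of_all _ hsum₀)]
    simp only [sum_map_ofReal (hroots _)]
  refine ⟨⟨hg.aestronglyMeasurable, ?_⟩, ?_⟩
  · rw [hasFiniteIntegral_iff_ofReal hae, hlint]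
    exact ENNReal.ofReal_lt_top
  · rw [integral_eq_lintegral_of_nonneg_ae hae hg.aestronglyMeasurable, hlint,
      ENNReal.toReal_ofReal (by positivity)]

theorem integral_discriminantMeasure_eq_roots {g : ℂ → ℝ} (hg : Measurable g) {C : ℝ}
    (hgC : ∀ w, ‖w‖ = 1 → g w ≤ C)
    (hint : IntegrableOn (fun x => ((levelPoly c p x).roots.map g).sum) (Ioo 0 Real.pi)) :
    Integrable g (discriminantMeasure fun j : Fin p => c j) ∧
      ∫ w, g w ∂(discriminantMeasure fun j : Fin p => c j) =
        (2 * Real.pi * p)⁻¹ * ∫ x in Ioo 0 Real.pi, ((levelPoly c p x).roots.map g).sum := by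
  have hsum (x : ℝ) : ((levelPoly c p x).roots.map fun w => C - g w).sum =
      2 * p * C - ((levelPoly c p x).roots.map g).sum := by
    rw [Multiset.sum_map_sub, Multiset.map_const', Multiset.sum_replicate,
      card_roots_levelPoly hp, nsmul_eq_mul]
    push_cast
    ring
  have hconst : IntegrableOn (fun _ : ℝ => 2 * p * C) (Ioo 0 Real.pi) :=
    integrableOn_const (by simp)
  obtain ⟨hi, hv⟩ := integral_discriminantMeasure_eq_roots_of_nonneg hc hp
    (g := fun w => C - g w) (by fun_prop) (fun w hw => sub_nonneg.mpr (hgC w hw))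
    (by simpa only [hsum, Pi.sub_def] using hconst.sub hint)
  have := isProbabilityMeasure_discriminantMeasure hc hp
  have hgi : Integrable g (discriminantMeasure fun j : Fin p => c j) := by
    simpa only [Pi.sub_def, sub_sub_cancel] using (integrable_const C).sub hi
  refine ⟨hgi, ?_⟩
  simp only [hsum] at hv
  rw [integral_sub (integrable_const C) hgi, integral_sub hconst hint, integral_const,
    setIntegral_const, probReal_univ, one_smul, Real.volume_real_Ioo_of_le Real.pi_pos.le,
    smul_eq_mul, sub_zero, mul_sub,
    show (2 * Real.pi * p)⁻¹ * (Real.pi * (2 * p * C)) = C by field_simp] at hv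
  exact sub_right_injective hv

/-- A pair `Y`, `Y⁻¹` with `Y + Y⁻¹ = Δ(z)² - 2` consists of the squares of the eigenvalues of the
normalized monodromy matrix, so `|log ‖Y‖|` is twice the Lyapunov exponent over a period. -/
theorem integral_log_discriminantMeasure {Y : ℂ} (hz₀ : z ≠ 0) (hz : ‖z‖ ≤ 1) (hY : Y ≠ 0)
    (hYz : Y + Y⁻¹ = discSq c p z) :
    Integrable (fun w => Real.log ‖z - w‖) (discriminantMeasure fun j : Fin p => c j) ∧
    ∫ w, Real.log ‖z - w‖ ∂(discriminantMeasure fun j : Fin p => c j) =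
      (Real.log (rhoSq c p * ‖z‖ ^ p) + |Real.log ‖Y‖|) / (2 * p) := by
  obtain ⟨hint, hval⟩ := integral_log_sub_two_cos hY
  rw [hYz] at hint hval
  have hae : (fun x : ℝ => ((levelPoly c p x).roots.map fun w => Real.log ‖z - w‖).sum)
      =ᵐ[volume.restrict (Ioo 0 Real.pi)] fun x => Real.log (rhoSq c p * ‖z‖ ^ p) +
        Real.log ‖discSq c p z - ((2 * Real.cos x : ℝ) : ℂ)‖ := by
    filter_upwards [ae_eval_levelPoly_ne_zero hc hz₀] with x hx
    rw [← log_norm_eval_eq_sum_roots (isMonicOfDegree_levelPoly c hp x).monic hx,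
      log_norm_eval_levelPoly hc hx hz₀]
  have hconst : IntegrableOn (fun _ : ℝ => Real.log (rhoSq c p * ‖z‖ ^ p)) (Ioo 0 Real.pi) :=
    integrableOn_const (by simp)
  obtain ⟨hi, hv⟩ := integral_discriminantMeasure_eq_roots hc hp (by fun_prop)
    (fun w hw => log_norm_sub_le_log_two hz hw.le) ((hconst.add hint).congr hae.symm)
  refine ⟨hi, ?_⟩
  rw [hv, integral_congr_ae hae, integral_add hconst hint, hval, setIntegral_const,
    Real.volume_real_Ioo_of_le Real.pi_pos.le, smul_eq_mul]
  field_simp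
  ring

end Potential

/-! ### Weak convergence of measures on the unit circle -/

theorem norm_integral_sub_integral_le_of_ae_le {α E : Type*} [MeasurableSpace α]
    [NormedAddCommGroup E] [NormedSpace ℝ E] {m : Measure α} [IsProbabilityMeasure m] {f g : α → E}
    (hf : Integrable f m) (hg : Integrable g m) {δ : ℝ} (h : ∀ᵐ w ∂m, ‖g w - f w‖ ≤ δ) :
    ‖∫ w, g w ∂m - ∫ w, f w ∂m‖ ≤ δ := by
  rw [← integral_sub hg hf]
  simpa using norm_integral_le_of_norm_le_const h

theorem tendsto_integral_of_approx {α E ι : Type*} [MeasurableSpace α] [NormedAddCommGroup E]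
    [NormedSpace ℝ E] {l : Filter ι} {μ : ι → Measure α} {ν : Measure α}
    [∀ i, IsProbabilityMeasure (μ i)] [IsProbabilityMeasure ν] {g : α → E}
    (hg : ∀ i, Integrable g (μ i)) (hgν : Integrable g ν)
    (h : ∀ δ > 0, ∃ f : α → E, (∀ i, Integrable f (μ i)) ∧ Integrable f ν ∧
      (∀ i, ∀ᵐ w ∂μ i, ‖g w - f w‖ ≤ δ) ∧ (∀ᵐ w ∂ν, ‖g w - f w‖ ≤ δ) ∧
      Tendsto (fun i => ∫ w, f w ∂μ i) l (𝓝 (∫ w, f w ∂ν))) :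
    Tendsto (fun i => ∫ w, g w ∂μ i) l (𝓝 (∫ w, g w ∂ν)) := by
  rw [Metric.tendsto_nhds]
  intro ε hε
  obtain ⟨f, hf, hfν, hgf, hgfν, hlim⟩ := h (ε / 4) (by positivity)
  filter_upwards [(Metric.tendsto_nhds.mp hlim) (ε / 4) (by positivity)] with i hi
  have hleft := norm_integral_sub_integral_le_of_ae_le (hf i) (hg i) (hgf i)
  have hright := norm_integral_sub_integral_le_of_ae_le hfν hgν hgfν
  rw [← dist_eq_norm] at hleft hright
  have := dist_triangle4 (∫ w, g w ∂μ i) (∫ w, f w ∂μ i) (∫ w, f w ∂ν) (∫ w, g w ∂ν)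
  rw [dist_comm] at hright
  linarith

/-- The angular coordinate of `w`, normalized to have period `1`. -/
noncomputable def unitAngle (w : ℂ) : UnitAddCircle := ((w.arg / (2 * Real.pi) : ℝ) : UnitAddCircle)

theorem measurable_unitAngle : Measurable unitAngle :=
  (AddCircle.continuous_mk' (1 : ℝ)).measurable.comp (Complex.measurable_arg.div_const _)

theorem fourier_unitAngle (n : ℤ) {w : ℂ} (hw : ‖w‖ = 1) : fourier n (unitAngle w) = w ^ n := by
  have hπ : (Real.pi : ℂ) ≠ 0 := by exact_mod_cast Real.pi_ne_zero
  conv_rhs => rw [← exp_arg_mul_I hw]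
  rw [unitAngle, fourier_coe_apply, ← Complex.exp_int_mul]
  congr 1
  push_cast
  field_simp

theorem integrable_comp_unitAngle (q : C(UnitAddCircle, ℂ)) (m : Measure ℂ)
    [IsFiniteMeasure m] : Integrable (fun w => q (unitAngle w)) m :=
  Integrable.of_bound (q.continuous.measurable.comp measurable_unitAngle).aestronglyMeasurable ‖q‖
    (ae_of_all _ fun _ => q.norm_coe_le_norm _)

theorem integral_fourier_unitAngle {m : Measure ℂ} (hm : ∀ᵐ w ∂m, ‖w‖ = 1) (n : ℤ) :
    ∫ w, fourier n (unitAngle w) ∂m = ∫ w, w ^ n ∂m :=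
  integral_congr_ae (hm.mono fun _ hw => fourier_unitAngle n hw)

theorem integral_zpow_neg {m : Measure ℂ} (hm : ∀ᵐ w ∂m, ‖w‖ = 1) (k : ℕ) :
    ∫ w, w ^ (-(k : ℤ)) ∂m = starRingEnd ℂ (∫ w, w ^ k ∂m) := by
  rw [← integral_conj]
  refine integral_congr_ae (hm.mono fun w hw => ?_)
  have hinv : w⁻¹ = starRingEnd ℂ w := inv_eq_iff_eq_inv.mpr (inv_conj_of_norm_eq_one hw).symm
  simp only [zpow_neg, zpow_natCast, map_pow, ← hinv, inv_pow]

section CircleConvergence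

variable {ι : Type*} {l : Filter ι} {μ : ι → Measure ℂ} {ν : Measure ℂ}
  [∀ i, IsProbabilityMeasure (μ i)] [IsProbabilityMeasure ν]
  (hμ : ∀ i, ∀ᵐ w ∂μ i, ‖w‖ = 1) (hν : ∀ᵐ w ∂ν, ‖w‖ = 1)

include hμ hν

theorem tendsto_integral_comp_unitAngle_of_mem_span
    (h : ∀ k : ℕ, Tendsto (fun i => ∫ w, w ^ k ∂μ i) l (𝓝 (∫ w, w ^ k ∂ν)))
    {q : C(UnitAddCircle, ℂ)} (hq : q ∈ Submodule.span ℂ (range (fourier (T := (1 : ℝ))))) :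
    Tendsto (fun i => ∫ w, q (unitAngle w) ∂μ i) l (𝓝 (∫ w, q (unitAngle w) ∂ν)) := by
  induction hq using Submodule.span_induction with
  | mem q hq =>
    obtain ⟨n, rfl⟩ := hq
    simp only [integral_fourier_unitAngle (hμ _), integral_fourier_unitAngle hν]
    obtain ⟨k, rfl | rfl⟩ := n.eq_nat_or_neg
    · simpa only [zpow_natCast] using h k
    · simp only [integral_zpow_neg (hμ _), integral_zpow_neg hν]
      exact (Complex.continuous_conj.tendsto _).comp (h k)
  | zero => simpa using tendsto_const_nhds
  | add q r _ _ hq hr =>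
    have hadd (m : Measure ℂ) [IsProbabilityMeasure m] := integral_add
      (integrable_comp_unitAngle q m) (integrable_comp_unitAngle r m)
    simp only [ContinuousMap.add_apply, hadd]
    exact hq.add hr
  | smul c q _ hq =>
    simp only [ContinuousMap.smul_apply, integral_smul]
    exact hq.const_smul c

theorem tendsto_integral_comp_unitAngle
    (h : ∀ k : ℕ, Tendsto (fun i => ∫ w, w ^ k ∂μ i) l (𝓝 (∫ w, w ^ k ∂ν)))
    (F : C(UnitAddCircle, ℂ)) :
    Tendsto (fun i => ∫ w, F (unitAngle w) ∂μ i) l (𝓝 (∫ w, F (unitAngle w) ∂ν)) := by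
  refine tendsto_integral_of_approx (fun i => integrable_comp_unitAngle F _)
    (integrable_comp_unitAngle F _) fun δ hδ => ?_
  have hF : F ∈ (Submodule.span ℂ (range (fourier (T := (1 : ℝ))))).topologicalClosure := by
    rw [span_fourier_closure_eq_top]
    trivial
  obtain ⟨q, hq, hFq⟩ := Metric.mem_closure_iff.mp hF δ hδ
  have hclose (w : ℂ) : ‖F (unitAngle w) - q (unitAngle w)‖ ≤ δ := by
    rw [← dist_eq_norm]
    exact (ContinuousMap.dist_apply_le_dist _).trans hFq.le
  exact ⟨fun w => q (unitAngle w), fun i => integrable_comp_unitAngle q _,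
    integrable_comp_unitAngle q _, fun i => ae_of_all _ hclose, ae_of_all _ hclose,
    tendsto_integral_comp_unitAngle_of_mem_span hμ hν h hq⟩

theorem tendsto_integral_of_moments
    (h : ∀ k : ℕ, Tendsto (fun i => ∫ w, w ^ k ∂μ i) l (𝓝 (∫ w, w ^ k ∂ν))) (f : ℂ →ᵇ ℝ) :
    Tendsto (fun i => ∫ w, f w ∂μ i) l (𝓝 (∫ w, f w ∂ν)) := by
  let F : C(UnitAddCircle, ℂ) := ⟨fun x => (f (fourier 1 x) : ℂ), by fun_prop⟩
  have hF (w : ℂ) (hw : ‖w‖ = 1) : F (unitAngle w) = (f w : ℂ) := by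
    change ((f (fourier 1 (unitAngle w)) : ℝ) : ℂ) = _
    rw [fourier_unitAngle 1 hw, zpow_one]
  have hre (m : Measure ℂ) (hm : ∀ᵐ w ∂m, ‖w‖ = 1) :
      ∫ w, F (unitAngle w) ∂m = ((∫ w, f w ∂m : ℝ) : ℂ) := by
    rw [← integral_complex_ofReal]
    exact integral_congr_ae (hm.mono hF)
  have hlim := tendsto_integral_comp_unitAngle hμ hν h F
  simp only [hre _ (hμ _), hre _ hν] at hlim
  exact (Complex.continuous_re.tendsto _).comp hlim

end CircleConvergence

theorem norm_sub_eq_norm_one_sub_mul_conj {z w : ℂ} (hw : ‖w‖ = 1) :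
    ‖z - w‖ = ‖1 - z * starRingEnd ℂ w‖ := by
  have h : w * starRingEnd ℂ w = 1 := by
    rw [Complex.mul_conj, Complex.normSq_eq_norm_sq, hw, one_pow, Complex.ofReal_one]
  rw [norm_sub_rev, ← mul_one ‖w - z‖, ← hw, ← Complex.norm_conj w, ← norm_mul, sub_mul, h]

theorem logTaylor_neg (n : ℕ) (u : ℂ) :
    Complex.logTaylor n (-u) = -∑ j ∈ Finset.range n, u ^ j / j := by
  rw [Complex.logTaylor, ← Finset.sum_neg_distrib]
  refine Finset.sum_congr rfl fun j _ => ?_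
  rw [← neg_one_mul u, mul_pow, ← mul_assoc, ← pow_add, Odd.neg_one_pow ⟨j, by ring⟩]
  ring

theorem abs_log_norm_one_sub_add_sum_le {u : ℂ} (hu : ‖u‖ ≤ 1 / 2) (k : ℕ) :
    |Real.log ‖1 - u‖ + ∑ j ∈ Finset.range (k + 1), (u ^ j).re / j| ≤ 2 * ‖u‖ ^ (k + 1) := by
  have hre : (Complex.log (1 - u) + ∑ j ∈ Finset.range (k + 1), u ^ j / j).re =
      Real.log ‖1 - u‖ + ∑ j ∈ Finset.range (k + 1), (u ^ j).re / j := by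
    simp only [Complex.add_re, Complex.log_re, Complex.re_sum, Complex.div_natCast_re]
  have htaylor := Complex.norm_log_sub_logTaylor_le k (z := -u) (by rw [norm_neg]; linarith)
  rw [logTaylor_neg, sub_neg_eq_add, ← sub_eq_add_neg, norm_neg] at htaylor
  have hinv : (1 - ‖u‖)⁻¹ ≤ 2 := by
    rw [inv_le_comm₀ (by linarith) two_pos]
    linarith
  have hinv₀ : 0 ≤ (1 - ‖u‖)⁻¹ := inv_nonneg.mpr (by linarith)
  rw [← hre]
  calc |_| ≤ ‖u‖ ^ (k + 1) * (1 - ‖u‖)⁻¹ / (k + 1) := (Complex.abs_re_le_norm _).trans htaylor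
    _ ≤ ‖u‖ ^ (k + 1) * (1 - ‖u‖)⁻¹ :=
        div_le_self (by positivity) (by linarith [k.cast_nonneg (α := ℝ)])
    _ ≤ ‖u‖ ^ (k + 1) * 2 := by gcongr
    _ = _ := mul_comm _ _

theorem abs_log_norm_one_sub_le {u : ℂ} (hu : ‖u‖ ≤ 1 / 2) : |Real.log ‖1 - u‖| ≤ 2 * ‖u‖ := by
  simpa using abs_log_norm_one_sub_add_sum_le hu 0

theorem abs_log_norm_sub_le {z w : ℂ} (hz : ‖z‖ ≤ 1 / 2) (hw : ‖w‖ = 1) :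
    |Real.log ‖z - w‖| ≤ 1 := by
  have hu : ‖z * starRingEnd ℂ w‖ = ‖z‖ := by rw [norm_mul, Complex.norm_conj, hw, mul_one]
  rw [norm_sub_eq_norm_one_sub_mul_conj hw]
  linarith [abs_log_norm_one_sub_le (hu.trans_le hz)]

theorem integrable_log_norm_sub {m : Measure ℂ} [IsFiniteMeasure m]
    (hm : ∀ᵐ w ∂m, ‖w‖ = 1) {z : ℂ} (hz : ‖z‖ ≤ 1 / 2) :
    Integrable (fun w => Real.log ‖z - w‖) m :=
  Integrable.of_bound (by fun_prop : Measurable fun w => Real.log ‖z - w‖).aestronglyMeasurable 1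
    (hm.mono fun _ hw => abs_log_norm_sub_le hz hw)

theorem integrable_re_pow {m : Measure ℂ} [IsFiniteMeasure m] (hm : ∀ᵐ w ∂m, ‖w‖ = 1) (ζ : ℂ)
    (k : ℕ) : Integrable (fun w => ((ζ * starRingEnd ℂ w) ^ k).re) m := by
  refine Integrable.of_bound (C := ‖ζ‖ ^ k) ?_ (hm.mono fun w hw => ?_)
  · exact (Continuous.measurable (by fun_prop)).aestronglyMeasurable
  · refine (Complex.abs_re_le_norm _).trans_eq ?_
    rw [norm_pow, norm_mul, Complex.norm_conj, hw, mul_one]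

/-- The kernel `log ‖r ζ - w‖` with the first `k` terms of its power series in `r` removed, scaled
so that it tends to `Re (ζ / w) ^ k` as `r → 0` for `w` on the unit circle. -/
noncomputable def logKernelRemainder (k : ℕ) (r : ℝ) (ζ w : ℂ) : ℝ :=
  -(k / r ^ k) * (Real.log ‖r * ζ - w‖ +
    ∑ j ∈ Finset.range k, r ^ j / j * ((ζ * starRingEnd ℂ w) ^ j).re)

theorem norm_re_pow_sub_logKernelRemainder_le {k : ℕ} {r : ℝ} (hr : 0 < r) (hr' : r ≤ 1 / 2)
    (hk : 0 < k) {ζ w : ℂ} (hζ : ‖ζ‖ = 1) (hw : ‖w‖ = 1) :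
    ‖((ζ * starRingEnd ℂ w) ^ k).re - logKernelRemainder k r ζ w‖ ≤ 2 * k * r := by
  rw [logKernelRemainder, norm_sub_eq_norm_one_sub_mul_conj hw, mul_assoc]
  set u := ζ * starRingEnd ℂ w with hu
  have hru : ‖(r : ℂ) * u‖ = r := by
    rw [hu, norm_mul, norm_mul, hζ, Complex.norm_conj, hw, Complex.norm_real,
      Real.norm_of_nonneg hr.le, mul_one, mul_one]
  have hpow (j : ℕ) : (((r : ℂ) * u) ^ j).re = r ^ j * (u ^ j).re := by
    rw [mul_pow, ← Complex.ofReal_pow, Complex.re_ofReal_mul]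
  have htaylor := abs_log_norm_one_sub_add_sum_le (hru.trans_le hr') k
  rw [hru, Finset.sum_range_succ] at htaylor
  simp only [hpow] at htaylor
  have hdiff : (u ^ k).re - -(k / r ^ k) * (Real.log ‖1 - r * u‖ +
      ∑ j ∈ Finset.range k, r ^ j / j * (u ^ j).re) = (k / r ^ k) * (Real.log ‖1 - r * u‖ +
        (∑ j ∈ Finset.range k, r ^ j * (u ^ j).re / j + r ^ k * (u ^ k).re / k)) := by
    simp only [div_mul_eq_mul_div]
    field_simp
    ring
  rw [hdiff, norm_mul, Real.norm_eq_abs, Real.norm_eq_abs, abs_of_pos (by positivity)]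
  calc (k / r ^ k) * |_| ≤ (k / r ^ k) * (2 * r ^ (k + 1)) := by gcongr
    _ = 2 * k * r := by
      rw [pow_succ]
      field_simp

theorem integral_logKernelRemainder {m : Measure ℂ} [IsFiniteMeasure m] (hm : ∀ᵐ w ∂m, ‖w‖ = 1)
    {k : ℕ} {r : ℝ} {ζ : ℂ} (hr : ‖r * ζ‖ ≤ 1 / 2) :
    Integrable (logKernelRemainder k r ζ) m ∧ ∫ w, logKernelRemainder k r ζ w ∂m =
      -(k / r ^ k) * (∫ w, Real.log ‖r * ζ - w‖ ∂m +
        ∑ j ∈ Finset.range k, r ^ j / j * ∫ w, ((ζ * starRingEnd ℂ w) ^ j).re ∂m) := by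
  have hterm (j : ℕ) : Integrable (fun w => r ^ j / j * ((ζ * starRingEnd ℂ w) ^ j).re) m :=
    (integrable_re_pow hm ζ j).const_mul _
  have hsum : Integrable
      (fun w => ∑ j ∈ Finset.range k, r ^ j / j * ((ζ * starRingEnd ℂ w) ^ j).re) m :=
    integrable_finsetSum _ fun j _ => hterm j
  have hlog := integrable_log_norm_sub hm hr
  refine ⟨(hlog.add hsum).const_mul _, ?_⟩
  simp only [logKernelRemainder, integral_const_mul, integral_add hlog hsum,
    integral_finsetSum _ fun j _ => hterm j]

theorem integral_pow_eq_re_add_re_mul_I {m : Measure ℂ} [IsFiniteMeasure m]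
    (hm : ∀ᵐ w ∂m, ‖w‖ = 1) {ζ : ℂ} {k : ℕ} (hζ : ζ ^ k = Complex.I) :
    ∫ w, w ^ k ∂m = ((∫ w, ((1 * starRingEnd ℂ w) ^ k).re ∂m : ℝ) : ℂ) +
      ((∫ w, ((ζ * starRingEnd ℂ w) ^ k).re ∂m : ℝ) : ℂ) * Complex.I := by
  have hre : Integrable (fun w => ((((1 * starRingEnd ℂ w) ^ k).re : ℝ) : ℂ)) m :=
    (integrable_re_pow hm 1 k).ofReal
  have him : Integrable (fun w => ((((ζ * starRingEnd ℂ w) ^ k).re : ℝ) : ℂ)) m :=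
    (integrable_re_pow hm ζ k).ofReal
  rw [← integral_complex_ofReal, ← integral_complex_ofReal, ← integral_mul_const,
    ← integral_add hre (him.mul_const _)]
  congr 1
  ext w
  rw [one_mul, mul_pow, hζ, ← map_pow]
  generalize w ^ k = v
  apply Complex.ext <;> simp

theorem exists_pow_eq_I {k : ℕ} (hk : 0 < k) : ∃ ζ : ℂ, ‖ζ‖ = 1 ∧ ζ ^ k = Complex.I := by
  obtain ⟨ζ, hζ⟩ := IsAlgClosed.exists_pow_nat_eq Complex.I hk
  refine ⟨ζ, (pow_eq_one_iff_of_nonneg (norm_nonneg ζ) hk.ne').mp ?_, hζ⟩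
  rw [← norm_pow, hζ, Complex.norm_I]

section PotentialConvergence

variable {ι : Type*} {l : Filter ι} {μ : ι → Measure ℂ} {ν : Measure ℂ}
  [∀ i, IsProbabilityMeasure (μ i)] [IsProbabilityMeasure ν]
  (hμ : ∀ i, ∀ᵐ w ∂μ i, ‖w‖ = 1) (hν : ∀ᵐ w ∂ν, ‖w‖ = 1)
  (h : ∀ z : ℂ, z ≠ 0 → ‖z‖ ≤ 1 / 2 → Tendsto (fun i => ∫ w, Real.log ‖z - w‖ ∂μ i) l
    (𝓝 (∫ w, Real.log ‖z - w‖ ∂ν)))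

include hμ hν h

theorem tendsto_integral_re_pow_of_potential {ζ : ℂ} (hζ : ‖ζ‖ = 1) (k : ℕ) :
    Tendsto (fun i => ∫ w, ((ζ * starRingEnd ℂ w) ^ k).re ∂μ i) l
      (𝓝 (∫ w, ((ζ * starRingEnd ℂ w) ^ k).re ∂ν)) := by
  induction k using Nat.strong_induction_on with
  | _ k ih =>
  rcases k.eq_zero_or_pos with rfl | hk
  · simpa using tendsto_const_nhds
  refine tendsto_integral_of_approx (fun i => integrable_re_pow (hμ i) ζ k)
    (integrable_re_pow hν ζ k) fun δ hδ => ?_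
  have : (0 : ℝ) < k := Nat.cast_pos.mpr hk
  obtain ⟨r, hr, hrδ⟩ : ∃ r > (0 : ℝ), r ≤ 1 / 2 ∧ 2 * k * r ≤ δ := by
    refine ⟨min (1 / 2) (δ / (2 * k)), lt_min (by norm_num) (by positivity), min_le_left _ _, ?_⟩
    rw [← le_div_iff₀' (by positivity)]
    exact min_le_right _ _
  have hrζ : ‖(r : ℂ) * ζ‖ = r := by
    rw [norm_mul, hζ, mul_one, Complex.norm_real, Real.norm_of_nonneg hr.le]
  have hrζ' : ‖(r : ℂ) * ζ‖ ≤ 1 / 2 := hrζ.trans_le hrδ.1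
  have hclose (w : ℂ) (hw : ‖w‖ = 1) :
      ‖((ζ * starRingEnd ℂ w) ^ k).re - logKernelRemainder k r ζ w‖ ≤ δ :=
    (norm_re_pow_sub_logKernelRemainder_le hr hrδ.1 hk hζ hw).trans hrδ.2
  refine ⟨logKernelRemainder k r ζ, fun i => (integral_logKernelRemainder (hμ i) hrζ').1,
    (integral_logKernelRemainder hν hrζ').1, fun i => (hμ i).mono hclose, hν.mono hclose, ?_⟩
  simp only [(integral_logKernelRemainder (hμ _) hrζ').2, (integral_logKernelRemainder hν hrζ').2]
  refine ((h _ (norm_pos_iff.mp (by rwa [hrζ])) hrζ').add ?_).const_mul _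
  exact tendsto_finsetSum _ fun j hj => (ih j (Finset.mem_range.mp hj)).const_mul _

theorem tendsto_integral_of_potential (f : ℂ →ᵇ ℝ) :
    Tendsto (fun i => ∫ w, f w ∂μ i) l (𝓝 (∫ w, f w ∂ν)) := by
  refine tendsto_integral_of_moments hμ hν (fun k => ?_) f
  rcases k.eq_zero_or_pos with rfl | hk
  · simpa using tendsto_const_nhds
  obtain ⟨ζ, hζ, hζk⟩ := exists_pow_eq_I hk
  simp only [integral_pow_eq_re_add_re_mul_I (hμ _) hζk, integral_pow_eq_re_add_re_mul_I hν hζk]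
  have hre := tendsto_integral_re_pow_of_potential hμ hν h (ζ := 1) norm_one k
  have him := tendsto_integral_re_pow_of_potential hμ hν h hζ k
  exact ((Complex.continuous_ofReal.tendsto _).comp hre).add
    (((Complex.continuous_ofReal.tendsto _).comp him).mul_const _)

end PotentialConvergence

/-! ### Positivity of the logarithmic energy on the unit circle -/

/-- The condition under which the mutual logarithmic energy of `μ` and `ν` is a finite Bochner
integral. As `Real.log 0 = 0`, the diagonal has to be required to be negligible. -/
def FiniteMutualEnergy (μ ν : Measure ℂ) : Prop :=
  (∀ᵐ q ∂(μ.prod ν), q.1 ≠ q.2) ∧ Integrable (fun q : ℂ × ℂ => Real.log ‖q.1 - q.2‖) (μ.prod ν)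

theorem norm_one_sub_le_two_mul {u : ℂ} (hu : ‖u‖ = 1) {r : ℝ} (hr₀ : 0 ≤ r) (hr : r ≤ 1) :
    ‖1 - u‖ ≤ 2 * ‖1 - r * u‖ := by
  have hru : ‖(r : ℂ) * u‖ = r := by
    rw [norm_mul, hu, mul_one, Complex.norm_real, Real.norm_of_nonneg hr₀]
  have hdist : 1 - r ≤ ‖1 - r * u‖ := by
    simpa only [norm_one, hru] using norm_sub_norm_le (1 : ℂ) (r * u)
  calc ‖1 - u‖ = ‖(1 - r * u) - ((1 - r : ℝ) : ℂ) * u‖ := by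
        push_cast
        ring_nf
    _ ≤ ‖1 - r * u‖ + (1 - r) := (norm_sub_le _ _).trans_eq (by
        rw [norm_mul, hu, mul_one, Complex.norm_real, Real.norm_of_nonneg (sub_nonneg.mpr hr)])
    _ ≤ 2 * ‖1 - r * u‖ := by linarith

theorem abs_log_norm_one_sub_mul_le {u : ℂ} (hu : ‖u‖ = 1) (hu' : u ≠ 1) {r : ℝ} (hr₀ : 0 ≤ r)
    (hr : r ≤ 1) : |Real.log ‖1 - r * u‖| ≤ Real.log 2 + |Real.log ‖1 - u‖| := by
  have hpos : 0 < ‖1 - u‖ := norm_pos_iff.mpr (sub_ne_zero.mpr hu'.symm)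
  have hlower := norm_one_sub_le_two_mul hu hr₀ hr
  have hpos' : 0 < ‖1 - r * u‖ := by linarith
  have hupper : ‖1 - r * u‖ ≤ 2 := by
    refine (norm_sub_le _ _).trans ?_
    rw [norm_one, norm_mul, hu, mul_one, Complex.norm_real, Real.norm_of_nonneg hr₀]
    linarith
  have hlog := Real.log_le_log hpos hlower
  rw [Real.log_mul two_ne_zero hpos'.ne'] at hlog
  rw [abs_le]
  constructor
  · linarith [neg_abs_le (Real.log ‖1 - u‖)]
  · linarith [abs_nonneg (Real.log ‖1 - u‖), Real.log_le_log hpos' hupper]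

theorem ae_prod_norm_eq_one {μ ν : Measure ℂ} (hμ : ∀ᵐ w ∂μ, ‖w‖ = 1) (hν : ∀ᵐ w ∂ν, ‖w‖ = 1) :
    ∀ᵐ q ∂(μ.prod ν), ‖q.1‖ = 1 ∧ ‖q.2‖ = 1 :=
  (Measure.quasiMeasurePreserving_fst.ae hμ).and (Measure.quasiMeasurePreserving_snd.ae hν)

theorem ae_prod_norm_mul_conj_eq_one {μ ν : Measure ℂ} (hμ : ∀ᵐ w ∂μ, ‖w‖ = 1)
    (hν : ∀ᵐ w ∂ν, ‖w‖ = 1) : ∀ᵐ q ∂(μ.prod ν), ‖q.1 * starRingEnd ℂ q.2‖ = 1 :=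
  (ae_prod_norm_eq_one hμ hν).mono fun q hq => by
    rw [norm_mul, Complex.norm_conj, hq.1, hq.2, mul_one]

section MutualEnergy

variable {μ ν : Measure ℂ} [IsProbabilityMeasure μ] [IsProbabilityMeasure ν]
  (hμ : ∀ᵐ w ∂μ, ‖w‖ = 1) (hν : ∀ᵐ w ∂ν, ‖w‖ = 1)

include hμ hν

theorem integral_re_pow_mul_conj (r : ℝ) (n : ℕ) :
    ∫ q : ℂ × ℂ, ((r * (q.1 * starRingEnd ℂ q.2)) ^ n / n).re ∂(μ.prod ν) =
      r ^ n / n * ((∫ z, z ^ n ∂μ) * starRingEnd ℂ (∫ w, w ^ n ∂ν)).re := by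
  have hint : Integrable (fun q : ℂ × ℂ => q.1 ^ n * starRingEnd ℂ (q.2 ^ n)) (μ.prod ν) :=
    Integrable.of_bound (Continuous.measurable (by fun_prop)).aestronglyMeasurable 1
      ((ae_prod_norm_mul_conj_eq_one hμ hν).mono fun q hq => by
        rw [map_pow, ← mul_pow, norm_pow, hq, one_pow])
  have hre := Complex.reCLM.integral_comp_comm hint
  simp only [Complex.reCLM_apply] at hre
  rw [integral_prod_mul (fun z : ℂ => z ^ n) (fun w : ℂ => starRingEnd ℂ (w ^ n)),
    integral_conj] at hre
  rw [← hre, ← integral_const_mul]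
  congr 1
  ext q
  rw [mul_pow, mul_pow, map_pow, mul_div_right_comm, ← Complex.ofReal_pow,
    ← Complex.ofReal_natCast, ← Complex.ofReal_div, Complex.re_ofReal_mul]

theorem hasSum_abel_energy {r : ℝ} (hr₀ : 0 ≤ r) (hr : r < 1) :
    HasSum (fun n : ℕ => r ^ n / n *
        ((∫ z, z ^ n ∂μ) * starRingEnd ℂ (∫ w, w ^ n ∂ν)).re)
      (∫ q : ℂ × ℂ, -Real.log ‖1 - r * (q.1 * starRingEnd ℂ q.2)‖ ∂(μ.prod ν)) := by
  simp only [← integral_re_pow_mul_conj hμ hν]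
  have hnorm : ∀ᵐ q ∂(μ.prod ν), ‖(r : ℂ) * (q.1 * starRingEnd ℂ q.2)‖ = r :=
    (ae_prod_norm_mul_conj_eq_one hμ hν).mono fun q hq => by
      rw [norm_mul, hq, mul_one, Complex.norm_real, Real.norm_of_nonneg hr₀]
  refine hasSum_integral_of_dominated_convergence (fun n _ => r ^ n)
    (fun n => (Continuous.measurable (by fun_prop)).aestronglyMeasurable) (fun n => ?_)
    (ae_of_all _ fun _ => summable_geometric_of_lt_one hr₀ hr) (integrable_const _) ?_
  · filter_upwards [hnorm] with q hq
    refine (Complex.abs_re_le_norm _).trans ?_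
    rw [norm_div, norm_pow, hq, Complex.norm_natCast]
    rcases n.eq_zero_or_pos with rfl | hn
    · simp
    · exact div_le_self (pow_nonneg hr₀ n) (Nat.one_le_cast.mpr hn)
  · filter_upwards [hnorm] with q hq
    have htaylor := Complex.hasSum_re (Complex.hasSum_taylorSeries_neg_log (hq.trans_lt hr))
    rwa [Complex.neg_re, Complex.log_re] at htaylor

theorem tendsto_abel_energy (h : FiniteMutualEnergy μ ν) :
    Tendsto (fun r : ℝ =>
        ∫ q : ℂ × ℂ, -Real.log ‖1 - r * (q.1 * starRingEnd ℂ q.2)‖ ∂(μ.prod ν)) (𝓝[<] 1)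
      (𝓝 (∫ q : ℂ × ℂ, -Real.log ‖q.1 - q.2‖ ∂(μ.prod ν))) := by
  have hdata : ∀ᵐ q ∂(μ.prod ν), ‖q.1 * starRingEnd ℂ q.2‖ = 1 ∧
      q.1 * starRingEnd ℂ q.2 ≠ 1 ∧ ‖q.1 - q.2‖ = ‖1 - q.1 * starRingEnd ℂ q.2‖ := by
    filter_upwards [ae_prod_norm_eq_one hμ hν, ae_prod_norm_mul_conj_eq_one hμ hν, h.1]
      with q hq hu hne
    have hdist := norm_sub_eq_norm_one_sub_mul_conj (z := q.1) hq.2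
    refine ⟨hu, fun hu' => hne ?_, hdist⟩
    rwa [hu', sub_self, norm_zero, norm_eq_zero, sub_eq_zero] at hdist
  refine tendsto_integral_filter_of_dominated_convergence
    (fun q : ℂ × ℂ => Real.log 2 + |Real.log ‖q.1 - q.2‖|) ?_ ?_
    ((integrable_const _).add h.2.abs) ?_
  · exact Eventually.of_forall fun r =>
      (by fun_prop : Measurable fun q : ℂ × ℂ =>
        -Real.log ‖1 - r * (q.1 * starRingEnd ℂ q.2)‖).aestronglyMeasurable
  · filter_upwards [Ioo_mem_nhdsLT zero_lt_one] with r hr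
    filter_upwards [hdata] with q ⟨hu, hu', hdist⟩
    rw [norm_neg, Real.norm_eq_abs, hdist]
    exact abs_log_norm_one_sub_mul_le hu hu' hr.1.le hr.2.le
  · filter_upwards [hdata] with q ⟨_, hu', hdist⟩
    have hne : ‖1 - ((1 : ℝ) : ℂ) * (q.1 * starRingEnd ℂ q.2)‖ ≠ 0 := by
      rw [Complex.ofReal_one, one_mul]
      exact norm_ne_zero_iff.mpr (sub_ne_zero.mpr hu'.symm)
    have hnorm : ContinuousAt (fun r : ℝ => ‖1 - r * (q.1 * starRingEnd ℂ q.2)‖) 1 := by fun_prop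
    have hlim := (hnorm.log hne).neg.tendsto.mono_left (nhdsWithin_le_nhds (s := Iio 1))
    simpa only [hdist, Pi.neg_def, Complex.ofReal_one, one_mul] using hlim

/-- Quantitative positive definiteness of the logarithmic kernel on the unit circle: the energy of
`μ - ν` is `∑ₖ |mₖ(μ) - mₖ(ν)|² / k`, where `mₖ` is the `k`-th moment. -/
theorem norm_moment_sub_sq_le (hμμ : FiniteMutualEnergy μ μ) (hνν : FiniteMutualEnergy ν ν)
    (hμν : FiniteMutualEnergy μ ν) (k : ℕ) :
    1 / k * ‖∫ w, w ^ k ∂μ - ∫ w, w ^ k ∂ν‖ ^ 2 ≤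
      ∫ q : ℂ × ℂ, -Real.log ‖q.1 - q.2‖ ∂(μ.prod μ) +
      ∫ q : ℂ × ℂ, -Real.log ‖q.1 - q.2‖ ∂(ν.prod ν) -
      2 * ∫ q : ℂ × ℂ, -Real.log ‖q.1 - q.2‖ ∂(μ.prod ν) := by
  have hlim := ((tendsto_abel_energy hμ hμ hμμ).add (tendsto_abel_energy hν hν hνν)).sub
    ((tendsto_abel_energy hμ hν hμν).const_mul 2)
  have hterm : Tendsto (fun r : ℝ => r ^ k / k * ‖∫ w, w ^ k ∂μ - ∫ w, w ^ k ∂ν‖ ^ 2) (𝓝[<] 1)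
      (𝓝 (1 ^ k / k * ‖∫ w, w ^ k ∂μ - ∫ w, w ^ k ∂ν‖ ^ 2)) :=
    (Continuous.tendsto (by fun_prop) 1).mono_left nhdsWithin_le_nhds
  rw [one_pow] at hterm
  refine le_of_tendsto_of_tendsto hterm hlim ?_
  filter_upwards [Ioo_mem_nhdsLT zero_lt_one] with r hr
  have hsum := ((hasSum_abel_energy hμ hμ hr.1.le hr.2).add
    (hasSum_abel_energy hν hν hr.1.le hr.2)).sub
    ((hasSum_abel_energy hμ hν hr.1.le hr.2).mul_left 2)
  have hsq (n : ℕ) : r ^ n / n * ((∫ z, z ^ n ∂μ) * starRingEnd ℂ (∫ w, w ^ n ∂μ)).re +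
      r ^ n / n * ((∫ z, z ^ n ∂ν) * starRingEnd ℂ (∫ w, w ^ n ∂ν)).re -
      2 * (r ^ n / n * ((∫ z, z ^ n ∂μ) * starRingEnd ℂ (∫ w, w ^ n ∂ν)).re) =
      r ^ n / n * ‖∫ w, w ^ n ∂μ - ∫ w, w ^ n ∂ν‖ ^ 2 := by
    rw [← Complex.normSq_eq_norm_sq, Complex.normSq_apply]
    simp only [Complex.mul_re, Complex.conj_re, Complex.conj_im, Complex.sub_re, Complex.sub_im]
    ring
  simp only [hsq] at hsum
  exact le_hasSum hsum k fun n _ => mul_nonneg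
    (div_nonneg (pow_nonneg hr.1.le _) n.cast_nonneg) (sq_nonneg _)

end MutualEnergy

/-! ### The logarithmic energy and the equilibrium measure -/

theorem toENNReal_log_enorm {u : ℂ} (hu : u ≠ 0) :
    (ENNReal.log ‖u‖ₑ).toENNReal = ENNReal.ofReal (Real.log ‖u‖) := by
  rw [← ofReal_norm, ENNReal.log_ofReal_of_pos (norm_pos_iff.mpr hu), EReal.real_coe_toENNReal]

theorem toENNReal_neg_log_enorm {u : ℂ} (hu : u ≠ 0) :
    (-ENNReal.log ‖u‖ₑ).toENNReal = ENNReal.ofReal (-Real.log ‖u‖) := by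
  rw [← ofReal_norm, ENNReal.log_ofReal_of_pos (norm_pos_iff.mpr hu), ← EReal.coe_neg,
    EReal.real_coe_toENNReal]

theorem measurable_toENNReal_log_enorm_sub :
    Measurable fun q : ℂ × ℂ => (ENNReal.log ‖q.1 - q.2‖ₑ).toENNReal :=
  (ENNReal.measurable_log.comp (by fun_prop)).ereal_toENNReal

theorem measurable_toENNReal_neg_log_enorm_sub :
    Measurable fun q : ℂ × ℂ => (-ENNReal.log ‖q.1 - q.2‖ₑ).toENNReal :=
  (ENNReal.measurable_log.comp (by fun_prop)).neg.ereal_toENNReal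

theorem logEnergy_eq_lintegral_prod (μ : Measure ℂ) [SFinite μ] :
    logEnergy μ =
      ((∫⁻ q, (-ENNReal.log ‖q.1 - q.2‖ₑ).toENNReal ∂(μ.prod μ) : ℝ≥0∞) : EReal) -
        ((∫⁻ q, (ENNReal.log ‖q.1 - q.2‖ₑ).toENNReal ∂(μ.prod μ) : ℝ≥0∞) : EReal) := by
  rw [logEnergy, lintegral_prod _ measurable_toENNReal_log_enorm_sub.aemeasurable,
    lintegral_prod _ measurable_toENNReal_neg_log_enorm_sub.aemeasurable]

theorem logEnergy_eq_of_finiteMutualEnergy {μ : Measure ℂ} [SFinite μ]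
    (h : FiniteMutualEnergy μ μ) :
    logEnergy μ = ((∫ q : ℂ × ℂ, -Real.log ‖q.1 - q.2‖ ∂(μ.prod μ) : ℝ) : EReal) := by
  obtain ⟨hne, hint⟩ := h
  have hneg : Integrable (fun q : ℂ × ℂ => -Real.log ‖q.1 - q.2‖) (μ.prod μ) := hint.neg
  have hlog : ∫⁻ q : ℂ × ℂ, (ENNReal.log ‖q.1 - q.2‖ₑ).toENNReal ∂(μ.prod μ) =
      ∫⁻ q : ℂ × ℂ, ENNReal.ofReal (Real.log ‖q.1 - q.2‖) ∂(μ.prod μ) :=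
    lintegral_congr_ae (hne.mono fun q hq => toENNReal_log_enorm (sub_ne_zero.mpr hq))
  have hneglog : ∫⁻ q : ℂ × ℂ, (-ENNReal.log ‖q.1 - q.2‖ₑ).toENNReal ∂(μ.prod μ) =
      ∫⁻ q : ℂ × ℂ, ENNReal.ofReal (-Real.log ‖q.1 - q.2‖) ∂(μ.prod μ) :=
    lintegral_congr_ae (hne.mono fun q hq => toENNReal_neg_log_enorm (sub_ne_zero.mpr hq))
  have hsub := integral_eq_lintegral_pos_part_sub_lintegral_neg_part hneg
  simp only [neg_neg] at hsub
  rw [logEnergy_eq_lintegral_prod, hlog, hneglog, hsub, EReal.coe_sub,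
    EReal.coe_ennreal_toReal ((lintegral_mono fun q => Real.ofReal_le_enorm _).trans_lt hneg.2).ne,
    EReal.coe_ennreal_toReal ((lintegral_mono fun q => Real.ofReal_le_enorm _).trans_lt hint.2).ne]

section CircleEnergy

variable {μ : Measure ℂ} [IsProbabilityMeasure μ] (hμ : ∀ᵐ w ∂μ, ‖w‖ = 1)

include hμ

theorem lintegral_toENNReal_log_lt_top :
    ∫⁻ q : ℂ × ℂ, (ENNReal.log ‖q.1 - q.2‖ₑ).toENNReal ∂(μ.prod μ) < ⊤ := by
  have hle : ∀ᵐ q ∂(μ.prod μ), (ENNReal.log ‖q.1 - q.2‖ₑ).toENNReal ≤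
      ENNReal.ofReal (Real.log 2) := by
    filter_upwards [ae_prod_norm_eq_one hμ hμ] with q hq
    rcases eq_or_ne (q.1 - q.2) 0 with h₀ | h₀
    · simp [h₀]
    · rw [toENNReal_log_enorm h₀]
      exact ENNReal.ofReal_le_ofReal (log_norm_sub_le_log_two hq.1.le hq.2.le)
  exact (lintegral_mono_ae hle).trans_lt (by simp)

theorem lintegral_toENNReal_neg_log_lt_top (h : logEnergy μ < ⊤) :
    ∫⁻ q : ℂ × ℂ, (-ENNReal.log ‖q.1 - q.2‖ₑ).toENNReal ∂(μ.prod μ) < ⊤ := by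
  rw [lt_top_iff_ne_top]
  intro htop
  rw [logEnergy_eq_lintegral_prod, htop, EReal.coe_ennreal_top, EReal.top_sub] at h
  · exact lt_irrefl _ h
  · simpa using (lintegral_toENNReal_log_lt_top hμ).ne

theorem finiteMutualEnergy_of_logEnergy_lt_top (h : logEnergy μ < ⊤) :
    FiniteMutualEnergy μ μ := by
  have hlog := lintegral_toENNReal_log_lt_top hμ
  have hneglog := lintegral_toENNReal_neg_log_lt_top hμ h
  have hne : ∀ᵐ q ∂(μ.prod μ), q.1 ≠ q.2 := by
    filter_upwards [ae_lt_top measurable_toENNReal_neg_log_enorm_sub hneglog.ne] with q hq heq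
    simp [heq] at hq
  refine ⟨hne,
    (by fun_prop : Measurable fun q : ℂ × ℂ => Real.log ‖q.1 - q.2‖).aestronglyMeasurable, ?_⟩
  have hle : ∀ᵐ q ∂(μ.prod μ), ENNReal.ofReal ‖Real.log ‖q.1 - q.2‖‖ ≤
      (ENNReal.log ‖q.1 - q.2‖ₑ).toENNReal + (-ENNReal.log ‖q.1 - q.2‖ₑ).toENNReal := by
    filter_upwards [hne] with q hq
    rw [toENNReal_log_enorm (sub_ne_zero.mpr hq), toENNReal_neg_log_enorm (sub_ne_zero.mpr hq),
      Real.norm_eq_abs]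
    rcases le_total 0 (Real.log ‖q.1 - q.2‖) with hq₀ | hq₀
    · rw [abs_of_nonneg hq₀]
      exact le_self_add
    · rw [abs_of_nonpos hq₀]
      exact le_add_self
  rw [hasFiniteIntegral_iff_norm]
  refine (lintegral_mono_ae hle).trans_lt ?_
  rw [lintegral_add_left measurable_toENNReal_log_enorm_sub]
  exact ENNReal.add_lt_top.mpr ⟨hlog, hneglog⟩

end CircleEnergy

theorem measure_eq_of_moments {μ ν : Measure ℂ} [IsProbabilityMeasure μ] [IsProbabilityMeasure ν]
    (hμ : ∀ᵐ w ∂μ, ‖w‖ = 1) (hν : ∀ᵐ w ∂ν, ‖w‖ = 1)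
    (h : ∀ k : ℕ, ∫ w, w ^ k ∂μ = ∫ w, w ^ k ∂ν) : μ = ν := by
  refine ext_of_forall_integral_eq_of_IsFiniteMeasure fun f => ?_
  have hlim := tendsto_integral_of_moments (ι := ℕ) (l := atTop) (μ := fun _ => μ) (fun _ => hμ) hν
    (fun k => by rw [h k]; exact tendsto_const_nhds) f
  exact tendsto_nhds_unique tendsto_const_nhds hlim

section BandEnergy

variable {c : ℕ → ℂ} (hc : ∀ j, ‖c j‖ < 1) {p : ℕ} (hp : 0 < p)

include hc hp

theorem exists_norm_eq_one_add_inv_eq_discSq {z : ℂ} (hz : z ∈ bandSet fun j : Fin p => c j) :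
    ∃ Y : ℂ, Y ≠ 0 ∧ ‖Y‖ = 1 ∧ Y + Y⁻¹ = discSq c p z := by
  obtain ⟨hz₁, hle⟩ := (mem_bandSet_iff hc hp z).mp hz
  have hsq := re_discriminant_sq hc p hz₁
  have hge : -2 ≤ (discSq c p z).re := by
    nlinarith [sq_nonneg (discriminant (fun j : Fin p => c j) z).re]
  refine ⟨Complex.exp (Real.arccos ((discSq c p z).re / 2) * Complex.I), Complex.exp_ne_zero _,
    Complex.norm_exp_ofReal_mul_I _, ?_⟩
  rw [exp_mul_I_add_inv, Real.cos_arccos (by linarith) (by linarith),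
    discSq_of_norm_eq_one c p hz₁, Complex.ofReal_re]
  congr 1
  ring

theorem integral_log_of_mem_bandSet {z : ℂ} (hz : z ∈ bandSet fun j : Fin p => c j) :
    Integrable (fun w => Real.log ‖z - w‖) (discriminantMeasure fun j : Fin p => c j) ∧
    ∫ w, Real.log ‖z - w‖ ∂(discriminantMeasure fun j : Fin p => c j) =
      Real.log (rhoSq c p) / (2 * p) := by
  obtain ⟨Y, hY, hY₁, hYz⟩ := exists_norm_eq_one_add_inv_eq_discSq hc hp hz
  have hz₁ := ((mem_bandSet_iff hc hp z).mp hz).1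
  have hlog := integral_log_discriminantMeasure hc hp hz.1 hz₁.le hY hYz
  rwa [hY₁, hz₁, one_pow, mul_one, Real.log_one, abs_zero, add_zero] at hlog

theorem discriminantMeasure_singleton {z : ℂ} (hz : z ≠ 0) :
    discriminantMeasure (fun j : Fin p => c j) {z} = 0 := by
  have hm := measurableSet_singleton z
  rw [← lintegral_indicator_one hm, lintegral_discriminantMeasure_eq_roots hc hp
    (measurable_one.indicator hm)]
  refine mul_eq_zero_of_right _ ?_
  rw [lintegral_congr_ae (g := fun _ => 0), lintegral_zero]
  filter_upwards [ae_eval_levelPoly_ne_zero hc hz (p := p)] with x hx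
  refine Multiset.sum_eq_zero fun y hy => ?_
  obtain ⟨w, hw, rfl⟩ := Multiset.mem_map.mp hy
  refine indicator_of_notMem (fun hwz => hx ?_) _
  rw [← mem_singleton_iff.mp hwz]
  exact isRoot_of_mem_roots hw

section

variable {μ : Measure ℂ} (hμ : ∀ᵐ z ∂μ, z ∈ bandSet fun j : Fin p => c j)

include hμ

theorem ae_norm_eq_one_of_ae_mem_bandSet : ∀ᵐ z ∂μ, ‖z‖ = 1 :=
  hμ.mono fun z hz => ((mem_bandSet_iff hc hp z).mp hz).1

theorem ae_prod_discriminantMeasure_ne :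
    ∀ᵐ q ∂(μ.prod (discriminantMeasure fun j : Fin p => c j)), q.1 ≠ q.2 := by
  have := isProbabilityMeasure_discriminantMeasure hc hp
  have hdiag : MeasurableSet {q : ℂ × ℂ | q.1 ≠ q.2} :=
    (measurableSet_eq_fun measurable_fst measurable_snd).compl
  rw [Measure.ae_prod_iff_ae_ae hdiag]
  filter_upwards [hμ] with z hz
  filter_upwards [measure_eq_zero_iff_ae_notMem.mp (discriminantMeasure_singleton hc hp hz.1)]
    with w hw heq
  exact hw heq.symm

variable [IsProbabilityMeasure μ]

theorem finiteMutualEnergy_discriminantMeasure :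
    FiniteMutualEnergy μ (discriminantMeasure fun j : Fin p => c j) := by
  have := isProbabilityMeasure_discriminantMeasure hc hp
  have hμ₁ := ae_norm_eq_one_of_ae_mem_bandSet hc hp hμ
  have hν₁ := ae_norm_eq_one_discriminantMeasure hc hp
  refine ⟨ae_prod_discriminantMeasure_ne hc hp hμ, ?_⟩
  set ν := discriminantMeasure fun j : Fin p => c j
  have hmeas : Measurable fun q : ℂ × ℂ => Real.log 2 - Real.log ‖q.1 - q.2‖ := by fun_prop
  have hint : Integrable (fun q : ℂ × ℂ => Real.log 2 - Real.log ‖q.1 - q.2‖) (μ.prod ν) := by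
    rw [integrable_prod_iff hmeas.aestronglyMeasurable]
    have hslice : ∀ᵐ z ∂μ, Integrable (fun w => Real.log 2 - Real.log ‖z - w‖) ν := hμ.mono
      fun z hz => (integrable_const _).sub (integral_log_of_mem_bandSet hc hp hz).1
    refine ⟨hslice, (integrable_const (Real.log 2 - Real.log (rhoSq c p) / (2 * p))).congr ?_⟩
    filter_upwards [hμ, hμ₁] with z hz hz₁
    obtain ⟨hi, hv⟩ := integral_log_of_mem_bandSet hc hp hz
    rw [integral_congr_ae (hν₁.mono fun w hw => Real.norm_of_nonneg (sub_nonneg.mpr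
      (log_norm_sub_le_log_two hz₁.le hw.le))), integral_sub (integrable_const _) hi, hv]
    simp
  simpa only [Pi.sub_def, sub_sub_cancel] using (integrable_const (Real.log 2)).sub hint

theorem mutualEnergy_discriminantMeasure :
    ∫ q : ℂ × ℂ, -Real.log ‖q.1 - q.2‖ ∂(μ.prod (discriminantMeasure fun j : Fin p => c j)) =
      -(Real.log (rhoSq c p) / (2 * p)) := by
  have := isProbabilityMeasure_discriminantMeasure hc hp
  rw [integral_neg, integral_prod _ (finiteMutualEnergy_discriminantMeasure hc hp hμ).2,
    integral_congr_ae (hμ.mono fun z hz => (integral_log_of_mem_bandSet hc hp hz).2)]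
  simp

end

theorem isEquilibriumMeasure_discriminantMeasure :
    IsEquilibriumMeasure (bandSet fun j : Fin p => c j)
      (discriminantMeasure fun j : Fin p => c j) := by
  have hprob := isProbabilityMeasure_discriminantMeasure hc hp
  have hν := discriminantMeasure_compl_bandSet hc hp
  have hν₁ := ae_norm_eq_one_discriminantMeasure hc hp
  set ν := discriminantMeasure fun j : Fin p => c j
  have hνν : FiniteMutualEnergy ν ν := finiteMutualEnergy_discriminantMeasure hc hp hν
  have henergy := logEnergy_eq_of_finiteMutualEnergy hνν
  rw [mutualEnergy_discriminantMeasure hc hp hν] at henergy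
  have hfin : logEnergy ν < ⊤ := by
    rw [henergy]
    exact EReal.coe_lt_top _
  refine ⟨hprob, hν, hfin, fun μ hμprob hμ hle => ?_⟩
  have hμ₁ := ae_norm_eq_one_of_ae_mem_bandSet hc hp hμ
  have hμμ := finiteMutualEnergy_of_logEnergy_lt_top hμ₁ (hle.trans_lt hfin)
  rw [logEnergy_eq_of_finiteMutualEnergy hμμ, henergy, EReal.coe_le_coe_iff] at hle
  refine measure_eq_of_moments hμ₁ hν₁ fun k => ?_
  rcases k.eq_zero_or_pos with rfl | hk
  · simp
  have hmoment := norm_moment_sub_sq_le hμ₁ hν₁ hμμ hνν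
    (finiteMutualEnergy_discriminantMeasure hc hp hμ) k
  rw [mutualEnergy_discriminantMeasure hc hp hν, mutualEnergy_discriminantMeasure hc hp hμ]
    at hmoment
  have hsq : ‖∫ w, w ^ k ∂μ - ∫ w, w ^ k ∂ν‖ ^ 2 ≤ 0 :=
    nonpos_of_mul_nonpos_right (hmoment.trans (by linarith)) (by positivity)
  exact sub_eq_zero.mp (norm_eq_zero.mp (pow_eq_zero_iff two_ne_zero |>.mp
    (hsq.antisymm (sq_nonneg _))))

end BandEnergy

/-! ### Periodic Schur iterates -/

section PeriodicSchur

open scoped Matrix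

theorem norm_schurIter_sub_le_two_thirds {z b b' : ℂ} (hz : ‖z‖ ≤ 1 / 2) {a : ℕ → ℂ}
    (ha : ∀ i, ‖a i‖ ≤ 1) (hb : ‖b‖ ≤ 1) (hb' : ‖b'‖ ≤ 1) {p : ℕ} (hp : 0 < p) :
    ‖schurIter z a b p - schurIter z a b' p‖ ≤ 2 / 3 * ‖b - b'‖ := by
  have hz₁ : ‖z‖ < 1 := by linarith
  have hK₀ : 0 ≤ ‖z‖ / (1 - ‖z‖ ^ 2) := div_nonneg (norm_nonneg z) (one_sub_norm_sq_pos hz₁).le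
  have hK : ‖z‖ / (1 - ‖z‖ ^ 2) ≤ 2 / 3 := by
    rw [div_le_iff₀ (one_sub_norm_sq_pos hz₁)]
    nlinarith [norm_nonneg z]
  refine (norm_schurIter_sub_le hz₁ ha hb hb' p).trans ?_
  gcongr
  exact (pow_le_of_le_one hK₀ (hK.trans (by norm_num)) hp.ne').trans hK

theorem exists_schurIter_eq_self {z : ℂ} (hz : ‖z‖ ≤ 1 / 2) {c : ℕ → ℂ} (hc : ∀ j, ‖c j‖ ≤ 1)
    {p : ℕ} (hp : 0 < p) : ∃ b : ℂ, ‖b‖ ≤ 1 ∧ schurIter z c b p = b := by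
  have hmaps : MapsTo (schurIter z c · p) (Metric.closedBall 0 1) (Metric.closedBall 0 1) :=
    fun b hb => mem_closedBall_zero_iff.mpr
      (norm_schurIter_le_one (by linarith) hc (mem_closedBall_zero_iff.mp hb) p)
  have hcontr : ContractingWith (2 / 3) (hmaps.restrict (schurIter z c · p) _ _) := by
    refine ⟨by rw [← NNReal.coe_lt_coe]; norm_num, LipschitzWith.of_dist_le_mul fun x y => ?_⟩
    simpa only [Subtype.dist_eq, MapsTo.val_restrict_apply, dist_eq_norm, NNReal.coe_div,
      NNReal.coe_ofNat] using norm_schurIter_sub_le_two_thirds hz hc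
        (mem_closedBall_zero_iff.mp x.2) (mem_closedBall_zero_iff.mp y.2) hp
  obtain ⟨b, hb, hfix, -⟩ := hcontr.exists_fixedPoint' Metric.isClosed_closedBall.isComplete hmaps
    (Metric.mem_closedBall_self zero_le_one) (edist_ne_top _ _)
  exact ⟨b, mem_closedBall_zero_iff.mp hb, hfix⟩

theorem tendsto_schurIter {ι : Type*} {l : Filter ι} {z : ℂ} (hz : ‖z‖ < 1) {a : ι → ℕ → ℂ}
    {c : ℕ → ℂ} (hc : ∀ j, ‖c j‖ ≤ 1) {b : ι → ℂ} {b₀ : ℂ} (hb₀ : ‖b₀‖ ≤ 1)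
    (hb : Tendsto b l (𝓝 b₀)) (n : ℕ) (ha : ∀ j < n, Tendsto (a · j) l (𝓝 (c j))) :
    Tendsto (fun i => schurIter z (a i) (b i) n) l (𝓝 (schurIter z c b₀ n)) := by
  induction n with
  | zero => exact hb
  | succ n ih =>
    have hb' := (ih fun j hj => ha j (hj.trans n.lt_succ_self)).const_mul z
    have ha' := ha n n.lt_succ_self
    exact (hb'.sub ((Complex.continuous_conj.tendsto _).comp ha')).div
      (tendsto_const_nhds.sub (ha'.mul hb'))
      (one_sub_mul_mul_ne_zero hz (hc n) (norm_schurIter_le_one hz hc hb₀ n))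

variable {c : ℕ → ℂ} {z b : ℂ}

theorem szegoProd_mulVec (hc : ∀ j, ‖c j‖ ≤ 1) (hz : ‖z‖ < 1) (hb : ‖b‖ ≤ 1) (n : ℕ) :
    szegoProd c z n *ᵥ ![b, 1] =
      (∏ i ∈ Finset.range n, (1 - c i * (z * schurIter z c b i))) • ![schurIter z c b n, 1] := by
  induction n with
  | zero => simp [szegoProd, schurIter]
  | succ n ih =>
    have hne : 1 - c n * (z * schurIter z c b n) ≠ 0 :=
      one_sub_mul_mul_ne_zero hz (hc n) (norm_schurIter_le_one hz hc hb n)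
    rw [szegoProd, ← Matrix.mulVec_mulVec, ih, Matrix.mulVec_smul, Finset.prod_range_succ,
      mul_smul, szegoMatrix_mulVec, schurIter, schurStep]
    congr 1
    rw [Matrix.smul_vec2, smul_eq_mul, smul_eq_mul, mul_div_cancel₀ _ hne, mul_one, mul_one]

variable (hc : ∀ j, ‖c j‖ < 1) {p : ℕ}

include hc

theorem add_inv_eq_discSq_of_eigenvalue (hz : z ≠ 0) {l : ℂ} (hl₀ : l ≠ 0)
    (hl : l ^ 2 - (tracePoly c p).eval z * l + rhoSq c p * z ^ p = 0) :
    l ^ 2 / (rhoSq c p * z ^ p) + (l ^ 2 / (rhoSq c p * z ^ p))⁻¹ = discSq c p z := by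
  have hR := rhoSq_ne_zero hc p
  have hτ : (tracePoly c p).eval z = (l ^ 2 + rhoSq c p * z ^ p) / l := by
    field_simp
    linear_combination -hl
  rw [discSq, hτ]
  field_simp
  ring

variable (hp : 0 < p) (hz₀ : z ≠ 0) (hz : ‖z‖ < 1) (hb : ‖b‖ ≤ 1)

include hp hz₀ hz hb

theorem rhoSq_mul_pow_lt_of_eigenvector {l : ℂ} (hl : szegoProd c z p *ᵥ ![b, 1] = l • ![b, 1]) :
    rhoSq c p * ‖z‖ ^ p < ‖l‖ ^ 2 := by
  have hD : 0 < rhoSq c p * ‖z‖ ^ p := mul_pos (rhoSq_pos hc p) (pow_pos (norm_pos_iff.mpr hz₀) p)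
  have hform := indefForm_szegoProd_mulVec_le hc hp hz ![b, 1]
  rw [hl, indefForm_smul] at hform
  simp only [indefForm, Matrix.cons_val_zero, Matrix.cons_val_one, norm_one, one_pow] at hform
  have hdecay : 0 < (1 - ‖z‖) * (‖b‖ ^ 2 + 1) := mul_pos (by linarith) (by positivity)
  have hb' : ‖b‖ ^ 2 - 1 ≤ 0 := sub_nonpos.mpr (pow_le_one₀ (norm_nonneg b) hb)
  by_contra! hcon
  nlinarith [mul_le_mul_of_nonpos_right hcon hb', mul_pos hD hdecay]

theorem integral_log_eq_sum_schurIter (hfix : schurIter z c b p = b) :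
    p * ∫ w, Real.log ‖z - w‖ ∂(discriminantMeasure fun j : Fin p => c j) =
      ∑ i ∈ Finset.range p, Real.log ‖1 - c i * (z * schurIter z c b i)‖ := by
  have hc₁ (j : ℕ) : ‖c j‖ ≤ 1 := (hc j).le
  have hne (i : ℕ) : 1 - c i * (z * schurIter z c b i) ≠ 0 :=
    one_sub_mul_mul_ne_zero hz (hc₁ i) (norm_schurIter_le_one hz hc₁ hb i)
  have hprod := szegoProd_mulVec hc₁ hz hb p
  rw [hfix] at hprod
  have hlog : Real.log ‖∏ i ∈ Finset.range p, (1 - c i * (z * schurIter z c b i))‖ =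
      ∑ i ∈ Finset.range p, Real.log ‖1 - c i * (z * schurIter z c b i)‖ := by
    rw [norm_prod, Real.log_prod fun i _ => norm_ne_zero_iff.mpr (hne i)]
  have hl₀ : ∏ i ∈ Finset.range p, (1 - c i * (z * schurIter z c b i)) ≠ 0 :=
    Finset.prod_ne_zero_iff.mpr fun i _ => hne i
  set l := ∏ i ∈ Finset.range p, (1 - c i * (z * schurIter z c b i))
  have hchar := (exists_eigenvector_iff c p z l).mp
    ⟨![b, 1], fun h => one_ne_zero (congrFun h 1), hprod⟩
  have hR := rhoSq_pos hc p
  have hD : 0 < rhoSq c p * ‖z‖ ^ p := mul_pos hR (pow_pos (norm_pos_iff.mpr hz₀) p)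
  have hY₀ : l ^ 2 / (rhoSq c p * z ^ p) ≠ 0 := div_ne_zero (pow_ne_zero 2 hl₀)
    (mul_ne_zero (rhoSq_ne_zero hc p) (pow_ne_zero p hz₀))
  have hlogY : |Real.log ‖l ^ 2 / (rhoSq c p * z ^ p)‖| =
      2 * Real.log ‖l‖ - Real.log (rhoSq c p * ‖z‖ ^ p) := by
    have hlD := rhoSq_mul_pow_lt_of_eigenvector hc hp hz₀ hz hb hprod
    rw [norm_div, norm_mul, norm_pow, norm_pow, Complex.norm_of_nonneg hR.le,
      abs_of_nonneg (Real.log_nonneg ((one_le_div hD).mpr hlD.le)),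
      Real.log_div (pow_ne_zero 2 (norm_ne_zero_iff.mpr hl₀)) hD.ne', Real.log_pow, Nat.cast_ofNat]
  rw [(integral_log_discriminantMeasure hc hp hz₀ hz.le hY₀
    (add_inv_eq_discSq_of_eigenvalue hc hz₀ hl₀ hchar)).2, hlogY, ← hlog]
  have : (p : ℝ) ≠ 0 := Nat.cast_ne_zero.mpr hp.ne'
  field_simp
  ring

end PeriodicSchur

/-! ### Limits along a ratio -/

section RatioLimits

/-- The filter on pairs `(n, N)` along which `n, N → ∞` and `u(n) / N → s`; a limit along it is the
doubly indexed limit `lim_{u(n)/N → s}`. -/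
noncomputable def ratioFilter (u : ℕ → ℕ) (s : ℝ) : Filter (ℕ × ℕ) :=
  (atTop ×ˢ atTop) ⊓ comap (fun q => (u q.1 : ℝ) / q.2) (𝓝 s)

instance (u : ℕ → ℕ) (s : ℝ) : (ratioFilter u s).IsCountablyGenerated := by
  unfold ratioFilter
  infer_instance

variable {ι : Type*} {l : Filter ι} {u : ℕ → ℕ} {s : ℝ}

theorem tendsto_ratioFilter_iff {f : ι → ℕ × ℕ} :
    Tendsto f l (ratioFilter u s) ↔ Tendsto (fun i => (f i).1) l atTop ∧
      Tendsto (fun i => (f i).2) l atTop ∧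
        Tendsto (fun i => (u (f i).1 : ℝ) / (f i).2) l (𝓝 s) := by
  rw [ratioFilter, tendsto_inf, tendsto_comap_iff, tendsto_prod_iff', and_assoc]
  rfl

theorem tendsto_fst_ratioFilter : Tendsto Prod.fst (ratioFilter u s) atTop :=
  (tendsto_ratioFilter_iff.mp tendsto_id).1

theorem tendsto_snd_ratioFilter : Tendsto Prod.snd (ratioFilter u s) atTop :=
  (tendsto_ratioFilter_iff.mp tendsto_id).2.1

theorem tendsto_div_ratioFilter :
    Tendsto (fun q : ℕ × ℕ => (u q.1 : ℝ) / q.2) (ratioFilter u s) (𝓝 s) :=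
  (tendsto_ratioFilter_iff.mp tendsto_id).2.2

theorem hasRatioLimit_iff_tendsto {E : Type*} [TopologicalSpace E] {X : ℕ → ℕ → E} {x : E} :
    HasRatioLimit u X s x ↔ Tendsto (fun q : ℕ × ℕ => X q.1 q.2) (ratioFilter u s) (𝓝 x) := by
  refine ⟨fun h => tendsto_of_seq_tendsto fun f hf => ?_, fun h n N hn hN hr => ?_⟩
  · obtain ⟨hn, hN, hr⟩ := tendsto_ratioFilter_iff.mp hf
    exact h _ _ hn hN hr
  · exact h.comp (tendsto_ratioFilter_iff (f := fun i => (n i, N i)) |>.mpr ⟨hn, hN, hr⟩)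

theorem tendsto_div_of_abs_sub_le {v w N : ι → ℝ} {C : ℝ} (hN : Tendsto N l atTop)
    (hvw : ∀ᶠ i in l, |w i - v i| ≤ C) (hv : Tendsto (fun i => v i / N i) l (𝓝 s)) :
    Tendsto (fun i => w i / N i) l (𝓝 s) := by
  have hdiff : Tendsto (fun i => (w i - v i) / N i) l (𝓝 0) := by
    refine squeeze_zero_norm' ?_ (hN.const_div_atTop C)
    filter_upwards [hvw, hN.eventually_ge_atTop 0] with i hi hNi
    rw [norm_div, Real.norm_of_nonneg hNi, Real.norm_eq_abs]
    gcongr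
  simpa [← add_div] using hdiff.add hv

theorem tendsto_pred_ratioFilter (p : ℕ) :
    Tendsto (fun q : ℕ × ℕ => (q.1 - 1, q.2)) (ratioFilter (· * p) s)
      (ratioFilter (· * p) s) := by
  refine tendsto_ratioFilter_iff.mpr ⟨(tendsto_sub_atTop_nat 1).comp tendsto_fst_ratioFilter,
    tendsto_snd_ratioFilter, tendsto_div_of_abs_sub_le (C := p)
      (tendsto_natCast_atTop_atTop.comp tendsto_snd_ratioFilter) ?_ tendsto_div_ratioFilter⟩
  filter_upwards [tendsto_fst_ratioFilter.eventually_ge_atTop 1] with q hq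
  have : (((q.1 - 1) * p : ℕ) : ℝ) - ((q.1 * p : ℕ) : ℝ) = -p := by
    push_cast [hq]
    ring
  rw [this, abs_neg, Nat.abs_cast]

theorem tendsto_zero_of_le_mul_add {T : ι → ι} (hT : Tendsto T l l) {e δ : ι → ℝ} {C r : ℝ}
    (he₀ : ∀ i, 0 ≤ e i) (heC : ∀ i, e i ≤ C) (hr₀ : 0 ≤ r) (hr₁ : r < 1)
    (hδ : Tendsto δ l (𝓝 0)) (hstep : ∀ᶠ i in l, e i ≤ r * e (T i) + δ i) :
    Tendsto e l (𝓝 0) := by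
  have hiter (m : ℕ) : ∀ ε > 0, ∀ᶠ i in l, e i ≤ r ^ m * C + ε := by
    induction m with
    | zero => exact fun ε hε => Eventually.of_forall fun i => by linarith [heC i]
    | succ m ih =>
      intro ε hε
      filter_upwards [hT.eventually (ih ε hε), hstep,
        hδ.eventually_le_const (mul_pos (sub_pos.mpr hr₁) hε)] with i hi hsi hδi
      rw [pow_succ]
      nlinarith [mul_le_mul_of_nonneg_left hi hr₀]
  refine Metric.tendsto_nhds.mpr fun ε hε => ?_
  have hC : Tendsto (fun m => r ^ m * C) atTop (𝓝 0) := by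
    simpa using (tendsto_pow_atTop_nhds_zero_of_lt_one hr₀ hr₁).mul_const C
  obtain ⟨m, hm⟩ := (hC.eventually_lt_const (half_pos hε)).exists
  filter_upwards [hiter m (ε / 2) (half_pos hε)] with i hi
  rw [Real.dist_0_eq_abs, abs_of_nonneg (he₀ i)]
  linarith

end RatioLimits

/-! ### Schur iterates of asymptotically periodic coefficients -/

section BlockLog

/-- The increment of `log |Φ_n^*(z)|` over the `k`-th period of length `p`, in terms of the
Schur iterates of the Verblunsky coefficients `a`. -/
noncomputable def blockLog (z : ℂ) (p : ℕ) (a : ℕ → ℂ) (k : ℕ) : ℝ :=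
  ∑ j ∈ Finset.range p, Real.log ‖1 - a (k * p + j) * (z * schurIter z a 1 (k * p + j))‖

theorem sum_blockLog (z : ℂ) (p : ℕ) (a : ℕ → ℂ) (L : ℕ) :
    ∑ k ∈ Finset.range L, blockLog z p a k =
      ∑ i ∈ Finset.range (L * p), Real.log ‖1 - a i * (z * schurIter z a 1 i)‖ := by
  induction L with
  | zero => simp
  | succ L ih => rw [Finset.sum_range_succ, ih, Nat.succ_mul, Finset.sum_range_add, blockLog]

variable {z : ℂ} (hz : ‖z‖ ≤ 1 / 2)

include hz

theorem abs_log_norm_one_sub_schurIter_le {a : ℕ → ℂ} (ha : ∀ n, ‖a n‖ ≤ 1) {w : ℂ} (hw : ‖w‖ ≤ 1)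
    (n : ℕ) : |Real.log ‖1 - w * (z * schurIter z a 1 n)‖| ≤ 1 := by
  have hle : ‖w * (z * schurIter z a 1 n)‖ ≤ 1 / 2 := (norm_mul_mul_le hw
    (norm_schurIter_le_one (hz.trans_lt (by norm_num)) ha norm_one.le n)).trans hz
  linarith [abs_log_norm_one_sub_le hle]

theorem abs_blockLog_le {a : ℕ → ℂ} (ha : ∀ n, ‖a n‖ ≤ 1) (p k : ℕ) : |blockLog z p a k| ≤ p := by
  refine (Finset.abs_sum_le_sum_abs _ _).trans ((Finset.sum_le_card_nsmul _ _ 1 fun j _ =>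
    abs_log_norm_one_sub_schurIter_le hz ha (ha _) _).trans ?_)
  rw [Finset.card_range, nsmul_one]

variable {α : ℕ → ℕ → ℂ} (hα : ∀ n N, ‖α n N‖ ≤ 1) {p : ℕ} (hp : 0 < p) {c : ℕ → ℂ} {s : ℝ}
  (hlim : ∀ j < p,
    Tendsto (fun q : ℕ × ℕ => α (q.1 * p + j) q.2) (ratioFilter (· * p) s) (𝓝 (c j)))

include hα hp hlim

theorem tendsto_schurIter_ratioFilter (hc : ∀ j, ‖c j‖ ≤ 1) {b : ℂ} (hb : ‖b‖ ≤ 1)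
    (hfix : schurIter z c b p = b) :
    Tendsto (fun q : ℕ × ℕ => schurIter z (α · q.2) 1 (q.1 * p)) (ratioFilter (· * p) s)
      (𝓝 b) := by
  have hz₁ : ‖z‖ < 1 := by linarith
  have hB (q : ℕ × ℕ) : ‖schurIter z (α · q.2) 1 (q.1 * p)‖ ≤ 1 :=
    norm_schurIter_le_one hz₁ (fun i => hα i _) norm_one.le _
  have hδ : Tendsto (fun q : ℕ × ℕ => ‖schurIter z (fun j => α ((q.1 - 1) * p + j) q.2) b p - b‖)
      (ratioFilter (· * p) s) (𝓝 0) := by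
    have hlast := tendsto_schurIter (a := fun (q : ℕ × ℕ) j => α ((q.1 - 1) * p + j) q.2) hz₁ hc hb
      tendsto_const_nhds p fun j hj => (hlim j hj).comp (tendsto_pred_ratioFilter p)
    rw [hfix] at hlast
    exact tendsto_iff_norm_sub_tendsto_zero.mp hlast
  refine tendsto_iff_norm_sub_tendsto_zero.mpr (tendsto_zero_of_le_mul_add (C := 2)
    (tendsto_pred_ratioFilter p) (fun q => norm_nonneg _) (fun q => ?_) (by norm_num)
    (by norm_num : (2 / 3 : ℝ) < 1) hδ ?_)
  · linarith [norm_sub_le (schurIter z (α · q.2) 1 (q.1 * p)) b, hB q]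
  · filter_upwards [tendsto_fst_ratioFilter.eventually_ge_atTop 1] with q hq
    have hperiod : schurIter z (α · q.2) 1 (q.1 * p) =
        schurIter z (fun j => α ((q.1 - 1) * p + j) q.2)
          (schurIter z (α · q.2) 1 ((q.1 - 1) * p)) p := by
      rw [← schurIter_add z (α · q.2), ← Nat.succ_mul, Nat.succ_eq_add_one, Nat.sub_add_cancel hq]
    rw [hperiod]
    exact (norm_sub_le_norm_sub_add_norm_sub _ _ _).trans (add_le_add_left
      (norm_schurIter_sub_le_two_thirds hz (fun j => hα _ _) (hB (q.1 - 1, q.2)) hb hp) _)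

theorem tendsto_blockLog (hc : ∀ j, ‖c j‖ < 1) (hz₀ : z ≠ 0) :
    Tendsto (fun q : ℕ × ℕ => blockLog z p (α · q.2) q.1) (ratioFilter (· * p) s)
      (𝓝 (p * ∫ w, Real.log ‖z - w‖ ∂(discriminantMeasure fun j : Fin p => c j))) := by
  have hz₁ : ‖z‖ < 1 := by linarith
  have hc₁ (j : ℕ) : ‖c j‖ ≤ 1 := (hc j).le
  obtain ⟨b, hb, hfix⟩ := exists_schurIter_eq_self hz hc₁ hp
  rw [integral_log_eq_sum_schurIter hc hp hz₀ hz₁ hb hfix]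
  refine tendsto_finsetSum _ fun j hj => ?_
  have hj' := Finset.mem_range.mp hj
  simp only [schurIter_add z (α · _) 1]
  have horbit := tendsto_schurIter hz₁ hc₁ hb (tendsto_schurIter_ratioFilter hz hα hp hlim hc₁ hb
    hfix) j fun m hm => hlim m (hm.trans hj')
  exact (tendsto_const_nhds.sub ((hlim j hj').mul (horbit.const_mul z))).norm.log
    (norm_ne_zero_iff.mpr (one_sub_mul_mul_ne_zero hz₁ (hc₁ j)
      (norm_schurIter_le_one hz₁ hc₁ hb j)))

end BlockLog

/-! ### Zero-counting measures of paraorthogonal polynomials -/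

section ZeroCounting

theorem integrable_sum_dirac (s : Multiset ℂ) (f : ℂ → ℝ) :
    Integrable f (s.map fun z => Measure.dirac z).sum := by
  induction s using Multiset.induction_on with
  | empty => simp
  | cons z s ih =>
    rw [Multiset.map_cons, Multiset.sum_cons]
    exact (integrable_dirac (by simp)).add_measure ih

theorem integral_sum_dirac (s : Multiset ℂ) (f : ℂ → ℝ) :
    ∫ z, f z ∂(s.map fun z => Measure.dirac z).sum = (s.map f).sum := by
  induction s using Multiset.induction_on with
  | empty => simp
  | cons z s ih =>
    rw [Multiset.map_cons, Multiset.sum_cons, Multiset.map_cons, Multiset.sum_cons,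
      integral_add_measure (integrable_dirac (by simp)) (integrable_sum_dirac s f), ih,
      integral_dirac]

theorem sum_dirac_univ (s : Multiset ℂ) :
    (s.map fun z => Measure.dirac z).sum univ = (s.card : ℝ≥0∞) := by
  induction s using Multiset.induction_on with
  | empty => simp
  | cons z s ih =>
    rw [Multiset.map_cons, Multiset.sum_cons, Measure.add_apply, ih, measure_univ,
      Multiset.card_cons, Nat.cast_succ, add_comm]

theorem ae_sum_dirac {s : Multiset ℂ} {P : ℂ → Prop} (hP : ∀ z ∈ s, P z) :
    ∀ᵐ z ∂(s.map fun z => Measure.dirac z).sum, P z := by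
  induction s using Multiset.induction_on with
  | empty => simp
  | cons z s ih =>
    rw [Multiset.map_cons, Multiset.sum_cons, ae_add_measure_iff, ae_dirac_eq]
    exact ⟨hP z (Multiset.mem_cons_self z s), ih fun w hw => hP w (Multiset.mem_cons_of_mem hw)⟩

theorem card_roots_popuc (β : ℂ) (a : ℕ → ℂ) (n : ℕ) : (popuc β a n).roots.card = n := by
  rw [splits_iff_card_roots.mp (IsAlgClosed.splits _), (isMonicOfDegree_popuc β a n).natDegree_eq]

theorem isProbabilityMeasure_popucZeroMeasure (β : ℂ) (a : ℕ → ℂ) {n : ℕ} (hn : n ≠ 0) :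
    IsProbabilityMeasure (popucZeroMeasure β a n) := by
  constructor
  rw [popucZeroMeasure, Measure.smul_apply, sum_dirac_univ, card_roots_popuc, smul_eq_mul]
  exact ENNReal.inv_mul_cancel (Nat.cast_ne_zero.mpr hn) (ENNReal.natCast_ne_top n)

theorem ae_norm_eq_one_popucZeroMeasure {β : ℂ} (hβ : ‖β‖ = 1) {a : ℕ → ℂ} (ha : ∀ n, ‖a n‖ < 1)
    (n : ℕ) : ∀ᵐ w ∂popucZeroMeasure β a n, ‖w‖ = 1 :=
  Measure.ae_smul_measure (ae_sum_dirac fun _ hw =>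
    norm_eq_one_of_isRoot_popuc hβ ha (isRoot_of_mem_roots hw)) _

variable {z β : ℂ} (hz : ‖z‖ ≤ 1 / 2) (hβ : ‖β‖ = 1) {a : ℕ → ℂ} (ha : ∀ n, ‖a n‖ ≤ 1)

include hz hβ ha

theorem integral_log_popucZeroMeasure_succ (n : ℕ) :
    ∫ w, Real.log ‖z - w‖ ∂popucZeroMeasure β a (n + 1) = ((n + 1 : ℕ) : ℝ)⁻¹ *
      (Real.log ‖1 - β * (z * schurIter z a 1 n)‖ +
        ∑ i ∈ Finset.range n, Real.log ‖1 - a i * (z * schurIter z a 1 i)‖) := by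
  have hz₁ : ‖z‖ < 1 := by linarith
  have hne {w : ℂ} (hw : ‖w‖ ≤ 1) (i : ℕ) : ‖1 - w * (z * schurIter z a 1 i)‖ ≠ 0 :=
    norm_ne_zero_iff.mpr
      (one_sub_mul_mul_ne_zero hz₁ hw (norm_schurIter_le_one hz₁ ha norm_one.le i))
  have hprod : ∏ i ∈ Finset.range n, ‖1 - a i * (z * schurIter z a 1 i)‖ ≠ 0 :=
    Finset.prod_ne_zero_iff.mpr fun i _ => hne (ha i) i
  have heval := norm_eval_popuc_succ hz₁ ha hβ n
  have hroot : (popuc β a (n + 1)).eval z ≠ 0 := by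
    rw [← norm_ne_zero_iff, heval]
    exact mul_ne_zero (hne hβ.le n) hprod
  rw [popucZeroMeasure, integral_smul_measure, integral_sum_dirac,
    ← log_norm_eval_eq_sum_roots (isMonicOfDegree_popuc β a (n + 1)).monic hroot, heval,
    Real.log_mul (hne hβ.le n) hprod, Real.log_prod fun i _ => hne (ha i) i, smul_eq_mul,
    ENNReal.toReal_inv, ENNReal.toReal_natCast]

theorem abs_integral_log_popucZeroMeasure_sub_le {p : ℕ} (hp : 0 < p) (n : ℕ) :
    |∫ w, Real.log ‖z - w‖ ∂popucZeroMeasure β a n -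
      (n : ℝ)⁻¹ * ∑ k ∈ Finset.range ((n - 1) / p), blockLog z p a k| ≤ (n : ℝ)⁻¹ * (p + 1) := by
  rcases n with - | n
  · simp [popucZeroMeasure, popuc]
  have hterm {w : ℂ} (hw : ‖w‖ ≤ 1) (i : ℕ) := abs_log_norm_one_sub_schurIter_le hz ha hw i
  have hblocks : ∑ i ∈ Finset.range n, Real.log ‖1 - a i * (z * schurIter z a 1 i)‖ =
      ∑ k ∈ Finset.range (n / p), blockLog z p a k + ∑ i ∈ Finset.range (n % p),
        Real.log ‖1 - a (n / p * p + i) * (z * schurIter z a 1 (n / p * p + i))‖ := by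
    rw [sum_blockLog, ← Finset.sum_range_add, Nat.div_add_mod']
  have hremainder : |∑ i ∈ Finset.range (n % p),
      Real.log ‖1 - a (n / p * p + i) * (z * schurIter z a 1 (n / p * p + i))‖| ≤ p := by
    refine (Finset.abs_sum_le_sum_abs _ _).trans
      ((Finset.sum_le_card_nsmul _ _ 1 fun i _ => hterm (ha _) _).trans ?_)
    rw [Finset.card_range, nsmul_one]
    exact_mod_cast (Nat.mod_lt n hp).le
  rw [integral_log_popucZeroMeasure_succ hz hβ ha, Nat.add_sub_cancel, ← mul_sub, abs_mul, abs_inv,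
    Nat.abs_cast, hblocks, add_sub_assoc, add_sub_cancel_left, add_comm (p : ℝ)]
  gcongr
  exact (abs_add_le _ _).trans (add_le_add (hterm hβ.le n) hremainder)

end ZeroCounting

/-! ### Riemann sums -/

section RiemannSums

theorem integral_comp_floor_div {h : ℝ} (hh : 0 < h) (F : ℕ → ℝ) (L : ℕ) :
    IntegrableOn (fun s : ℝ => F ⌊s / h⌋₊) (Ico 0 (L * h)) ∧
      ∫ s in Ico 0 (L * h), F ⌊s / h⌋₊ = h * ∑ k ∈ Finset.range L, F k := by
  induction L with
  | zero => simp
  | succ L ih =>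
    have hLh : 0 ≤ L * h := by positivity
    have hle : L * h ≤ (L + 1 : ℕ) * h := by gcongr; exact L.le_succ
    have hconst : EqOn (fun s : ℝ => F ⌊s / h⌋₊) (fun _ => F L)
        (Ico (L * h) ((L + 1 : ℕ) * h)) := by
      intro s hs
      have hfloor : ⌊s / h⌋₊ = L := by
        rw [Nat.floor_eq_iff (div_nonneg (hLh.trans hs.1) hh.le), le_div_iff₀ hh, div_lt_iff₀ hh]
        exact_mod_cast hs
      exact congrArg F hfloor
    have hint : IntegrableOn (fun s : ℝ => F ⌊s / h⌋₊) (Ico (L * h) ((L + 1 : ℕ) * h)) :=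
      IntegrableOn.congr_fun (integrableOn_const (by simp)) hconst.symm measurableSet_Ico
    rw [← Ico_union_Ico_eq_Ico hLh hle]
    refine ⟨ih.1.union hint, ?_⟩
    rw [setIntegral_union Ico_disjoint_Ico_same measurableSet_Ico ih.1 hint, ih.2,
      setIntegral_congr_fun measurableSet_Ico hconst, setIntegral_const,
      Real.volume_real_Ico_of_le hle, smul_eq_mul, Finset.sum_range_succ]
    push_cast
    ring

variable {ι : Type*} {l : Filter ι}

theorem tendsto_indicator_Ico_apply {r : ι → ℝ} {t s : ℝ} (hr : Tendsto r l (𝓝 t)) (hst : s ≠ t)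
    {f : ι → ℝ → ℝ} {g : ℝ → ℝ} (hf : s ∈ Icc 0 t → Tendsto (f · s) l (𝓝 (g s))) :
    Tendsto (fun i => (Ico 0 (r i)).indicator (f i) s) l (𝓝 ((Icc 0 t).indicator g s)) := by
  by_cases hs₀ : 0 ≤ s
  swap
  · rw [indicator_of_notMem fun h => hs₀ h.1]
    exact tendsto_const_nhds.congr fun i => (indicator_of_notMem (fun h => hs₀ h.1) _).symm
  rcases hst.lt_or_gt with hlt | hgt
  · have hs : s ∈ Icc 0 t := ⟨hs₀, hlt.le⟩
    rw [indicator_of_mem hs]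
    refine (hf hs).congr' ?_
    filter_upwards [hr.eventually_const_lt hlt] with i hi
    rw [indicator_of_mem (mem_Ico.mpr ⟨hs₀, hi⟩)]
  · rw [indicator_of_notMem fun h => hgt.not_ge h.2]
    refine tendsto_const_nhds.congr' ?_
    filter_upwards [hr.eventually_le_const hgt] with i hi
    rw [indicator_of_notMem fun h => h.2.not_ge hi]

theorem tendsto_riemannSum [l.IsCountablyGenerated] {t C : ℝ} {h : ι → ℝ} (hh : ∀ᶠ i in l, 0 < h i)
    {F : ι → ℕ → ℝ} (hF : ∀ i k, |F i k| ≤ C) {g : ℝ → ℝ}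
    (hlim : ∀ᵐ s ∂volume.restrict (Icc 0 t), Tendsto (fun i => F i ⌊s / h i⌋₊) l (𝓝 (g s)))
    {L : ι → ℕ} (hL : Tendsto (fun i => L i * h i) l (𝓝 t)) :
    Tendsto (fun i => h i * ∑ k ∈ Finset.range (L i), F i k) l (𝓝 (∫ s in Icc 0 t, g s)) := by
  have hval : ∀ᶠ i in l, ∫ s, (Ico 0 (L i * h i)).indicator (fun s => F i ⌊s / h i⌋₊) s =
      h i * ∑ k ∈ Finset.range (L i), F i k := by
    filter_upwards [hh] with i hi
    rw [integral_indicator measurableSet_Ico, (integral_comp_floor_div hi (F i) (L i)).2]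
  refine Tendsto.congr' hval ?_
  rw [← integral_indicator measurableSet_Icc]
  refine tendsto_integral_filter_of_dominated_convergence
    ((Ico 0 (t + 1)).indicator fun _ => C) ?_ ?_ ?_ ?_
  · refine Eventually.of_forall fun i => (Measurable.indicator ?_
      measurableSet_Ico).aestronglyMeasurable
    exact (measurable_from_nat (f := F i)).comp
      (Nat.measurable_floor.comp (measurable_id.div_const _))
  · filter_upwards [hL.eventually_le_const (lt_add_one t)] with i hi
    refine Eventually.of_forall fun s => ?_
    have : 0 ≤ C := (abs_nonneg _).trans (hF i 0)
    rw [norm_indicator_eq_indicator_norm]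
    exact (indicator_le_indicator_of_subset (Ico_subset_Ico_right hi)
      (fun _ => norm_nonneg _) s).trans (indicator_le_indicator (hF i _))
  · exact (integrable_indicator_iff measurableSet_Ico).mpr (integrableOn_const (by simp))
  · filter_upwards [(ae_restrict_iff' measurableSet_Icc).mp hlim, Measure.ae_ne volume t]
      with s hs hst
    exact tendsto_indicator_Ico_apply hL hst hs

theorem tendsto_floor_ratioFilter {p : ℕ} (hp : 0 < p) {s : ℝ} (hs : 0 < s) {N : ι → ℕ}
    (hN : Tendsto N l atTop) :
    Tendsto (fun i => (⌊s / (p / N i : ℝ)⌋₊, N i)) l (ratioFilter (· * p) s) := by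
  have hp' : (0 : ℝ) < p := Nat.cast_pos.mpr hp
  have hN' : Tendsto (fun i => (N i : ℝ)) l atTop := tendsto_natCast_atTop_atTop.comp hN
  have hmesh (i : ι) : s / (p / N i : ℝ) = s / p * N i := by
    rw [div_div_eq_mul_div, mul_div_right_comm]
  simp only [hmesh]
  refine tendsto_ratioFilter_iff.mpr ⟨tendsto_nat_floor_atTop.comp
    (hN'.const_mul_atTop (div_pos hs hp')), hN, ?_⟩
  have hfloor := ((tendsto_nat_floor_mul_div_atTop (div_pos hs hp').le).comp hN').mul_const (p : ℝ)
  rw [div_mul_cancel₀ s hp'.ne'] at hfloor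
  refine hfloor.congr fun i => ?_
  simp only [Function.comp_apply]
  push_cast
  ring

end RiemannSums

/-! ### Mixtures of measures -/

section Mixtures

variable {X Y : Type*} [MeasurableSpace X] [MeasurableSpace Y] {m : Measure X} {ν : X → Measure Y}

theorem exists_kernel_ae_eq (hν : AEMeasurable ν m) :
    ∃ κ : ProbabilityTheory.Kernel X Y, ν =ᵐ[m] κ :=
  ⟨⟨hν.mk ν, hν.measurable_mk⟩, hν.ae_eq_mk⟩

theorem ae_bind_of_ae_ae (hν : AEMeasurable ν m) {P : Y → Prop} (hP : MeasurableSet {y | P y})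
    (h : ∀ᵐ x ∂m, ∀ᵐ y ∂ν x, P y) : ∀ᵐ y ∂m.bind ν, P y := by
  obtain ⟨κ, hκ⟩ := exists_kernel_ae_eq hν
  rw [Measure.bind_congr_right hκ]
  refine Measure.ae_comp_of_ae_ae hP ?_
  filter_upwards [h, hκ] with x hx hκx
  rwa [← hκx]

theorem integral_bind {E : Type*} [NormedAddCommGroup E] [NormedSpace ℝ E]
    (hν : AEMeasurable ν m) {f : Y → E} (hf : Integrable f (m.bind ν)) :
    ∫ y, f y ∂m.bind ν = ∫ x, ∫ y, f y ∂ν x ∂m := by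
  obtain ⟨κ, hκ⟩ := exists_kernel_ae_eq hν
  rw [Measure.bind_congr_right hκ] at hf ⊢
  rw [Measure.comp_eq_comp_const_apply] at hf ⊢
  rw [ProbabilityTheory.Kernel.integral_comp hf, ProbabilityTheory.Kernel.const_apply]
  refine integral_congr_ae ?_
  filter_upwards [hκ] with x hx
  rw [hx]

end Mixtures

section Average

variable {t : ℝ} {ν : ℝ → Measure ℂ}

theorem averageMeasure_eq_bind (t : ℝ) (ν : ℝ → Measure ℂ) :
    averageMeasure t ν = (ENNReal.ofReal t⁻¹ • volume.restrict (Icc 0 t)).bind ν :=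
  (Measure.bind_smul _ _ _).symm

theorem isProbabilityMeasure_smul_restrict_Icc (ht : 0 < t) :
    IsProbabilityMeasure (ENNReal.ofReal t⁻¹ • (volume : Measure ℝ).restrict (Icc 0 t)) := by
  constructor
  rw [Measure.smul_apply, Measure.restrict_apply_univ, Real.volume_Icc, sub_zero, smul_eq_mul,
    ← ENNReal.ofReal_mul (inv_nonneg.mpr ht.le), inv_mul_cancel₀ ht.ne', ENNReal.ofReal_one]

variable (hν : AEMeasurable ν (volume.restrict (Icc 0 t)))

include hν

theorem isProbabilityMeasure_averageMeasure (ht : 0 < t)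
    (hprob : ∀ᵐ s ∂volume.restrict (Icc 0 t), IsProbabilityMeasure (ν s)) :
    IsProbabilityMeasure (averageMeasure t ν) := by
  have := isProbabilityMeasure_smul_restrict_Icc ht
  rw [averageMeasure_eq_bind]
  exact isProbabilityMeasure_bind (hν.smul_measure _) (Measure.ae_smul_measure hprob _)

theorem ae_norm_eq_one_averageMeasure
    (hcirc : ∀ᵐ s ∂volume.restrict (Icc 0 t), ∀ᵐ w ∂ν s, ‖w‖ = 1) :
    ∀ᵐ w ∂averageMeasure t ν, ‖w‖ = 1 :=
  Measure.ae_smul_measure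
    (ae_bind_of_ae_ae hν (measurableSet_eq_fun measurable_norm measurable_const) hcirc) _

theorem integral_averageMeasure (ht : 0 ≤ t) {f : ℂ → ℝ} (hf : Integrable f (averageMeasure t ν)) :
    ∫ w, f w ∂averageMeasure t ν = t⁻¹ * ∫ s in Icc 0 t, ∫ w, f w ∂ν s := by
  rw [averageMeasure_eq_bind] at hf ⊢
  rw [integral_bind (hν.smul_measure _) hf, integral_smul_measure,
    ENNReal.toReal_ofReal (inv_nonneg.mpr ht), smul_eq_mul]

end Average

/-! ### Measurable dependence on the coefficients -/

section Measurability

theorem continuous_szegoProd (n : ℕ) :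
    Continuous fun q : (ℕ → ℂ) × ℂ => szegoProd q.1 q.2 n := by
  induction n with
  | zero => exact continuous_const
  | succ n ih =>
    refine Continuous.matrix_mul (continuous_matrix fun i j => ?_) ih
    unfold szegoMatrix
    fin_cases i <;> fin_cases j <;> dsimp <;> fun_prop

theorem continuous_norm_eval_tracePoly (p : ℕ) :
    Continuous fun q : (ℕ → ℂ) × ℝ =>
      ‖(tracePoly q.1 p).eval (Complex.exp (q.2 * Complex.I))‖ ^ 2 := by
  have hexp : Continuous fun q : (ℕ → ℂ) × ℝ => (q.1, Complex.exp (q.2 * Complex.I)) := by fun_prop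
  simp only [eval_tracePoly]
  exact ((continuous_szegoProd p).comp hexp).matrix_trace.norm.pow 2

theorem measurable_rhoSq (p : ℕ) : Measurable fun c : ℕ → ℂ => rhoSq c p := by
  unfold rhoSq
  fun_prop

theorem measurable_discAngle (p : ℕ) :
    Measurable fun q : (ℕ → ℂ) × ℝ => discAngle q.1 p q.2 :=
  ((continuous_norm_eval_tracePoly p).measurable.div
    ((measurable_rhoSq p).comp measurable_fst)).sub_const 2

theorem deriv_discAngle (c : ℕ → ℂ) (p : ℕ) (θ : ℝ) :
    deriv (discAngle c p) θ =
      deriv (fun φ : ℝ => ‖(tracePoly c p).eval (Complex.exp (φ * Complex.I))‖ ^ 2) θ /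
        rhoSq c p := by
  change deriv (fun φ : ℝ => _ / rhoSq c p - 2) θ = _
  rw [deriv_sub_const, deriv_div_const]

theorem measurable_deriv_discAngle (p : ℕ) :
    Measurable fun q : (ℕ → ℂ) × ℝ => deriv (discAngle q.1 p) q.2 := by
  simp only [deriv_discAngle]
  exact (measurable_deriv_with_param
    (f := fun (c : ℕ → ℂ) (θ : ℝ) => ‖(tracePoly c p).eval (Complex.exp (θ * Complex.I))‖ ^ 2)
    (continuous_norm_eval_tracePoly p)).div ((measurable_rhoSq p).comp measurable_fst)

variable {X : Type*} [MeasurableSpace X] {p : ℕ} (hp : 0 < p)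

include hp

theorem measurable_discriminantMeasure {c : X → ℕ → ℂ} (hcm : Measurable c)
    (hc : ∀ x j, ‖c x j‖ < 1) : Measurable fun x => discriminantMeasure fun j : Fin p => c x j := by
  refine Measure.measurable_of_measurable_coe _ fun B hB => ?_
  have hpair : Measurable fun q : X × ℝ => (c q.1, q.2) := by fun_prop
  have hA := (measurable_discAngle p).comp hpair
  have hD := (measurable_deriv_discAngle p).comp hpair
  have hbands : MeasurableSet {q : X × ℝ | q.2 ∈ bandAngles (c q.1) p} :=
    (measurable_snd measurableSet_Ioc).inter (hA measurableSet_Ioo)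
  have hexp : Measurable fun q : X × ℝ => Complex.exp (q.2 * Complex.I) := by fun_prop
  have hind : Measurable (B.indicator (1 : ℂ → ℝ≥0∞)) := measurable_one.indicator hB
  have hdensity : Measurable ({q : X × ℝ | q.2 ∈ bandAngles (c q.1) p}.indicator fun q =>
      ENNReal.ofReal (|deriv (discAngle (c q.1) p) q.2| / √(4 - discAngle (c q.1) p q.2 ^ 2)) *
        B.indicator (1 : ℂ → ℝ≥0∞) (Complex.exp (q.2 * Complex.I))) :=
    ((hD.norm.div ((measurable_const.sub (hA.pow_const 2)).sqrt)).ennreal_ofReal.mul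
      (hind.comp hexp)).indicator hbands
  convert (hdensity.lintegral_prod_right' (ν := volume)).const_mul
    (ENNReal.ofReal ((2 * Real.pi * p)⁻¹)) using 2 with x
  rw [← lintegral_indicator_one hB, lintegral_discriminantMeasure (hc x) hp hind,
    ← lintegral_indicator (measurableSet_bandAngles _ _)]
  rfl

theorem aemeasurable_discriminantMeasure {m : Measure X} {a : Fin p → X → ℂ}
    (ha : ∀ j, AEMeasurable (a j) m) (ha₁ : ∀ j, ∀ᵐ x ∂m, ‖a j x‖ < 1) :
    AEMeasurable (fun x => discriminantMeasure fun j => a j x) m := by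
  have hext (i : ℕ) : ∃ g : X → ℂ, Measurable g ∧ (∀ x, ‖g x‖ < 1) ∧
      ∀ h : i < p, a ⟨i, h⟩ =ᵐ[m] g := by
    by_cases h : i < p
    · obtain ⟨g, hg, hrange, hag⟩ := (ha ⟨i, h⟩).exists_ae_eq_range_subset
        (t := {w : ℂ | ‖w‖ < 1}) (ha₁ ⟨i, h⟩) ⟨0, by simp⟩
      exact ⟨g, hg, fun x => hrange (mem_range_self x), fun _ => hag⟩
    · exact ⟨0, measurable_const, by simp, fun h' => absurd h' h⟩
  choose g hg hg₁ hag using hext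
  refine ⟨_, measurable_discriminantMeasure (c := fun x i => g i x) hp
    (measurable_pi_lambda _ hg) (fun x i => hg₁ i x), ?_⟩
  filter_upwards [ae_all_iff.mpr fun j : Fin p => hag j j.isLt] with x hx
  exact congrArg discriminantMeasure (funext hx)

end Measurability

/-! ### The limit of the zero-counting measures -/

section Limit

variable {t : ℝ} (ht : 0 < t) {p : ℕ} (hp : 0 < p)

include hp in
theorem tendsto_div_pred_ratioFilter :
    Tendsto (fun q : ℕ × ℕ => ((q.1 - 1) / p : ℕ) * (p / q.2 : ℝ)) (ratioFilter (fun n => n) t)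
      (𝓝 t) := by
  have hN : Tendsto (fun q : ℕ × ℕ => (q.2 : ℝ)) (ratioFilter (fun n => n) t) atTop :=
    tendsto_natCast_atTop_atTop.comp tendsto_snd_ratioFilter
  refine (tendsto_div_of_abs_sub_le (C := p + 1) (w := fun q => ((q.1 - 1) / p * p : ℕ)) hN
    (.of_forall fun q => ?_) tendsto_div_ratioFilter).congr fun q => ?_
  · have hmod := Nat.div_add_mod' (q.1 - 1) p
    have hlt := Nat.mod_lt (q.1 - 1) hp
    have hupper : (((q.1 - 1) / p * p : ℕ) : ℝ) ≤ q.1 := by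
      exact_mod_cast (by lia)
    have hlower : (q.1 : ℝ) ≤ ((q.1 - 1) / p * p : ℕ) + (p + 1) := by
      exact_mod_cast (by lia)
    rw [abs_le]
    constructor <;> linarith
  · push_cast
    ring

include hp in
theorem tendsto_sum_div_of_ratioFilter {F : ℕ → ℕ → ℝ} {C : ℝ} (hF : ∀ k N, |F k N| ≤ C)
    {g : ℝ → ℝ} (hlim : ∀ᵐ s ∂volume.restrict (Icc 0 t),
      Tendsto (fun q : ℕ × ℕ => F q.1 q.2) (ratioFilter (· * p) s) (𝓝 (g s))) :
    Tendsto (fun q : ℕ × ℕ => (p / q.2 : ℝ) * ∑ k ∈ Finset.range ((q.1 - 1) / p), F k q.2)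
      (ratioFilter (fun n => n) t) (𝓝 (∫ s in Icc 0 t, g s)) := by
  refine tendsto_riemannSum (F := fun q k => F k q.2) ?_ (fun q k => hF k q.2) ?_
    (tendsto_div_pred_ratioFilter hp)
  · filter_upwards [tendsto_snd_ratioFilter.eventually_gt_atTop 0] with q hq
    positivity
  · filter_upwards [hlim, ae_restrict_of_ae (Measure.ae_ne volume 0),
      ae_restrict_mem measurableSet_Icc] with s hs hs₀ hst
    exact hs.comp (tendsto_floor_ratioFilter hp (lt_of_le_of_ne hst.1 hs₀.symm)
      tendsto_snd_ratioFilter)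

include ht in
theorem tendsto_ratioFilter_inv_mul (c : ℝ) {S : ℕ × ℕ → ℝ} {y : ℝ}
    (hS : Tendsto (fun q => c / q.2 * S q) (ratioFilter (fun n => n) t) (𝓝 (c * y)))
    (hc : c ≠ 0) :
    Tendsto (fun q => (q.1 : ℝ)⁻¹ * S q) (ratioFilter (fun n => n) t) (𝓝 (t⁻¹ * y)) := by
  have h := (tendsto_div_ratioFilter.inv₀ ht.ne').mul (hS.const_mul c⁻¹)
  rw [inv_mul_cancel_left₀ hc] at h
  refine h.congr' ?_
  filter_upwards [tendsto_snd_ratioFilter.eventually_gt_atTop 0] with q hq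
  have : (q.2 : ℝ) ≠ 0 := by positivity
  field_simp

variable {α : ℕ → ℕ → ℂ} {z β : ℂ} (hz : ‖z‖ ≤ 1 / 2) (hβ : ‖β‖ = 1)

include ht hp hz hβ in
theorem tendsto_integral_log_popucZeroMeasure (hα : ∀ n N, ‖α n N‖ ≤ 1) {U : ℝ → ℝ}
    (hU : ∀ᵐ s ∂volume.restrict (Icc 0 t),
      Tendsto (fun q : ℕ × ℕ => blockLog z p (α · q.2) q.1) (ratioFilter (· * p) s)
        (𝓝 (p * U s))) :
    Tendsto (fun q : ℕ × ℕ => ∫ w, Real.log ‖z - w‖ ∂popucZeroMeasure β (α · q.2) q.1)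
      (ratioFilter (fun n => n) t) (𝓝 (t⁻¹ * ∫ s in Icc 0 t, U s)) := by
  have hsum := tendsto_sum_div_of_ratioFilter hp (F := fun k N => blockLog z p (α · N) k)
    (fun k N => abs_blockLog_le hz (hα · N) p k) hU
  rw [integral_const_mul] at hsum
  have hmain := tendsto_ratioFilter_inv_mul ht p hsum (by positivity)
  have herror : Tendsto (fun q : ℕ × ℕ => (q.1 : ℝ)⁻¹ * (p + 1)) (ratioFilter (fun n => n) t)
      (𝓝 0) := by
    simpa using (tendsto_inv_atTop_nhds_zero_nat.comp tendsto_fst_ratioFilter).mul_const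
      ((p : ℝ) + 1)
  have hdiff := squeeze_zero_norm (fun q : ℕ × ℕ => (Real.norm_eq_abs _).trans_le <|
    abs_integral_log_popucZeroMeasure_sub_le hz hβ (hα · q.2) hp q.1) herror
  simpa using hdiff.add hmain

theorem hasRatioLimit_integral_popucZeroMeasure {α : ℕ → ℕ → ℂ} {β : ℂ} (hβ : ‖β‖ = 1)
    (hα : ∀ n N, ‖α n N‖ < 1) {ν : Measure ℂ} [IsProbabilityMeasure ν] (hν : ∀ᵐ w ∂ν, ‖w‖ = 1)
    (h : ∀ z : ℂ, z ≠ 0 → ‖z‖ ≤ 1 / 2 →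
      Tendsto (fun q : ℕ × ℕ => ∫ w, Real.log ‖z - w‖ ∂popucZeroMeasure β (α · q.2) q.1)
        (ratioFilter (fun n => n) t) (𝓝 (∫ w, Real.log ‖z - w‖ ∂ν))) (f : ℂ →ᵇ ℝ) :
    HasRatioLimit (fun n => n) (fun n N => ∫ z, f z ∂popucZeroMeasure β (α · N) n) t
      (∫ z, f z ∂ν) := by
  rw [hasRatioLimit_iff_tendsto]
  -- For `n = 0` the zero-counting measure vanishes, so the indices are shifted to `n - 1 + 1`.
  have hpos : ∀ᶠ q : ℕ × ℕ in ratioFilter (fun n => n) t, q.1 - 1 + 1 = q.1 := by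
    filter_upwards [tendsto_fst_ratioFilter.eventually_ge_atTop 1] with q hq
    lia
  have (q : ℕ × ℕ) : IsProbabilityMeasure (popucZeroMeasure β (α · q.2) (q.1 - 1 + 1)) :=
    isProbabilityMeasure_popucZeroMeasure β _ (Nat.succ_ne_zero _)
  have hlim := tendsto_integral_of_potential (l := ratioFilter (fun n => n) t)
    (μ := fun q : ℕ × ℕ => popucZeroMeasure β (α · q.2) (q.1 - 1 + 1))
    (fun q => ae_norm_eq_one_popucZeroMeasure hβ (hα · q.2) _) hν
    (fun z hz₀ hz => (h z hz₀ hz).congr' (hpos.mono fun q hq => by simp only [hq])) f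
  exact hlim.congr' (hpos.mono fun q hq => by simp only [hq])

theorem exists_nat_extension {a : Fin p → ℂ} (ha : ∀ j, ‖a j‖ < 1) :
    ∃ c : ℕ → ℂ, (∀ i, ‖c i‖ < 1) ∧ (fun j : Fin p => c j) = a := by
  refine ⟨fun i => if h : i < p then a ⟨i, h⟩ else 0, fun i => ?_, by simp⟩
  dsimp only
  split_ifs with h
  · exact ha ⟨i, h⟩
  · simp

end Limit

theorem theorem4p5 (t : ℝ) (ht : 0 < t) (p : ℕ) (hp : 0 < p)
    (a : Fin p → ℝ → ℂ)
    (ha_meas : ∀ j, AEMeasurable (a j) (volume.restrict (Icc 0 t)))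
    (ha_disk : ∀ j, ∀ s ∈ Icc (0 : ℝ) t, ‖a j s‖ < 1)
    (α : ℕ → ℕ → ℂ) (hα_disk : ∀ n N, ‖α n N‖ < 1)
    (hα_lim : ∀ j : Fin p, ∀ᵐ s ∂(volume.restrict (Icc 0 t)),
      HasRatioLimit (fun k => k * p) (fun k N => α (k * p + j) N) s (a j s))
    (β : ℂ) (hβ : ‖β‖ = 1) :
    (∀ s ∈ Icc (0 : ℝ) t,
      IsEquilibriumMeasure (bandSet fun j => a j s) (discriminantMeasure fun j => a j s)) ∧
    AEMeasurable (fun s => discriminantMeasure fun j => a j s) (volume.restrict (Icc 0 t)) ∧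
    ∀ f : ℂ →ᵇ ℝ,
      HasRatioLimit (fun n => n)
        (fun n N => ∫ z, f z ∂(popucZeroMeasure β (fun m => α m N) n)) t
        (∫ z, f z ∂(averageMeasure t fun s => discriminantMeasure fun j => a j s)) := by
  have hext (s : ℝ) (hs : s ∈ Icc 0 t) := exists_nat_extension fun j => ha_disk j s hs
  choose! c hc hca using hext
  have hmem := ae_restrict_mem (μ := volume) (measurableSet_Icc (a := (0 : ℝ)) (b := t))
  have hequi (s : ℝ) (hs : s ∈ Icc 0 t) :
      IsEquilibriumMeasure (bandSet fun j => a j s) (discriminantMeasure fun j => a j s) := by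
    rw [← hca s hs]
    exact isEquilibriumMeasure_discriminantMeasure (hc s hs) hp
  have hcirc (s : ℝ) (hs : s ∈ Icc 0 t) : ∀ᵐ w ∂discriminantMeasure fun j => a j s, ‖w‖ = 1 := by
    rw [← hca s hs]
    exact ae_norm_eq_one_discriminantMeasure (hc s hs) hp
  have hmeas := aemeasurable_discriminantMeasure hp ha_meas fun j => hmem.mono (ha_disk j)
  have := isProbabilityMeasure_averageMeasure hmeas ht (hmem.mono fun s hs => (hequi s hs).1)
  have hcirc_avg := ae_norm_eq_one_averageMeasure hmeas (hmem.mono hcirc)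
  refine ⟨hequi, hmeas, hasRatioLimit_integral_popucZeroMeasure hβ hα_disk hcirc_avg
    fun z hz₀ hz => ?_⟩
  rw [integral_averageMeasure hmeas ht.le (integrable_log_norm_sub hcirc_avg hz)]
  refine tendsto_integral_log_popucZeroMeasure ht hp hz hβ (fun n N => (hα_disk n N).le) ?_
  filter_upwards [ae_all_iff.mpr hα_lim, hmem] with s hs hst
  rw [← hca s hst]
  refine tendsto_blockLog hz (fun n N => (hα_disk n N).le) hp (fun j hj => ?_) (hc s hst) hz₀
  have hlim := hasRatioLimit_iff_tendsto.mp (hs ⟨j, hj⟩)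
  rwa [← congrFun (hca s hst) ⟨j, hj⟩] at hlim
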